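/- Let $\phi$ be the Hamming, the $\ell_1$ or the $\ell_2$ metric, and put $p=1$ for the Hamming and the $\ell_1$ metric, $p=2$ for the $\ell_2$ metric. There are absolute constants $C,c,\kappa$ and a randomized dynamic data structure (four fixed programs: build, insert, delete, enumerate) on a word RAM with the following property. Let $n\ge 2$, $q\ge 2$, $d$ be integers and $r>0$ a real number such that $\max(1,r)^p\log_2 n\le d$. The domain universe is $U=\{0,\dots,q-1\}^d\subset\mathbb R^d$ (the Hamming cube if $q=2$). The machine has words of $\kappa(\lfloor\log_2(ndq)\rfloor+1)$ bits, unit-cost word operations, and may draw uniform random integers. The data structure is built for two families of points $A,B$ with $|A|+|B|=n$, and then undergoes an arbitrary sequence of operations, each of which inserts a point into $A$ or $B$, deletes a point, or enumerates the similarity join; at all times $|A|+|B|\le 2n$. The points carry distinct names in $\{0,\dots,2n-1\}$ (so that equal points are allowed), and the sequence of operations (kind of operation, side $A$ or $B$, names) is fixed in advance. For all points, all random choices and all such sequences, every operation halts, and * the data structure never uses more than $C\,nd\,(\log_2 n)^c=\tilde O(nd)$ words of memory; * it is constructed in time at most $C\,nd\,(\log_2 n)^c=\tilde O(nd)$; *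 every insertion and every deletion takes time at most $C\,d\,(\log_2 n)^c=\tilde O(d)$. If moreover the initial points and the inserted points are independent and uniformly distributed in $U$, and independent of the random choices of the data structure, then each enumeration operation has the following property with probability at least $1-2/n$: it reports precisely the pairs $(a,b)\in A\times B$ (for the current $A,B$) with $\phi(a,b)\le r$, each exactly once, and with delay at most $C\,d\,(\log_2 n)^c=\tilde O(d)$; that is, the time from the start to the first report, between any two consecutive reports, and from the last report to the end is at most this number. -/

import Mathlib

open MeasureTheory

/-! ### Points, metrics, the uniform distribution -/

/-- The domain universe: the points of `ℝ^d` with coordinates in `{0, …, q - 1}`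
(for `q = 2` this is the Hamming cube). -/
abbrev Point (d q : ℕ) : Type := Fin d → Fin q

/-- The three metrics considered. -/
inductive JoinMetric where
  | hamming
  | l1
  | l2

namespace JoinMetric

/-- The distance of two points of the universe. -/
noncomputable def dist (φ : JoinMetric) {d q : ℕ} (x y : Point d q) : ℝ :=
  match φ with
  | hamming => (hammingDist x y : ℝ)
  | l1 => ∑ i, |((x i : ℕ) : ℝ) - ((y i : ℕ) : ℝ)|
  | l2 => Real.sqrt (∑ i, (((x i : ℕ) : ℝ) - ((y i : ℕ) : ℝ)) ^ 2)

/-- The power of the distance which is a sum over the coordinates. On the universe,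
`dist ^ exponent` takes integer values, and it is at least the Hamming distance. -/
def exponent : JoinMetric → ℕ
  | hamming => 1
  | l1 => 1
  | l2 => 2

end JoinMetric

/-- The uniform distribution on a finite nonempty type. -/
noncomputable def uniform (α : Type) [Fintype α] [Nonempty α] [MeasurableSpace α] : Measure α :=
  (PMF.uniformOfFintype α).toMeasure

instance (α : Type) [Fintype α] [Nonempty α] [MeasurableSpace α] :
    IsProbabilityMeasure (uniform α) := by
  unfold uniform
  infer_instance

/-- The law of a sequence of independent uniform points of the universe. -/
noncomputable def pointLaw (d q : ℕ) [NeZero q] : Measure (ℕ → Point d q) :=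
  Measure.infinitePi fun _ => uniform (Point d q)

/-- The random source of the machine: the entry at `(j, m)` is the integer in `{0, …, m}` that is
returned when the `j`-th random request of the machine asks for an integer of that range. -/
abbrev Tape : Type := (p : ℕ × ℕ) → Fin (p.2 + 1)

/-- All entries of the tape are independent, and each is uniform on its range. -/
noncomputable def tapeLaw : Measure Tape :=
  Measure.infinitePi fun p : ℕ × ℕ => uniform (Fin (p.2 + 1))

/-! ### A word RAM with a random source -/

/-- Arithmetic on words. Comparisons return `0` or `1`. -/
inductive BinOp where
  | add | sub | mul | div | mod | lt | eq

/-- Addition and multiplication are modulo `2 ^ w`, subtraction is cut off at `0`, division is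
integer division. -/
def BinOp.eval (w : ℕ) : BinOp → ℕ → ℕ → ℕ
  | add, a, b => (a + b) % 2 ^ w
  | sub, a, b => a - b
  | mul, a, b => (a * b) % 2 ^ w
  | div, a, b => a / b
  | mod, a, b => a % b
  | lt, a, b => if a < b then 1 % 2 ^ w else 0
  | eq, a, b => if a = b then 1 % 2 ^ w else 0

/-- Expressions over the registers, the memory and the read-only input of the current operation. -/
inductive Expr where
  | const (c : ℕ)
  | reg (x : ℕ)
  | load (a : Expr)
  | input (a : Expr)
  | bin (o : BinOp) (a b : Expr)

/-- Programs. A program is a finite text, so it uses finitely many registers. -/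
inductive Stmt where
  | skip
  | assign (x : ℕ) (e : Expr)
  | store (a e : Expr)
  | rand (x : ℕ) (e : Expr)
  | emit (a b : Expr)
  | seq (s t : Stmt)
  | ite (e : Expr) (s t : Stmt)
  | while (e : Expr) (s : Stmt)

/-- A configuration of the machine. -/
structure Config where
  /-- the registers -/
  reg : ℕ → ℕ
  /-- the memory -/
  mem : ℕ → ℕ
  /-- the size of the memory used so far: all addresses written so far are smaller -/
  size : ℕ
  /-- the number of random requests made so far -/
  draws : ℕ
  /-- the number of steps made in the current operation -/
  time : ℕ
  /-- the results reported in the current operation, in chronological order: the time of the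
  report and the two words reported -/
  out : List (ℕ × ℕ × ℕ)

/-- The initial configuration. -/
def Config.init : Config where
  reg := fun _ => 0
  mem := fun _ => 0
  size := 0
  draws := 0
  time := 0
  out := []

/-- Start of a new operation: clock and list of results are reset, all else is kept. -/
def Config.fresh (σ : Config) : Config := { σ with time := 0, out := [] }

/-- `k` steps of the machine go by. -/
def Config.tick (σ : Config) (k : ℕ) : Config := { σ with time := σ.time + k }

namespace Expr

/-- The value of an expression on a machine with words of `w` bits and input `I`. -/
def eval (w : ℕ) (I : List ℕ) (σ : Config) : Expr → ℕ
  | const c => c % 2 ^ w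
  | reg x => σ.reg x
  | load a => σ.mem (a.eval w I σ)
  | input a => (I.getD (a.eval w I σ) 0) % 2 ^ w
  | bin o a b => o.eval w (a.eval w I σ) (b.eval w I σ)

/-- The number of steps needed to evaluate an expression: one for each of its nodes. -/
def cost : Expr → ℕ
  | const _ => 1
  | reg _ => 1
  | load a => a.cost + 1
  | input a => a.cost + 1
  | bin _ a b => a.cost + b.cost + 1

end Expr

/-- `Exec w I ω s σ σ'`: on a machine with words of `w` bits, with input `I` and random source `ω`,
the program `s` started in `σ` halts in `σ'`. -/
inductive Exec (w : ℕ) (I : List ℕ) (ω : Tape) : Stmt → Config → Config → Prop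
  | skip (σ : Config) : Exec w I ω .skip σ σ
  | assign (σ : Config) (x : ℕ) (e : Expr) :
      Exec w I ω (.assign x e) σ
        { σ.tick (e.cost + 1) with reg := Function.update σ.reg x (e.eval w I σ) }
  | store (σ : Config) (a e : Expr) :
      Exec w I ω (.store a e) σ
        { σ.tick (a.cost + e.cost + 1) with
          mem := Function.update σ.mem (a.eval w I σ) (e.eval w I σ)
          size := max σ.size (a.eval w I σ + 1) }
  | rand (σ : Config) (x : ℕ) (e : Expr) :
      Exec w I ω (.rand x e) σ
        { σ.tick (e.cost + 1) with
          reg := Function.update σ.reg x (ω (σ.draws, e.eval w I σ) : ℕ)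
          draws := σ.draws + 1 }
  | emit (σ : Config) (a b : Expr) :
      Exec w I ω (.emit a b) σ
        { σ.tick (a.cost + b.cost + 1) with
          out := σ.out ++
            [(σ.time + (a.cost + b.cost + 1), a.eval w I σ, b.eval w I σ)] }
  | seq (s t : Stmt) (σ σ' σ'' : Config) (h : Exec w I ω s σ σ') (h' : Exec w I ω t σ' σ'') :
      Exec w I ω (.seq s t) σ σ''
  | ite_true (e : Expr) (s t : Stmt) (σ σ' : Config) (he : e.eval w I σ ≠ 0)
      (h : Exec w I ω s (σ.tick (e.cost + 1)) σ') : Exec w I ω (.ite e s t) σ σ'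
  | ite_false (e : Expr) (s t : Stmt) (σ σ' : Config) (he : e.eval w I σ = 0)
      (h : Exec w I ω t (σ.tick (e.cost + 1)) σ') : Exec w I ω (.ite e s t) σ σ'
  | while_true (e : Expr) (s : Stmt) (σ σ' σ'' : Config) (he : e.eval w I σ ≠ 0)
      (h : Exec w I ω s (σ.tick (e.cost + 1)) σ') (h' : Exec w I ω (.while e s) σ' σ'') :
      Exec w I ω (.while e s) σ σ''
  | while_false (e : Expr) (s : Stmt) (σ : Config) (he : e.eval w I σ = 0) :
      Exec w I ω (.while e s) σ (σ.tick (e.cost + 1))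

/-! ### Dynamic similarity join -/

/-- An operation on a structure that was built for `n` points. The points stored carry distinct
names from `{0, …, 2 n - 1}`, so that there are never more than `2 n` of them. -/
inductive Op (n : ℕ) where
  /-- insert a new point under the name `s` into `A` (`side = true`) or `B` (`side = false`) -/
  | insert (s : Fin (2 * n)) (side : Bool)
  /-- delete the point named `s` -/
  | delete (s : Fin (2 * n))
  /-- enumerate the similarity join -/
  | enumerate

/-- The points present before the `t`-th operation: for every name in use, the side (`true` for
`A`, `false` for `B`) and the index of the point in the sequence of all points. The structure is
built for the points with indices `0, …, n - 1`; an insertion that is the `t`-th operation inserts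
the point with index `n + t`. -/
def roster (n : ℕ) (side : ℕ → Bool) (ops : ℕ → Op n) : ℕ → Fin (2 * n) → Option (Bool × ℕ)
  | 0 => fun s => if (s : ℕ) < n then some (side s, s) else none
  | t + 1 =>
    match ops t with
    | .insert s b => Function.update (roster n side ops t) s (some (b, n + t))
    | .delete s => Function.update (roster n side ops t) s none
    | .enumerate => roster n side ops t

/-- Insertions use names that are free, deletions names that are in use. -/
def ValidOps (n : ℕ) (side : ℕ → Bool) (ops : ℕ → Op n) : Prop :=
  ∀ t, match ops t with
    | .insert s _ => roster n side ops t s = none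
    | .delete s => roster n side ops t s ≠ none
    | .enumerate => True

/-- The names `a`, `b` form a result of the similarity join before the `t`-th operation. -/
def IsResult (φ : JoinMetric) {n d q : ℕ} (r : ℝ) (side : ℕ → Bool) (ops : ℕ → Op n)
    (x : ℕ → Point d q) (t : ℕ) (a b : Fin (2 * n)) : Prop :=
  ∃ u v : ℕ, roster n side ops t a = some (true, u) ∧ roster n side ops t b = some (false, v) ∧
    φ.dist (x u) (x v) ≤ r

/-- A dynamic data structure: one program for each kind of operation. -/
structure JoinStructure where
  build : Stmt
  insert : Stmt
  delete : Stmt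
  enumerate : Stmt

/-- The program that carries out an operation. -/
def JoinStructure.prog (P : JoinStructure) {n : ℕ} : Op n → Stmt
  | .insert _ _ => P.insert
  | .delete _ => P.delete
  | .enumerate => P.enumerate

/-- The coordinates of a point as a list of words. -/
def Point.words {d q : ℕ} (p : Point d q) : List ℕ := List.ofFn fun i => (p i : ℕ)

/-- The input of the construction: the parameters and the `n` initial points with their sides.
The threshold is given as the integer part of `r ^ exponent`; as `dist ^ exponent` is an integer,
this determines which distances are at most `r`. -/
noncomputable def buildInput (φ : JoinMetric) (n d q : ℕ) (r : ℝ) (side : ℕ → Bool)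
    (x : ℕ → Point d q) : List ℕ :=
  [n, d, q, ⌊r ^ φ.exponent⌋₊] ++
    (List.range n).flatMap fun i => (side i).toNat :: (x i).words

/-- The input of the operation `o`, where `p` is the point to be inserted if `o` is an insertion. -/
def opInput {n d q : ℕ} (o : Op n) (p : Point d q) : List ℕ :=
  match o with
  | .insert s b => (s : ℕ) :: b.toNat :: p.words
  | .delete s => [(s : ℕ)]
  | .enumerate => []

/-- `σ 0, σ 1, …` are the configurations after the construction and after the operations
`0, 1, …`, each of which halts. -/
def IsRun (φ : JoinMetric) (P : JoinStructure) (w : ℕ) {n d q : ℕ} (r : ℝ) (side : ℕ → Bool)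
    (ops : ℕ → Op n) (x : ℕ → Point d q) (ω : Tape) (σ : ℕ → Config) : Prop :=
  Exec w (buildInput φ n d q r side x) ω P.build Config.init (σ 0) ∧
    ∀ t, Exec w (opInput (ops t) (x (n + t))) ω (P.prog (ops t)) (σ t).fresh (σ (t + 1))

/-- The operation that ended in `σ` has reported precisely the pairs in `R`, each of them once. -/
def Config.Reports (σ : Config) {N : ℕ} (R : Fin N → Fin N → Prop) : Prop :=
  (σ.out.map Prod.snd).Nodup ∧
    ∀ i j : ℕ, (i, j) ∈ σ.out.map Prod.snd ↔ ∃ a b : Fin N, (a : ℕ) = i ∧ (b : ℕ) = j ∧ R a b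

/-- The operation that ended in `σ` had delay at most `D`: at most `D` steps from its start to the
first report, between consecutive reports, and from the last report to its end. -/
def Config.DelayAtMost (σ : Config) (D : ℝ) : Prop :=
  List.IsChain (fun s t : ℕ => (t : ℝ) ≤ s + D) (0 :: (σ.out.map Prod.fst ++ [σ.time]))

/-! Put `D = Nat.clog 2 n` and let `R` be the integer part of `r ^ exponent`. The hypothesis on `r`
gives `D ≤ d` and `n ^ R ≤ 2 ^ d`. In each of the three metrics a result differs in at most `R`
coordinates, since every differing coordinate contributes at least 1 to the power of the distance.
Hence there are three cases. If `R ≤ 3`, the two points of a result differ in at most three of the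
first `D` coordinates. There are `D ^ 3` tables, one for each triple of coordinates below `D`. The
key of a point in a table is the number with the first `D` coordinates other than the triple as its
digits in base `q`, reduced modulo `M = n / K + 1`. The table whose triple covers all differences
gives both points the same key (`exists_key_eq`). If `R ≥ 4` and `n ≥ K ≥ 2 ^ 44`, then with
probability at least `1 - 1 / n` no two of the current points are within Hamming distance `R`, by a
union bound over pairs and the estimate `choose_mul_two_pow_le`; then the join is empty. If `n < K`,
then `M = 1`, and all points share one bucket in every table.

A key has at least `D - 3` free digits, so a random point falls into a given bucket with probability
at most `(K + 8) / n`. A union bound over sets of points and over all buckets shows that with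
probability at least `1 - 1 / n` no bucket holds more than `cap = L * D` points. The two good events
together are `Par.Fair`, and `prob_fair` bounds their probability.

The programs are deterministic, and their time bounds hold for all inputs. A bucket is a doubly
linked list of names with a counter. A further list contains the buckets that have at most `cap`
points and hold a pair to be reported, where a pair is reported only in the first table in which its
keys agree. An update changes one bucket per table and recomputes the status of that bucket by
examining all its pairs, unless it is too large (`wp_refresh`). Enumeration walks along the list of
buckets. Each bucket on it yields a report, so the delay is at most about two visits
(`wp_enumProg`). Under `Par.Fair` the reports are exactly the join (`mem_reports`), and they are
never repeated (`nodup_reports`).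

The programs are verified by a weakest precondition calculus for total correctness that also tracks
clock, memory size and output. `exists_isRun` chains the operations into a run. -/

/-! ### Notation for expressions and programs -/

instance : Add Expr := ⟨Expr.bin .add⟩
instance : Sub Expr := ⟨Expr.bin .sub⟩
instance : Mul Expr := ⟨Expr.bin .mul⟩
instance : Div Expr := ⟨Expr.bin .div⟩
instance : Mod Expr := ⟨Expr.bin .mod⟩

namespace Expr

/-- Comparison of words. -/
def less (a b : Expr) : Expr := .bin .lt a b

/-- Test for equality of words. -/
def same (a b : Expr) : Expr := .bin .eq a b

variable (w : ℕ) (I : List ℕ) (σ : Config) (a b : Expr)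

@[simp] theorem eval_add : (a + b).eval w I σ = (a.eval w I σ + b.eval w I σ) % 2 ^ w := rfl
@[simp] theorem eval_sub : (a - b).eval w I σ = a.eval w I σ - b.eval w I σ := rfl
@[simp] theorem eval_mul : (a * b).eval w I σ = (a.eval w I σ * b.eval w I σ) % 2 ^ w := rfl
@[simp] theorem eval_div : (a / b).eval w I σ = a.eval w I σ / b.eval w I σ := rfl
@[simp] theorem eval_mod : (a % b).eval w I σ = a.eval w I σ % b.eval w I σ := rfl
@[simp] theorem eval_less : (less a b).eval w I σ =
    if a.eval w I σ < b.eval w I σ then 1 % 2 ^ w else 0 := rfl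
@[simp] theorem eval_same : (same a b).eval w I σ =
    if a.eval w I σ = b.eval w I σ then 1 % 2 ^ w else 0 := rfl
@[simp] theorem eval_const (k : ℕ) : (const k).eval w I σ = k % 2 ^ w := rfl
@[simp] theorem eval_reg (x : ℕ) : (reg x).eval w I σ = σ.reg x := rfl
@[simp] theorem eval_load : (load a).eval w I σ = σ.mem (a.eval w I σ) := rfl
@[simp] theorem eval_input : (input a).eval w I σ = (I.getD (a.eval w I σ) 0) % 2 ^ w := rfl

@[simp] theorem cost_add : (a + b).cost = a.cost + b.cost + 1 := rfl
@[simp] theorem cost_sub : (a - b).cost = a.cost + b.cost + 1 := rfl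
@[simp] theorem cost_mul : (a * b).cost = a.cost + b.cost + 1 := rfl
@[simp] theorem cost_div : (a / b).cost = a.cost + b.cost + 1 := rfl
@[simp] theorem cost_mod : (a % b).cost = a.cost + b.cost + 1 := rfl
@[simp] theorem cost_less : (less a b).cost = a.cost + b.cost + 1 := rfl
@[simp] theorem cost_same : (same a b).cost = a.cost + b.cost + 1 := rfl
@[simp] theorem cost_const (k : ℕ) : (const k).cost = 1 := rfl
@[simp] theorem cost_reg (x : ℕ) : (reg x).cost = 1 := rfl
@[simp] theorem cost_load : (load a).cost = a.cost + 1 := rfl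
@[simp] theorem cost_input : (input a).cost = a.cost + 1 := rfl

end Expr

/-- A sequence of programs. -/
def block : List Stmt → Stmt
  | [] => .skip
  | s :: l => .seq s (block l)

/-- The loop over `x = 0, 1, …` below the content of register `b`. -/
def forLoop (x b : ℕ) (s : Stmt) : Stmt :=
  block [.assign x (.const 0), .while (.less (.reg x) (.reg b)) (block [s, .assign x (.reg x + .const 1)])]

/-! ### Weakest preconditions -/

/-- Every step only adds to the clock. Through `wp.mono` this supplies the lower bounds on times of
reports that `Emits` asks for. -/
theorem Exec.time_le {w : ℕ} {I : List ℕ} {ω : Tape} {s : Stmt} {σ σ' : Config}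
    (h : Exec w I ω s σ σ') : σ.time ≤ σ'.time := by
  induction h with
  | skip => exact le_rfl
  | assign => simp [Config.tick]
  | store => simp [Config.tick]
  | rand => simp [Config.tick]
  | emit => simp [Config.tick]
  | seq s t σ σ' σ'' _ _ h h' => exact h.trans h'
  | ite_true e s t σ σ' _ _ h => simp only [Config.tick] at h; omega
  | ite_false e s t σ σ' _ _ h => simp only [Config.tick] at h; omega
  | while_true e s σ σ' σ'' _ _ _ h h' => simp only [Config.tick] at h; omega
  | while_false => simp [Config.tick]

/-- Total correctness: started in `σ`, the program halts in a configuration with property `Q`. -/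
def wp (w : ℕ) (I : List ℕ) (ω : Tape) (s : Stmt) (Q : Config → Prop) (σ : Config) : Prop :=
  ∃ σ', Exec w I ω s σ σ' ∧ Q σ'

section wp
variable {w : ℕ} {I : List ℕ} {ω : Tape} {Q Q' : Config → Prop} {σ : Config} {s : Stmt}

theorem wp.mono (h : wp w I ω s Q σ) (hQ : ∀ σ', σ.time ≤ σ'.time → Q σ' → Q' σ') :
    wp w I ω s Q' σ := by
  obtain ⟨σ', h, h'⟩ := h
  exact ⟨σ', h, hQ _ h.time_le h'⟩

/-- Makes the postcondition opaque for the simplifier. -/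
theorem wp.intro (h : ∀ P : Config → Prop, (∀ τ, Q τ → P τ) → wp w I ω s P σ) :
    wp w I ω s Q σ :=
  h Q fun _ => id

@[simp] theorem wp_skip : wp w I ω .skip Q σ ↔ Q σ :=
  ⟨fun ⟨_, h, h'⟩ => by cases h; exact h', fun h => ⟨_, .skip _, h⟩⟩

@[simp] theorem wp_seq {t : Stmt} :
    wp w I ω (.seq s t) Q σ ↔ wp w I ω s (wp w I ω t Q) σ :=
  ⟨fun ⟨_, h, h'⟩ => by cases h with | seq _ _ _ τ _ h1 h2 => exact ⟨τ, h1, _, h2, h'⟩,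
    fun ⟨_, h, _, h1, h2⟩ => ⟨_, .seq _ _ _ _ _ h h1, h2⟩⟩

@[simp] theorem wp_block_nil : wp w I ω (block []) Q σ ↔ Q σ := wp_skip

@[simp] theorem wp_block_cons {l : List Stmt} :
    wp w I ω (block (s :: l)) Q σ ↔ wp w I ω s (wp w I ω (block l) Q) σ := wp_seq

@[simp] theorem wp_assign {x : ℕ} {e : Expr} : wp w I ω (.assign x e) Q σ ↔
    Q { σ with
      reg := Function.update σ.reg x (e.eval w I σ)
      time := σ.time + (e.cost + 1) } :=
  ⟨fun ⟨_, h, h'⟩ => by cases h; exact h', fun h => ⟨_, .assign _ _ _, h⟩⟩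

@[simp] theorem wp_store {a e : Expr} : wp w I ω (.store a e) Q σ ↔
    Q { σ with
      mem := Function.update σ.mem (a.eval w I σ) (e.eval w I σ)
      size := max σ.size (a.eval w I σ + 1)
      time := σ.time + (a.cost + e.cost + 1) } :=
  ⟨fun ⟨_, h, h'⟩ => by cases h; exact h', fun h => ⟨_, .store _ _ _, h⟩⟩

@[simp] theorem wp_emit {a b : Expr} : wp w I ω (.emit a b) Q σ ↔
    Q { σ with
      time := σ.time + (a.cost + b.cost + 1)
      out := σ.out ++ [(σ.time + (a.cost + b.cost + 1), a.eval w I σ, b.eval w I σ)] } :=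
  ⟨fun ⟨_, h, h'⟩ => by cases h; exact h', fun h => ⟨_, .emit _ _ _, h⟩⟩

@[simp] theorem wp_ite {e : Expr} {t : Stmt} : wp w I ω (.ite e s t) Q σ ↔
    if e.eval w I σ = 0 then wp w I ω t Q { σ with time := σ.time + (e.cost + 1) }
    else wp w I ω s Q { σ with time := σ.time + (e.cost + 1) } := by
  constructor
  · rintro ⟨_, h, h'⟩
    cases h with
    | ite_true _ _ _ _ _ he h => rw [if_neg he]; exact ⟨_, h, h'⟩
    | ite_false _ _ _ _ _ he h => rw [if_pos he]; exact ⟨_, h, h'⟩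
  · intro h
    split_ifs at h with he
    · exact ⟨_, .ite_false _ _ _ _ _ he h.choose_spec.1, h.choose_spec.2⟩
    · exact ⟨_, .ite_true _ _ _ _ _ he h.choose_spec.1, h.choose_spec.2⟩

theorem wp_while_step {e : Expr} (he : e.eval w I σ ≠ 0)
    (h : wp w I ω s (wp w I ω (.while e s) Q) { σ with time := σ.time + (e.cost + 1) }) :
    wp w I ω (.while e s) Q σ := by
  obtain ⟨τ, h, τ', h', hQ⟩ := h
  exact ⟨τ', .while_true _ _ _ _ _ he h h', hQ⟩

theorem wp_while_exit {e : Expr} (he : e.eval w I σ = 0)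
    (h : Q { σ with time := σ.time + (e.cost + 1) }) :
    wp w I ω (.while e s) Q σ :=
  ⟨_, .while_false _ _ _ he, h⟩

/-- A loop that is controlled by a counter. -/
theorem wp_while_nat {e : Expr} (N : ℕ) (J : ℕ → Config → Prop) (h0 : J 0 σ)
    (hs : ∀ i < N, ∀ τ, J i τ → e.eval w I τ ≠ 0 ∧
      wp w I ω s (J (i + 1)) { τ with time := τ.time + (e.cost + 1) })
    (hN : ∀ τ, J N τ → e.eval w I τ = 0 ∧ Q { τ with time := τ.time + (e.cost + 1) }) :
    wp w I ω (.while e s) Q σ := by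
  suffices ∀ k i τ, i + k = N → J i τ → wp w I ω (.while e s) Q τ from this N 0 σ (by simp) h0
  intro k
  induction k with
  | zero =>
    intro i τ hi h
    obtain rfl : i = N := by omega
    exact wp_while_exit (hN _ h).1 (hN _ h).2
  | succ k ih =>
    intro i τ hi h
    obtain ⟨h1, h2⟩ := hs i (by omega) τ h
    exact wp_while_step h1 (h2.mono fun τ' _ h' => ih (i + 1) τ' (by omega) h')

/-- A loop that runs through a list. -/
theorem wp_while_list {α : Type} {e : Expr} (l : List α) (J : List α → List α → Config → Prop)
    (h0 : J [] l σ)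
    (hs : ∀ l₁ a l₂, l = l₁ ++ a :: l₂ → ∀ τ, J l₁ (a :: l₂) τ → e.eval w I τ ≠ 0 ∧
      wp w I ω s (J (l₁ ++ [a]) l₂) { τ with time := τ.time + (e.cost + 1) })
    (hN : ∀ τ, J l [] τ → e.eval w I τ = 0 ∧ Q { τ with time := τ.time + (e.cost + 1) }) :
    wp w I ω (.while e s) Q σ := by
  suffices ∀ l₂ l₁ τ, l = l₁ ++ l₂ → J l₁ l₂ τ → wp w I ω (.while e s) Q τ from
    this l [] σ (by simp) h0
  intro l₂
  induction l₂ with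
  | nil =>
    intro l₁ τ hl h
    obtain rfl : l₁ = l := by simpa using hl.symm
    exact wp_while_exit (hN _ h).1 (hN _ h).2
  | cons a l₂ ih =>
    intro l₁ τ hl h
    obtain ⟨h1, h2⟩ := hs l₁ a l₂ hl τ h
    exact wp_while_step h1 (h2.mono fun τ' _ h' => ih (l₁ ++ [a]) τ' (by simpa using hl) h')

/-- The bound on `N` keeps the counter from wrapping around. The constants are the costs of the loop
control: 2 for the initialization, 4 for each test and 4 for each increment. The body has to
preserve the counter and the bound. -/
theorem wp_forLoop {x b : ℕ} (N : ℕ) (J : ℕ → Config → Prop) (hb : σ.reg b = N)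
    (hN : N < 2 ^ w) (hxb : x ≠ b)
    (h0 : J 0 { σ with reg := Function.update σ.reg x 0, time := σ.time + 2 })
    (hs : ∀ i < N, ∀ τ, J i τ → τ.reg x = i → τ.reg b = N →
      wp w I ω s (fun τ' => τ'.reg x = i ∧ τ'.reg b = N ∧
        J (i + 1) { τ' with reg := Function.update τ'.reg x (i + 1), time := τ'.time + 4 })
        { τ with time := τ.time + 4 })
    (hQ : ∀ τ, J N τ → τ.reg x = N → τ.reg b = N → Q { τ with time := τ.time + 4 }) :
    wp w I ω (forLoop x b s) Q σ := by
  simp only [forLoop, wp_block_cons, wp_assign]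
  refine wp_while_nat N (fun i τ => J i τ ∧ τ.reg x = i ∧ τ.reg b = N) ?_ ?_ ?_
  · refine ⟨?_, ?_, ?_⟩
    · simpa using h0
    · simp
    · simp [Function.update_of_ne hxb.symm, hb]
  · rintro i hi τ ⟨hJ, hx, hb⟩
    have h1 : 1 % 2 ^ w = 1 := Nat.mod_eq_of_lt (by omega)
    refine ⟨by simp [hx, hb, hi, h1], ?_⟩
    rw [wp_block_cons]
    refine (hs i hi τ hJ hx hb).mono ?_
    rintro τ' - ⟨hx', hb', hJ'⟩
    have h2 : (i + 1) % 2 ^ w = i + 1 := Nat.mod_eq_of_lt (by omega)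
    simpa [hx', hb', h1, h2, Function.update_of_ne hxb.symm] using hJ'
  · rintro τ ⟨hJ, hx, hb⟩
    exact ⟨by simp [hx, hb], by simpa using hQ τ hJ hx hb⟩

end wp

/-! ### Parameters, keys, and the test of a single pair -/

/-- The contribution of a coordinate to the power of the distance. -/
def JoinMetric.gap : JoinMetric → ℕ → ℕ → ℕ
  | hamming, a, b => 1 - if a = b then 1 else 0
  | l1, a, b => (a - b) + (b - a)
  | l2, a, b => ((a - b) + (b - a)) * ((a - b) + (b - a))

/-- The expression that computes `JoinMetric.gap`. -/
def JoinMetric.gapExpr : JoinMetric → Expr → Expr → Expr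
  | hamming, a, b => .const 1 - .same a b
  | l1, a, b => (a - b) + (b - a)
  | l2, a, b => ((a - b) + (b - a)) * ((a - b) + (b - a))

theorem JoinMetric.gap_le (φ : JoinMetric) {q a b : ℕ} (ha : a < q) (hb : b < q) :
    φ.gap a b ≤ q * q := by
  have h : a - b + (b - a) ≤ q := by omega
  have h1 : q ≤ q * q := Nat.le_mul_self q
  cases φ with
  | hamming => simp only [gap]; omega
  | l1 => exact h.trans h1
  | l2 => exact Nat.mul_le_mul h h

theorem JoinMetric.eval_gapExpr (φ : JoinMetric) {w : ℕ} {I : List ℕ} {σ : Config} {a b : Expr}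
    {q u v : ℕ} (ha : a.eval w I σ = u) (hb : b.eval w I σ = v) (hu : u < q) (hv : v < q)
    (hq : q * q + 1 < 2 ^ w) :
    (φ.gapExpr a b).eval w I σ = φ.gap u v := by
  have h := φ.gap_le hu hv
  have h1 : 1 % 2 ^ w = 1 := Nat.mod_eq_of_lt (by omega)
  have h2 := JoinMetric.gap_le .l1 hu hv
  cases φ with
  | hamming => simp [gap, gapExpr, ha, hb, h1]
  | l1 => simpa [gap, gapExpr, ha, hb] using Nat.mod_eq_of_lt (by simp only [gap] at h; omega)
  | l2 =>
    have h3 : (u - v + (v - u)) % 2 ^ w = u - v + (v - u) :=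
      Nat.mod_eq_of_lt (by simp only [gap] at h2; omega)
    simpa [gap, gapExpr, ha, hb, h3] using Nat.mod_eq_of_lt (by simp only [gap] at h; omega)

theorem JoinMetric.cost_gapExpr_le (φ : JoinMetric) (a b : Expr) :
    (φ.gapExpr a b).cost ≤ 4 * (a.cost + b.cost) + 7 := by
  cases φ <;> simp [gapExpr] <;> omega

/-- The parameters of the data structure: the metric, the dimension `d`, the size `q` of the
alphabet, the threshold `R`, the number `D` of coordinates used for keys, the number `E` of tables,
the number `M` of keys, the largest size `cap` of a bucket that is examined, and the number `N`
of names. -/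
structure Par where
  φ : JoinMetric
  d : ℕ
  q : ℕ
  R : ℕ
  D : ℕ
  E : ℕ
  M : ℕ
  cap : ℕ
  N : ℕ

namespace Par
variable (p : Par)

/-- All addresses in use are smaller. -/
def space : ℕ := 64 * (p.N * p.E) + 64 * (p.M * p.E) + 16 * (p.N * p.d) + 8 * p.N + 1000

/-- Words of `w` bits suffice for all computations. -/
structure Fits (w : ℕ) : Prop where
  M_pos : 0 < p.M
  E_pos : 0 < p.E
  D_le : p.D ≤ p.d
  lt : p.space + p.M * p.q + p.q + p.d * (p.q * p.q) + p.q * p.q + p.cap + p.d + p.E < 2 ^ w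

/-- The machine holds the parameters in its registers. -/
structure Loaded (σ : Config) : Prop where
  d : σ.reg 0 = p.d
  q : σ.reg 1 = p.q
  R : σ.reg 2 = p.R
  D : σ.reg 3 = p.D
  E : σ.reg 4 = p.E
  M : σ.reg 5 = p.M
  cap : σ.reg 6 = p.cap

/-- The coordinates that are left out by the key with number `S`. -/
def Skips (S i : ℕ) : Prop := i = S % p.D ∨ i = S / p.D % p.D ∨ i = S / p.D / p.D

instance (S i : ℕ) : Decidable (p.Skips S i) := by unfold Skips; infer_instance

/-- The key with number `S`, computed from the first `i` coordinates. -/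
def keyUpTo (S : ℕ) (x : ℕ → ℕ) : ℕ → ℕ
  | 0 => 0
  | i + 1 => if p.Skips S i then keyUpTo S x i else (keyUpTo S x i * p.q + x i) % p.M

/-- The key with number `S`. -/
def key (S : ℕ) (x : ℕ → ℕ) : ℕ := p.keyUpTo S x p.D

/-- The power of the distance. -/
def gapSum (x y : ℕ → ℕ) : ℕ := ∑ i ∈ Finset.range p.d, p.φ.gap (x i) (y i)

/-- `u` and `v` form a result that is to be reported in the table `S`, the first table where they
have the same key. -/
def good (S : ℕ) (u v : ℕ × (ℕ → ℕ)) : Bool :=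
  decide (u.1 = 1 ∧ v.1 = 0 ∧ p.gapSum u.2 v.2 ≤ p.R ∧ ∀ T < S, p.key T u.2 ≠ p.key T v.2)

/-- A side (`0` or `1`) and coordinates in the alphabet. -/
structure Valid (u : ℕ × (ℕ → ℕ)) : Prop where
  side : u.1 ≤ 1
  lt : ∀ i < p.d, u.2 i < p.q

/-- The memory holds the point `u` under the name `s`, and its keys with numbers up to `S`. -/
structure Stored (mem : ℕ → ℕ) (S s : ℕ) (u : ℕ × (ℕ → ℕ)) : Prop where
  side : mem (8 * s + 4) = u.1
  coord : ∀ i < p.d, mem (8 * (s * p.d + i) + 3) = u.2 i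
  key : ∀ T ≤ S, mem (8 * (s * p.E + T) + 2) = p.key T u.2

end Par

/-- A computation of at most `T` steps that changes registers with numbers at least `k` only. -/
structure Calm (k T : ℕ) (σ τ : Config) : Prop where
  reg : ∀ y < k, τ.reg y = σ.reg y
  mem : τ.mem = σ.mem
  out : τ.out = σ.out
  size : τ.size = σ.size
  time : τ.time ≤ σ.time + T

theorem Par.Loaded.congr {p : Par} {σ τ : Config} (h : p.Loaded σ)
    (hreg : ∀ y < 7, τ.reg y = σ.reg y) : p.Loaded τ := by
  obtain ⟨h0, h1, h2, h3, h4, h5, h6⟩ := h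
  constructor <;> rw [hreg _ (by norm_num)] <;> assumption

/-- Row-major indexing. It bounds addresses of coordinates and nodes, numbers of buckets, and values
of numbers written in base `q`. -/
theorem name_mul_add_lt {s N a E : ℕ} (hs : s < N) (ha : a < E) : s * E + a < N * E := by
  calc s * E + a < s * E + E := by omega
    _ = (s + 1) * E := by ring
    _ ≤ N * E := Nat.mul_le_mul_right _ hs

open Expr in
/-- Decides whether the points with names in the registers 25 and 26 are to be reported in the
table whose number is in register 10. -/
def JoinMetric.test (φ : JoinMetric) : Stmt :=
  block [
    .assign 27 (load (const 8 * reg 25 + const 4) * (const 1 - load (const 8 * reg 26 + const 4))),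
    .assign 28 (const 0),
    forLoop 29 0 (.assign 28 (reg 28 +
      φ.gapExpr (load (const 8 * (reg 25 * reg 0 + reg 29) + const 3))
        (load (const 8 * (reg 26 * reg 0 + reg 29) + const 3)))),
    .ite (less (reg 2) (reg 28)) (.assign 27 (const 0)) .skip,
    forLoop 29 10 (.ite (same (load (const 8 * (reg 25 * reg 4 + reg 29) + const 2))
      (load (const 8 * (reg 26 * reg 4 + reg 29) + const 2))) (.assign 27 (const 0)) .skip)]

namespace Par
variable {p : Par}

theorem key_lt (hM : 0 < p.M) (S : ℕ) (x : ℕ → ℕ) : p.key S x < p.M := by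
  unfold key
  induction p.D with
  | zero => exact hM
  | succ i ih =>
    rw [keyUpTo]
    split_ifs
    exacts [ih, Nat.mod_lt _ hM]

open Expr
variable {w : ℕ} {I : List ℕ} {ω : Tape} {σ : Config}

/-- Register 27 starts as the product that is 1 exactly for a point of `A` followed by a point of
`B`. It is cleared if the sum of the gaps exceeds the threshold, and again if the keys agree in some
earlier table. `Fits` excludes overflow in every intermediate value. -/
theorem wp_test (hp : p.Fits w) (hσ : p.Loaded σ) {S a b : ℕ} (hS : σ.reg 10 = S) (hSE : S < p.E)
    (ha : σ.reg 25 = a) (hb : σ.reg 26 = b) (haN : a < p.N) (hbN : b < p.N) {u v : ℕ × (ℕ → ℕ)}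
    (hu : p.Valid u) (hv : p.Valid v) (hua : p.Stored σ.mem S a u) (hvb : p.Stored σ.mem S b v) :
    wp w I ω p.φ.test (fun τ => Calm 27 (150 * (p.d + p.E + 1)) σ τ ∧
      τ.reg 27 = if p.good S u v then 1 else 0) σ := by
  have hlt := hp.lt
  unfold space at hlt
  have hu1 := hu.side
  have hv1 := hv.side
  have hadd : ∀ i < p.d, a * p.d + i < p.N * p.d := fun i hi => name_mul_add_lt haN hi
  have hbdd : ∀ i < p.d, b * p.d + i < p.N * p.d := fun i hi => name_mul_add_lt hbN hi
  have haE : ∀ i < p.E, a * p.E + i < p.N * p.E := fun i hi => name_mul_add_lt haN hi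
  have hbE : ∀ i < p.E, b * p.E + i < p.N * p.E := fun i hi => name_mul_add_lt hbN hi
  have hsum : ∀ k ≤ p.d, ∑ i ∈ Finset.range k, p.φ.gap (u.2 i) (v.2 i) ≤ p.d * (p.q * p.q) := by
    intro k hk
    calc _ ≤ ∑ i ∈ Finset.range k, p.q * p.q := Finset.sum_le_sum fun i hi => by
          have := Finset.mem_range.1 hi
          exact p.φ.gap_le (hu.lt i (by omega)) (hv.lt i (by omega))
      _ = k * (p.q * p.q) := by simp
      _ ≤ _ := Nat.mul_le_mul_right _ hk
  have hm : u.1 * (1 - v.1) ≤ 1 := Nat.mul_le_mul hu1 (Nat.sub_le _ _)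
  have h29 : (29 : ℕ) ≠ 10 := by norm_num
  rw [JoinMetric.test, wp_block_cons]
  simp (disch := omega) [Nat.mod_eq_of_lt, ha, hb, hua.side, hvb.side]
  refine wp_forLoop p.d (fun i τ => Calm 27 (50 + i * 140) σ τ ∧ τ.reg 27 = u.1 * (1 - v.1) ∧
    τ.reg 28 = ∑ j ∈ Finset.range i, p.φ.gap (u.2 j) (v.2 j)) ?_ (by omega) (by norm_num) ?_ ?_ ?_
  · simpa using hσ.d
  · refine ⟨⟨fun y hy => ?_, ?_, ?_, ?_, ?_⟩, ?_, ?_⟩ <;>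
      simp (disch := omega) [Function.update_of_ne, add_assoc]
  · rintro i hi τ ⟨hc, h27, h28⟩ hx hd
    have h1 := hadd i hi
    have h2 := hbdd i hi
    have h3 : (load (const 8 * (reg 25 * reg 0 + reg 29) + const 3)).eval w I
        { τ with time := τ.time + 4 } = u.2 i := by
      rw [← hua.coord i hi]
      simp (disch := omega) [Nat.mod_eq_of_lt, hx, hd, hc.reg, ha, hc.mem]
    have h4 : (load (const 8 * (reg 26 * reg 0 + reg 29) + const 3)).eval w I
        { τ with time := τ.time + 4 } = v.2 i := by
      rw [← hvb.coord i hi]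
      simp (disch := omega) [Nat.mod_eq_of_lt, hx, hd, hc.reg, hb, hc.mem]
    have h5 := p.φ.eval_gapExpr h3 h4 (hu.lt i hi) (hv.lt i hi) (by omega)
    have h6 := p.φ.cost_gapExpr_le (load (const 8 * (reg 25 * reg 0 + reg 29) + const 3))
      (load (const 8 * (reg 26 * reg 0 + reg 29) + const 3))
    have h7 := hsum (i + 1) (by omega)
    have h8 := hc.time
    rw [Finset.sum_range_succ] at h7
    simp at h6
    rw [wp_assign, eval_add, h5, eval_reg, h28, Nat.mod_eq_of_lt (by omega)]
    refine ⟨by simp [hx], by simp [hd], ⟨?_, ?_, ?_, ?_, ?_⟩, ?_, ?_⟩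
    · intro y hy
      simp (disch := omega) [Function.update_of_ne, hc.reg]
    · exact hc.mem
    · exact hc.out
    · exact hc.size
    · simp; omega
    · simpa using h27
    · simp [Finset.sum_range_succ]
  rintro τ ⟨hc, h27, h28⟩ - -
  have h1 := hsum p.d le_rfl
  have hc1 := hc.time
  -- Both outcomes of the comparison with the threshold continue with the loop over the earlier
  -- keys, so that loop is verified once for an arbitrary state before it.
  have hlast : ∀ τ : Config, Calm 27 (70 + p.d * 140) σ τ →
      τ.reg 27 = (if u.1 = 1 ∧ v.1 = 0 ∧ p.gapSum u.2 v.2 ≤ p.R then 1 else 0) →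
      wp w I ω (forLoop 29 10 (.ite (same (load (const 8 * (reg 25 * reg 4 + reg 29) + const 2))
        (load (const 8 * (reg 26 * reg 4 + reg 29) + const 2))) (.assign 27 (const 0)) .skip))
        (fun τ => Calm 27 (150 * (p.d + p.E + 1)) σ τ ∧
          τ.reg 27 = if p.good S u v then 1 else 0) τ := by
    intro τ hc h27
    have hc1 := hc.time
    refine wp_forLoop S (fun i τ => Calm 27 (80 + p.d * 140 + i * 50) σ τ ∧ τ.reg 27 =
      if u.1 = 1 ∧ v.1 = 0 ∧ p.gapSum u.2 v.2 ≤ p.R ∧ ∀ T < i, p.key T u.2 ≠ p.key T v.2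
        then 1 else 0) ?_ (by omega) (by norm_num) ?_ ?_ ?_
    · rw [hc.reg _ (by norm_num), hS]
    · refine ⟨⟨fun y hy => ?_, ?_, ?_, ?_, ?_⟩, ?_⟩
      · simp (disch := omega) [Function.update_of_ne, hc.reg]
      · exact hc.mem
      · exact hc.out
      · exact hc.size
      · simp; omega
      · simpa using h27
    · rintro i hi τ ⟨hc, h27⟩ hx hSi
      have h1 := haE i (by omega)
      have h2 := hbE i (by omega)
      have h3 := hc.time
      have h6 : (∀ T < i + 1, p.key T u.2 ≠ p.key T v.2) ↔
          (∀ T < i, p.key T u.2 ≠ p.key T v.2) ∧ p.key i u.2 ≠ p.key i v.2 := by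
        constructor
        · exact fun h => ⟨fun T hT => h T (by omega), h i (by omega)⟩
        · rintro ⟨h, h'⟩ T hT
          rcases Nat.lt_succ_iff_lt_or_eq.1 hT with hT | rfl
          exacts [h T hT, h']
      refine wp.intro fun P hP => ?_
      by_cases hk : p.key i u.2 = p.key i v.2
      · simp (disch := omega) [Nat.mod_eq_of_lt, hc.reg, hc.mem, ha, hb, hσ.E, hx,
          hua.key i hi.le, hvb.key i hi.le, hk]
        refine hP _ ⟨by simp [hx], by simp [hSi], ⟨fun y hy => ?_, rfl, hc.out, hc.size, ?_⟩, ?_⟩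
        · simp (disch := omega) [Function.update_of_ne, hc.reg]
        · simp; omega
        · simp only [h6, hk, ne_eq, not_true_eq_false, and_false, if_false]
          simp
      · simp (disch := omega) [Nat.mod_eq_of_lt, hc.reg, hc.mem, ha, hb, hσ.E, hx,
          hua.key i hi.le, hvb.key i hi.le, hk]
        refine hP _ ⟨hx, hSi, ⟨fun y hy => ?_, rfl, hc.out, hc.size, ?_⟩, ?_⟩
        · simp (disch := omega) [Function.update_of_ne, hc.reg]
        · simp; omega
        · simp only [h6, hk, ne_eq, not_false_eq_true, and_true]
          simpa using h27
    · rintro τ ⟨hc, h27⟩ - -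
      have h3 := hc.time
      refine ⟨⟨hc.reg, hc.mem, hc.out, hc.size, ?_⟩, ?_⟩
      · simp only; omega
      · simpa [good] using h27
  have h2 : u.1 * (1 - v.1) = if u.1 = 1 ∧ v.1 = 0 then 1 else 0 := by
    generalize u.1 = a at *
    generalize v.1 = b at *
    interval_cases a <;> interval_cases b <;> rfl
  rw [wp_block_cons, wp_ite]
  by_cases hR : p.R < p.gapSum u.2 v.2
  · have hR' : p.R < ∑ j ∈ Finset.range p.d, p.φ.gap (u.2 j) (v.2 j) := hR
    simp (disch := omega) [hc.reg, hσ.R, h28, hR', Nat.mod_eq_of_lt]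
    refine wp.mono (hlast _ ⟨fun y hy => ?_, hc.mem, hc.out, hc.size, ?_⟩ ?_)
      fun _ _ h => wp_block_nil.2 h
    · simp (disch := omega) [Function.update_of_ne, hc.reg]
    · simp; omega
    · simp [hR]
  · have hR' : ¬ p.R < ∑ j ∈ Finset.range p.d, p.φ.gap (u.2 j) (v.2 j) := hR
    simp (disch := omega) [hc.reg, hσ.R, h28, hR']
    refine wp.mono (hlast _ ⟨fun y hy => ?_, hc.mem, hc.out, hc.size, ?_⟩ ?_)
      fun _ _ h => wp_block_nil.2 h
    · exact hc.reg y hy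
    · simp; omega
    · simp [h27, h2, not_lt.1 hR]

end Par

/-! ### Linked lists -/

/-- In the memory, the nodes of `l` form a doubly linked list with head `h`. The word `8 * a`
holds the successor of the node `a`, the word `8 * a + 1` its predecessor. -/
def Linked (mem : ℕ → ℕ) : ℕ → List ℕ → Prop
  | h, [] => mem (8 * h) = 0
  | h, a :: l => mem (8 * h) = a ∧ mem (8 * a + 1) = h ∧ Linked mem a l

/-- The word 0 serves as the null pointer, which explains the default value; the loops over lists
stop at it. -/
theorem Linked.next_head {mem : ℕ → ℕ} {h : ℕ} {l : List ℕ} (hl : Linked mem h l) :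
    mem (8 * h) = l.headD 0 := by
  cases l with
  | nil => exact hl
  | cons a l => exact hl.1

theorem Linked.next {mem : ℕ → ℕ} {h a : ℕ} {l₁ l₂ : List ℕ}
    (hl : Linked mem h (l₁ ++ a :: l₂)) : mem (8 * a) = l₂.headD 0 := by
  induction l₁ generalizing h with
  | nil => exact hl.2.2.next_head
  | cons b l₁ ih => exact ih hl.2.2

/-! ### Visiting a bucket -/

/-- A computation that reports the pairs in `P` if register 17 is not `0`, and records in
register 16 whether `P` is empty. -/
structure Emits (P : List (ℕ × ℕ)) (T : ℕ) (σ τ : Config) : Prop where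
  reg : ∀ y < 23, y ≠ 16 → τ.reg y = σ.reg y
  mem : τ.mem = σ.mem
  size : τ.size = σ.size
  found : τ.reg 16 ≠ 0 ↔ σ.reg 16 ≠ 0 ∨ P ≠ []
  out : ∃ new, τ.out = σ.out ++ new ∧ new.map Prod.snd = (if σ.reg 17 = 0 then [] else P) ∧
    ∀ e ∈ new, σ.time ≤ e.1 ∧ e.1 ≤ τ.time
  time_le : σ.time ≤ τ.time
  le_time : τ.time ≤ σ.time + T

theorem Emits.trans {P P' : List (ℕ × ℕ)} {T T' : ℕ} {σ τ υ : Config} (h : Emits P T σ τ)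
    (h' : Emits P' T' τ υ) : Emits (P ++ P') (T + T') σ υ := by
  obtain ⟨new, h1, h2, h3⟩ := h.out
  obtain ⟨new', h1', h2', h3'⟩ := h'.out
  have ht := h.time_le
  have ht' := h'.time_le
  refine ⟨fun y hy hy' => (h'.reg y hy hy').trans (h.reg y hy hy'), h'.mem.trans h.mem,
    h'.size.trans h.size, ?_, ⟨new ++ new', ?_, ?_, ?_⟩, by omega, ?_⟩
  · rw [h'.found, h.found]
    simp only [ne_eq, List.append_eq_nil_iff]
    tauto
  · rw [h1', h1, List.append_assoc]
  · rw [List.map_append, h2, h2', h.reg 17 (by norm_num) (by norm_num)]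
    split_ifs <;> simp
  · intro e he
    rcases List.mem_append.1 he with he | he
    · have := h3 e he; omega
    · have := h3' e he; omega
  · have := h.le_time
    have := h'.le_time
    omega

theorem Emits.mono {P : List (ℕ × ℕ)} {T T' : ℕ} {σ τ : Config} (h : Emits P T σ τ)
    (hT : T ≤ T') : Emits P T' σ τ :=
  { h with le_time := by have := h.le_time; omega }

/-- A computation that changes registers with numbers at least 23 only, followed by time. -/
theorem Emits.of_calm {T : ℕ} {σ τ : Config} (h : Calm 23 T σ τ) (ht : σ.time ≤ τ.time) :
    Emits [] T σ τ :=
  ⟨fun y hy _ => h.reg y hy, h.mem, h.size, by simp [h.reg],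
    ⟨[], by simp [h.out], by simp, by simp⟩, ht, h.time⟩

open Expr in
/-- Examines all pairs of points in the bucket in register 15. -/
def JoinMetric.visit (φ : JoinMetric) : Stmt :=
  block [
    .assign 23 (load (const 8 * (const 4 * reg 15 + const 3))),
    .while (reg 23) (block [
      .assign 24 (load (const 8 * (const 4 * reg 15 + const 3))),
      .while (reg 24) (block [
        .assign 25 ((reg 23 - const 2) / const 4 / reg 4),
        .assign 26 ((reg 24 - const 2) / const 4 / reg 4),
        φ.test,
        .ite (reg 27)
          (block [.assign 16 (const 1), .ite (reg 17) (.emit (reg 25) (reg 26)) .skip]) .skip,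
        .assign 24 (load (const 8 * reg 24))]),
      .assign 23 (load (const 8 * reg 23))])]

namespace Par
variable (p : Par)

/-- The node of the name `s` in the lists of table `S`. -/
def elem (S s : ℕ) : ℕ := 4 * (s * p.E + S) + 2

/-- The pairs reported for a bucket with the names in `l`. -/
def bucketPairs (S : ℕ) (db : ℕ → ℕ × (ℕ → ℕ)) (l l' : List ℕ) : List (ℕ × ℕ) :=
  l.flatMap fun a => (l'.filter fun b => p.good S (db a) (db b)).map fun b => (a, b)

/-- The time for the visit of a pair. -/
def pairTime : ℕ := 150 * (p.d + p.E + 1) + 100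

/-- The time for the visit of a bucket with `k` names. -/
def visitTime (k : ℕ) : ℕ := k * (k * p.pairTime + 50) + 50

variable {p} {w : ℕ} {I : List ℕ} {ω : Tape} {σ : Config}

/-- A node encodes its name and table arithmetically, so the name is recovered by division and need
not be stored. -/
theorem name_elem {S s : ℕ} (hS : S < p.E) : (p.elem S s - 2) / 4 / p.E = s := by
  unfold elem
  rw [Nat.add_sub_cancel, Nat.mul_div_cancel_left _ (by norm_num), add_comm,
    Nat.add_mul_div_right _ _ (by omega), Nat.div_eq_of_lt hS, zero_add]

theorem Loaded.emits {P : List (ℕ × ℕ)} {T : ℕ} {τ : Config} (h : p.Loaded σ)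
    (he : Emits P T σ τ) : p.Loaded τ :=
  h.congr fun y hy => he.reg y (by omega) (by omega)

open Expr

theorem wp_pair (hp : p.Fits w) (hσ : p.Loaded σ) {S a b : ℕ} (hS : σ.reg 10 = S) (hSE : S < p.E)
    (ha : σ.reg 23 = p.elem S a) (hb : σ.reg 24 = p.elem S b) (haN : a < p.N) (hbN : b < p.N)
    {u v : ℕ × (ℕ → ℕ)} (hu : p.Valid u) (hv : p.Valid v) (hua : p.Stored σ.mem S a u)
    (hvb : p.Stored σ.mem S b v) :
    wp w I ω (block [
        .assign 25 ((reg 23 - const 2) / const 4 / reg 4),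
        .assign 26 ((reg 24 - const 2) / const 4 / reg 4),
        p.φ.test,
        .ite (reg 27)
          (block [.assign 16 (const 1), .ite (reg 17) (.emit (reg 25) (reg 26)) .skip]) .skip,
        .assign 24 (load (const 8 * reg 24))])
      (fun τ => Emits (if p.good S u v then [(a, b)] else []) (150 * (p.d + p.E + 1) + 50) σ τ ∧
        τ.reg 23 = σ.reg 23 ∧ τ.reg 24 = σ.mem (8 * p.elem S b)) σ := by
  have hlt := hp.lt
  unfold space at hlt
  have haE := name_mul_add_lt haN hSE
  have hbE := name_mul_add_lt hbN hSE
  have hb' : p.elem S b = 4 * (b * p.E + S) + 2 := rfl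
  have hna := p.name_elem (s := a) hSE
  have hnb := p.name_elem (s := b) hSE
  refine wp.intro fun P hP => ?_
  rw [wp_block_cons, wp_assign, wp_block_cons, wp_assign, wp_block_cons]
  simp (disch := omega) only [eval_div, eval_sub, eval_const, eval_reg, Nat.mod_eq_of_lt, ha, hb,
    hσ.E, hna, hnb, cost_div, cost_sub, cost_const, cost_reg, Function.update_of_ne, Nat.reduceAdd]
  refine wp.mono (wp_test hp ?_ (S := S) ?_ hSE (a := a) ?_ (b := b) ?_ haN hbN hu hv hua hvb) ?_
  · exact hσ.congr fun y hy => by simp (disch := omega) [Function.update_of_ne]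
  · simpa using hS
  · simp
  · simp
  rintro τ ht ⟨hc, h27⟩
  have hc1 := hc.time
  have hreg : ∀ y < 25, τ.reg y = σ.reg y := by
    intro y hy
    rw [hc.reg y (by omega)]
    simp (disch := omega) [Function.update_of_ne]
  have h25 : τ.reg 25 = a := by simp [hc.reg]
  have h26 : τ.reg 26 = b := by simp [hc.reg]
  have hmem : τ.mem = σ.mem := hc.mem
  have hout : τ.out = σ.out := hc.out
  have hsize : τ.size = σ.size := hc.size
  simp only at hc1 ht
  by_cases hg : p.good S u v
  · rw [if_pos hg] at h27 hP
    rw [wp_block_cons, wp_ite, eval_reg, h27, if_neg one_ne_zero]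
    simp only [wp_block_cons, wp_assign, wp_ite, eval_reg, eval_const]
    rw [Nat.mod_eq_of_lt (by omega : 1 < 2 ^ w)]
    have h17 := hreg 17 (by norm_num)
    by_cases hm : σ.reg 17 = 0
    · simp (disch := omega) [h17, hm, hmem, hreg, hb, Nat.mod_eq_of_lt]
      refine hP _ ⟨⟨fun y hy hy' => ?_, ?_, hsize, by simp, ⟨[], by simp [hout], by simp [hm],
        by simp⟩, ?_, ?_⟩, ?_, ?_⟩
      · simp (disch := omega) [Function.update_of_ne, hreg]
      · simp
      · simp only; omega
      · simp only; omega
      · simp [hreg]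
      · simp
    · simp (disch := omega) [h17, hm, hmem, hreg, hb, Nat.mod_eq_of_lt, h25, h26, hout]
      refine hP _ ⟨⟨fun y hy hy' => ?_, ?_, hsize, by simp, ⟨_, rfl, by simp [hm],
        ?_⟩, ?_, ?_⟩, ?_, ?_⟩
      · simp (disch := omega) [Function.update_of_ne, hreg]
      · simp
      · simp; omega
      · simp only; omega
      · simp only; omega
      · simp [hreg]
      · simp
  · rw [if_neg hg] at h27 hP
    rw [wp_block_cons, wp_ite, eval_reg, h27, if_pos rfl]
    simp (disch := omega) [hmem, hreg, hb, Nat.mod_eq_of_lt]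
    refine hP _ ⟨.of_calm ⟨fun y hy => ?_, rfl, hout, hsize, ?_⟩ ?_, ?_, ?_⟩
    · simp (disch := omega) [Function.update_of_ne, hreg]
    · simp only; omega
    · simp only; omega
    · simp [hreg]
    · simp

/-- Both loops run over the whole bucket; the sides are told apart by the test of the pair. In the
invariants the processed prefix determines what has been emitted, and the remaining suffix
determines the cursor. -/
theorem wp_visit (hp : p.Fits w) (hσ : p.Loaded σ) {S B : ℕ} (hS : σ.reg 10 = S) (hSE : S < p.E)
    (hB : σ.reg 15 = B) (hBM : B < p.M * p.E) {l : List ℕ} {db : ℕ → ℕ × (ℕ → ℕ)}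
    (hl : Linked σ.mem (4 * B + 3) (l.map (p.elem S)))
    (hN : ∀ s ∈ l, s < p.N ∧ p.Valid (db s) ∧ p.Stored σ.mem S s (db s)) :
    wp w I ω p.φ.visit (Emits (p.bucketPairs S db l l) (p.visitTime l.length) σ) σ := by
  have hlt := hp.lt
  unfold space at hlt
  have hnext : ∀ l₁ a l₂, l = l₁ ++ a :: l₂ →
      σ.mem (8 * p.elem S a) = (l₂.map (p.elem S)).headD 0 := by
    rintro l₁ a l₂ rfl
    rw [List.map_append, List.map_cons] at hl
    exact hl.next
  have hpos : ∀ (m : List ℕ) (a : ℕ), ((a :: m).map (p.elem S)).headD 0 = p.elem S a :=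
    fun _ _ => rfl
  have helem : ∀ a ∈ l, 8 * p.elem S a < 2 ^ w := by
    intro a ha
    have := name_mul_add_lt (hN a ha).1 hSE
    unfold elem
    omega
  refine wp.intro fun P hP => ?_
  rw [JoinMetric.visit, wp_block_cons, wp_assign, wp_block_cons]
  simp (disch := omega) only [eval_load, eval_mul, eval_add, eval_const, eval_reg, hB,
    Nat.mod_eq_of_lt, hl.next_head, cost_load, cost_mul, cost_add, cost_const, cost_reg]
  refine wp_while_list l (fun l₁ l₂ τ => Emits (p.bucketPairs S db l₁ l)
    (30 + l₁.length * (l.length * p.pairTime + 50)) σ τ ∧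
    τ.reg 23 = (l₂.map (p.elem S)).headD 0) ?_ ?_ ?_
  · refine ⟨.of_calm ⟨fun y hy => ?_, rfl, rfl, rfl, ?_⟩ ?_, by simp⟩
    · simp (disch := omega) [Function.update_of_ne]
    · simp
    · simp only; omega
  · rintro l₁ a l₂ hl₁ τ ⟨he, h23⟩
    have ha : a ∈ l := by rw [hl₁]; simp
    rw [hpos] at h23
    refine ⟨by simp [h23, elem], ?_⟩
    have hτ := hσ.emits he
    have h10 : τ.reg 10 = S := by rw [he.reg _ (by norm_num) (by norm_num), hS]
    have h15 : τ.reg 15 = B := by rw [he.reg _ (by norm_num) (by norm_num), hB]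
    have hmem := he.mem
    refine wp.intro fun P hP => ?_
    rw [wp_block_cons, wp_assign, wp_block_cons]
    simp (disch := omega) only [eval_load, eval_mul, eval_add, eval_const, eval_reg, h15,
      Nat.mod_eq_of_lt, hmem, hl.next_head, cost_load, cost_mul, cost_add, cost_const, cost_reg]
    refine wp_while_list l (fun m₁ m₂ υ =>
      Emits ((m₁.filter fun b => p.good S (db a) (db b)).map fun b => (a, b))
        (30 + m₁.length * p.pairTime) τ υ ∧
      υ.reg 23 = p.elem S a ∧ υ.reg 24 = (m₂.map (p.elem S)).headD 0) ?_ ?_ ?_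
    · refine ⟨.of_calm ⟨fun y hy => ?_, hmem.symm, rfl, rfl, ?_⟩ ?_, by simpa, by simp⟩
      · simp (disch := omega) [Function.update_of_ne]
      · simp
      · simp only; omega
    · rintro m₁ b m₂ hm₁ υ ⟨he', h23', h24⟩
      have hb : b ∈ l := by rw [hm₁]; simp
      rw [hpos] at h24
      refine ⟨by simp [h24, elem], ?_⟩
      have hυ := hτ.emits he'
      have h10' : υ.reg 10 = S := by rw [he'.reg _ (by norm_num) (by norm_num), h10]
      have hmem' : υ.mem = σ.mem := he'.mem.trans hmem
      refine wp.mono (wp_pair (σ := { υ with time := υ.time + ((reg 24).cost + 1) }) hp (S := S) (a := a) (b := b) (u := db a) (v := db b) ?_ h10' hSE h23'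
        h24 (hN a ha).1 (hN b hb).1 (hN a ha).2.1 (hN b hb).2.1 ?_ ?_) ?_
      · exact hυ.congr fun _ _ => rfl
      · simpa only [hmem'] using (hN a ha).2.2
      · simpa only [hmem'] using (hN b hb).2.2
      rintro ξ ht ⟨he₂, h23₂, h24₂⟩
      have he₁ : Emits [] 2 υ { υ with time := υ.time + 2 } :=
        .of_calm ⟨fun _ _ => rfl, rfl, rfl, rfl, le_rfl⟩ (by simp)
      refine ⟨?_, h23₂.trans h23', ?_⟩
      · have := he'.trans (he₁.trans he₂)
        rw [List.nil_append] at this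
        convert this.mono (T' := 30 + (m₁ ++ [b]).length * p.pairTime) ?_ using 1
        · rw [List.filter_append, List.map_append]
          congr 1
          by_cases hg : p.good S (db a) (db b) <;> simp [hg]
        · simp only [List.length_append, List.length_singleton, add_one_mul, pairTime]
          omega
      · rw [h24₂]
        simp only [hmem']
        exact hnext _ _ _ hm₁
    · rintro υ ⟨he', h23', h24⟩
      refine ⟨by simp [h24], ?_⟩
      have hmem' : υ.mem = σ.mem := he'.mem.trans hmem
      have h8 := helem a ha
      rw [wp_block_cons, wp_assign, wp_block_nil]
      simp (disch := omega) only [eval_load, eval_mul, eval_const, eval_reg, Nat.mod_eq_of_lt, h23',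
        hmem', hnext _ _ _ hl₁, cost_load, cost_mul, cost_const, cost_reg]
      refine hP _ ⟨?_, by simp⟩
      have he₁ : Emits [] 8 υ { υ with
          reg := Function.update υ.reg 23 ((l₂.map (p.elem S)).headD 0)
          mem := σ.mem
          time := υ.time + 2 + 5 } := by
        refine .of_calm ⟨fun y hy => ?_, hmem'.symm, rfl, rfl, ?_⟩ ?_
        · simp (disch := omega) [Function.update_of_ne]
        · simp only; omega
        · simp only; omega
      have := he.trans (he'.trans he₁)
      rw [List.append_nil] at this
      convert this.mono (T' := 30 + (l₁ ++ [a]).length * (l.length * p.pairTime + 50)) ?_ using 1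
      · simp [bucketPairs]
      · simp only [List.length_append, List.length_singleton, add_one_mul]
        omega
  · rintro τ ⟨he, h23⟩
    refine ⟨by simp [h23], ?_⟩
    rw [wp_block_nil]
    refine hP _ ?_
    have he₁ : Emits [] 2 τ { τ with time := τ.time + 2 } :=
      .of_calm ⟨fun _ _ => rfl, rfl, rfl, rfl, le_rfl⟩ (by simp)
    have := he.trans he₁
    rw [List.append_nil] at this
    exact this.mono (by unfold visitTime; omega)

end Par

/-! ### Insertion into and removal from linked lists -/

/-- The memory after the node `x` has been inserted behind the head `h`. -/
def linkMem (mem : ℕ → ℕ) (h x : ℕ) : ℕ → ℕ :=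
  Function.update (Function.update (Function.update (Function.update mem (8 * x) (mem (8 * h)))
    (8 * mem (8 * h) + 1) x) (8 * x + 1) h) (8 * h) x

/-- The memory after the node `x` has been removed. -/
def unlinkMem (mem : ℕ → ℕ) (x : ℕ) : ℕ → ℕ :=
  Function.update (Function.update (Function.update mem
    (8 * mem (8 * x + 1)) (mem (8 * x))) (8 * mem (8 * x) + 1) (mem (8 * x + 1))) (8 * x + 1) 0

section links
variable {mem mem' : ℕ → ℕ} {h x a k : ℕ} {l l₁ l₂ : List ℕ}

/-- Links occupy the residues 0 and 1 modulo 8, so sides, coordinates, keys and counters are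
untouched. -/
theorem linkMem_apply (hk : 2 ≤ k % 8) : linkMem mem h x k = mem k := by
  unfold linkMem
  simp (disch := omega) only [Function.update_of_ne]

theorem unlinkMem_apply (hk : 2 ≤ k % 8) : unlinkMem mem x k = mem k := by
  unfold unlinkMem
  simp (disch := omega) only [Function.update_of_ne]

theorem linkMem_next : linkMem mem h x (8 * a) =
    if a = h then x else if a = x then mem (8 * h) else mem (8 * a) := by
  unfold linkMem
  simp only [Function.update_apply]
  simp (disch := omega) only [if_neg]
  simp

theorem linkMem_prev : linkMem mem h x (8 * a + 1) =
    if a = x then h else if a = mem (8 * h) then x else mem (8 * a + 1) := by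
  unfold linkMem
  simp only [Function.update_apply]
  have h1 : ∀ b, 8 * a + 1 ≠ 8 * b := by omega
  simp [h1]

theorem unlinkMem_next : unlinkMem mem x (8 * a) =
    if a = mem (8 * x + 1) then mem (8 * x) else mem (8 * a) := by
  unfold unlinkMem
  simp only [Function.update_apply]
  have h1 : ∀ b, 8 * a ≠ 8 * b + 1 := by omega
  simp [h1]

theorem unlinkMem_prev : unlinkMem mem x (8 * a + 1) =
    if a = x then 0 else if a = mem (8 * x) then mem (8 * x + 1) else mem (8 * a + 1) := by
  unfold unlinkMem
  simp only [Function.update_apply]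
  have h1 : ∀ b, 8 * a + 1 ≠ 8 * b := by omega
  simp [h1]

theorem Linked.congr (hl : Linked mem h l) (hn : ∀ a ∈ h :: l, mem' (8 * a) = mem (8 * a))
    (hp : ∀ a ∈ l, mem' (8 * a + 1) = mem (8 * a + 1)) : Linked mem' h l := by
  induction l generalizing h with
  | nil => exact (hn h (by simp)).trans hl
  | cons a l ih =>
    refine ⟨(hn h (by simp)).trans hl.1, (hp a (by simp)).trans hl.2.1, ih hl.2.2 ?_ ?_⟩
    · exact fun b hb => hn b (List.mem_cons_of_mem _ hb)
    · exact fun b hb => hp b (List.mem_cons_of_mem _ hb)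

theorem Linked.prev_mem (hl : Linked mem h l) (ha : a ∈ l) : mem (8 * a + 1) ∈ h :: l := by
  induction l generalizing h with
  | nil => simp at ha
  | cons b l ih =>
    rcases List.mem_cons.1 ha with rfl | ha
    · simp [hl.2.1]
    · exact List.mem_cons_of_mem _ (ih hl.2.2 ha)

theorem Linked.next_mem (hl : Linked mem h l) (ha : a ∈ h :: l) :
    mem (8 * a) ∈ l ∨ mem (8 * a) = 0 := by
  induction l generalizing h with
  | nil =>
    obtain rfl : a = h := by simpa using ha
    exact .inr hl
  | cons b l ih =>
    rcases List.mem_cons.1 ha with rfl | ha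
    · exact .inl (by simp [hl.1])
    · rcases ih hl.2.2 ha with h | h
      exacts [.inl (List.mem_cons_of_mem _ h), .inr h]

/-- The empty list needs no special treatment in the program: then the new predecessor is written to
the dummy node 0, which lies on no list. -/
theorem Linked.link (hl : Linked mem h l) (hh : h ∉ l) (hxh : x ≠ h) (hx : x ∉ l) (h0 : 0 ∉ l)
    (hd : l.Nodup) : Linked (linkMem mem h x) h (x :: l) := by
  refine ⟨by simp [linkMem_next], by simp [linkMem_prev], ?_⟩
  cases l with
  | nil => simpa [Linked, linkMem_next, hxh] using hl
  | cons a l =>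
    have hax : a ≠ x := fun h => hx (by simp [h])
    refine ⟨by simp [linkMem_next, hxh, hl.1], by simp [linkMem_prev, hax, hl.1], ?_⟩
    refine hl.2.2.congr (fun b hb => ?_) (fun b hb => ?_)
    · rw [linkMem_next, if_neg, if_neg]
      · rintro rfl; exact hx hb
      · rintro rfl; exact hh hb
    · rw [linkMem_prev, if_neg, if_neg]
      · rw [hl.1]; rintro rfl; exact (List.nodup_cons.1 hd).1 hb
      · rintro rfl; exact hx (List.mem_cons_of_mem _ hb)

/-- Induction along the list. If the removed node comes first, the head is joined to its successor.
Otherwise its predecessor lies in the list and is not the head, and its successor is not the first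
node, so the first link is unchanged and the tail is handled by induction. -/
theorem Linked.unlink (hl : Linked mem h l) (hx : x ∈ l) (hh : h ∉ l) (h0 : 0 ∉ l)
    (hd : l.Nodup) : Linked (unlinkMem mem x) h (l.erase x) := by
  induction l generalizing h with
  | nil => simp at hx
  | cons a l ih =>
    have hd' := List.nodup_cons.1 hd
    have hhl : h ∉ l := fun h => hh (List.mem_cons_of_mem _ h)
    have h0l : 0 ∉ l := fun h => h0 (List.mem_cons_of_mem _ h)
    by_cases hax : a = x
    · subst hax
      rw [List.erase_cons_head]
      have hp := hl.2.1
      cases l with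
      | nil => simpa [Linked, unlinkMem_next, hp] using hl.2.2
      | cons b l =>
        have hba : b ≠ a := by rintro rfl; simp at hd
        have hn := hl.2.2.1
        refine ⟨by simp [unlinkMem_next, hp, hn], by simp [unlinkMem_prev, hba, hn, hp], ?_⟩
        refine hl.2.2.2.2.congr (fun c hc => ?_) (fun c hc => ?_)
        · rw [unlinkMem_next, if_neg]
          rw [hp]; rintro rfl; exact hhl hc
        · rw [unlinkMem_prev, if_neg, if_neg]
          · rw [hn]; rintro rfl
            exact (List.nodup_cons.1 hd'.2).1 hc
          · rintro rfl; exact hd'.1 (List.mem_cons_of_mem _ hc)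
    · rw [List.erase_cons_tail (by simpa using hax)]
      have hxl : x ∈ l := by simpa [Ne.symm hax] using hx
      have hpm := hl.2.2.prev_mem hxl
      have hnm := hl.2.2.next_mem (List.mem_cons_of_mem _ hxl)
      refine ⟨?_, ?_, ih hl.2.2 hxl hd'.1 h0l hd'.2⟩
      · rw [unlinkMem_next, if_neg, hl.1]
        rintro rfl; exact hh hpm
      · rw [unlinkMem_prev, if_neg hax, if_neg, hl.2.1]
        rintro rfl
        rcases hnm with h | h
        · exact hd'.1 h
        · exact h0 (by simp [h])

end links

/-- The memory holds the lists `L h` for all odd `h`. -/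
structure HoldsLists (mem : ℕ → ℕ) (L : ℕ → List ℕ) : Prop where
  linked : ∀ h, h % 2 = 1 → Linked mem h (L h)
  even : ∀ h, ∀ a ∈ L h, a % 2 = 0 ∧ a ≠ 0
  nodup : ∀ h, (L h).Nodup
  inj : ∀ h h' a, a ∈ L h → a ∈ L h' → h = h'
  prev : ∀ a, a % 2 = 0 → a ≠ 0 → (∀ h, a ∉ L h) → mem (8 * a + 1) = 0
  odd : ∀ h, h % 2 = 0 → L h = []

namespace HoldsLists
variable {mem mem' : ℕ → ℕ} {L : ℕ → List ℕ} {h x : ℕ}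

theorem odd_of_mem (hL : HoldsLists mem L) (hx : x ∈ L h) : h % 2 = 1 := by
  by_contra hh
  rw [hL.odd h (by omega)] at hx
  simp at hx

theorem congr (hL : HoldsLists mem L) (h : ∀ a, a % 8 < 2 → mem' a = mem a) : HoldsLists mem' L where
  linked h' hh := (hL.linked h' hh).congr (fun a _ => h _ (by omega)) fun a _ => h _ (by omega)
  even := hL.even
  nodup := hL.nodup
  inj := hL.inj
  prev a h1 h2 h3 := (h _ (by omega)).trans (hL.prev a h1 h2 h3)
  odd := hL.odd

theorem zero_notMem (hL : HoldsLists mem L) : 0 ∉ L h := fun hm => (hL.even h 0 hm).2 rfl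

theorem notMem_of_odd (hL : HoldsLists mem L) {h' : ℕ} (hh : h % 2 = 1) : h ∉ L h' := fun hm => by
  have := (hL.even h' h hm).1
  omega

/-- The predecessor is either the odd head or another node. Together with the field `prev` this
makes the predecessor word a constant time test for being on some list. -/
theorem prev_ne_zero (hL : HoldsLists mem L) (hx : x ∈ L h) : mem (8 * x + 1) ≠ 0 := by
  have hh := hL.odd_of_mem hx
  rcases List.mem_cons.1 ((hL.linked h hh).prev_mem hx) with h1 | h1
  · omega
  · exact (hL.even h _ h1).2

/-- The only existing words affected belong to the head and to its old successor. By disjointness of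
the lists neither lies on another list, except that the successor may be the dummy 0, whose
predecessor word the invariant leaves arbitrary. -/
theorem link (hL : HoldsLists mem L) (hh : h % 2 = 1) (hx : x % 2 = 0) (hx0 : x ≠ 0)
    (hxL : ∀ h, x ∉ L h) : HoldsLists (linkMem mem h x) (Function.update L h (x :: L h)) := by
  have hnext := (hL.linked h hh).next_mem (List.mem_cons_self (l := L h))
  have hmem : ∀ h' a, a ∈ Function.update L h (x :: L h) h' ↔ a ∈ L h' ∨ a = x ∧ h' = h := by
    intro h' a
    by_cases hh' : h' = h
    · subst hh'; simp [or_comm]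
    · simp [hh']
  constructor
  · intro h' hh'
    by_cases hhh : h' = h
    · subst hhh
      rw [Function.update_self]
      exact (hL.linked h' hh).link (hL.notMem_of_odd hh) (by omega) (hxL h') hL.zero_notMem
        (hL.nodup h')
    · rw [Function.update_of_ne hhh]
      refine (hL.linked h' hh').congr (fun a ha => ?_) (fun a ha => ?_)
      · rw [linkMem_next, if_neg, if_neg]
        · rintro rfl
          rcases List.mem_cons.1 ha with ha | ha
          · omega
          · exact hxL _ ha
        · rintro rfl
          rcases List.mem_cons.1 ha with ha | ha
          · exact hhh ha.symm
          · exact hL.notMem_of_odd hh ha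
      · rw [linkMem_prev, if_neg, if_neg]
        · rintro rfl
          rcases hnext with h1 | h1
          · exact hhh (hL.inj _ _ _ ha h1)
          · exact hL.zero_notMem (h1 ▸ ha)
        · rintro rfl
          exact hxL _ ha
  · intro h' a ha
    rcases (hmem h' a).1 ha with h1 | ⟨rfl, -⟩
    exacts [hL.even _ _ h1, ⟨hx, hx0⟩]
  · intro h'
    by_cases hhh : h' = h
    · subst hhh
      rw [Function.update_self]
      exact List.nodup_cons.2 ⟨hxL _, hL.nodup _⟩
    · rw [Function.update_of_ne hhh]
      exact hL.nodup _
  · intro h₁ h₂ a h1 h2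
    rcases (hmem h₁ a).1 h1 with h1 | ⟨rfl, rfl⟩ <;> rcases (hmem h₂ a).1 h2 with h2 | ⟨h2, h3⟩
    · exact hL.inj _ _ _ h1 h2
    · exact absurd (h2 ▸ h1) (hxL _)
    · exact absurd h2 (hxL _)
    · exact h3.symm
  · intro a ha ha0 hn
    have h1 : a ≠ x := fun h1 => hn h ((hmem h a).2 (.inr ⟨h1, rfl⟩))
    have h2 : ∀ h', a ∉ L h' := fun h' h2 => hn h' ((hmem h' a).2 (.inl h2))
    rw [linkMem_prev, if_neg h1, if_neg, hL.prev a ha ha0 h2]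
    rintro rfl
    rcases hnext with h1 | h1
    exacts [h2 _ h1, ha0 h1]
  · intro h' hh'
    rw [Function.update_of_ne (by omega), hL.odd h' hh']

theorem unlink (hL : HoldsLists mem L) (hx : x ∈ L h) :
    HoldsLists (unlinkMem mem x) (Function.update L h ((L h).erase x)) := by
  have hh := hL.odd_of_mem hx
  have hnext := (hL.linked h hh).next_mem (List.mem_cons_of_mem h hx)
  have hprev := (hL.linked h hh).prev_mem hx
  have hmem : ∀ h' a, a ∈ Function.update L h ((L h).erase x) h' ↔ a ∈ L h' ∧ a ≠ x := by
    intro h' a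
    by_cases hh' : h' = h
    · subst hh'
      rw [Function.update_self, (hL.nodup h').mem_erase_iff, and_comm]
    · rw [Function.update_of_ne hh']
      refine ⟨fun h1 => ⟨h1, ?_⟩, And.left⟩
      rintro rfl
      exact hh' (hL.inj _ _ _ h1 hx)
  constructor
  · intro h' hh'
    by_cases hhh : h' = h
    · subst hhh
      rw [Function.update_self]
      exact (hL.linked h' hh).unlink hx (hL.notMem_of_odd hh) hL.zero_notMem (hL.nodup h')
    · rw [Function.update_of_ne hhh]
      refine (hL.linked h' hh').congr (fun a ha => ?_) (fun a ha => ?_)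
      · rw [unlinkMem_next, if_neg]
        rintro rfl
        rcases List.mem_cons.1 ha with ha | ha <;> rcases List.mem_cons.1 hprev with h1 | h1
        · exact hhh (ha.symm.trans h1)
        · exact hL.notMem_of_odd hh' (ha ▸ h1)
        · exact hL.notMem_of_odd hh (h1 ▸ ha)
        · exact hhh (hL.inj _ _ _ ha h1)
      · rw [unlinkMem_prev, if_neg, if_neg]
        · rintro rfl
          rcases hnext with h1 | h1
          · exact hhh (hL.inj _ _ _ ha h1)
          · exact hL.zero_notMem (h1 ▸ ha)
        · rintro rfl
          exact hhh (hL.inj _ _ _ ha hx)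
  · exact fun h' a ha => hL.even h' a ((hmem h' a).1 ha).1
  · intro h'
    by_cases hhh : h' = h
    · subst hhh
      rw [Function.update_self]
      exact (hL.nodup _).erase _
    · rw [Function.update_of_ne hhh]
      exact hL.nodup _
  · exact fun h₁ h₂ a h1 h2 => hL.inj h₁ h₂ a ((hmem _ _).1 h1).1 ((hmem _ _).1 h2).1
  · intro a ha ha0 hn
    rw [unlinkMem_prev]
    split_ifs with h1 h2
    · rfl
    · subst h2
      rcases hnext with h2 | h2
      · exact absurd ((hmem h _).2 ⟨h2, h1⟩) (hn h)
      · exact absurd h2 ha0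
    · exact hL.prev a ha ha0 fun h' h3 => hn h' ((hmem h' a).2 ⟨h3, h1⟩)
  · intro h' hh'
    rw [Function.update_of_ne (by omega), hL.odd h' hh']

end HoldsLists

/-- A computation of at most `T` steps that reports nothing, stays within the memory of the data
structure and changes registers with numbers at least `k` only. -/
structure Works (p : Par) (k T : ℕ) (σ τ : Config) : Prop where
  reg : ∀ y < k, τ.reg y = σ.reg y
  out : τ.out = σ.out
  size : τ.size ≤ max σ.size p.space
  time : τ.time ≤ σ.time + T

theorem Par.Loaded.works {p : Par} {σ τ : Config} {k T : ℕ} (h : p.Loaded σ)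
    (hw : Works p k T σ τ) (hk : 7 ≤ k) : p.Loaded τ :=
  h.congr fun y hy => hw.reg y (by omega)

open Expr in
/-- Inserts the node in register 21 behind the head in register 20. -/
def linkProg : Stmt :=
  block [
    .assign 22 (load (const 8 * reg 20)),
    .store (const 8 * reg 21) (reg 22),
    .store (const 8 * reg 22 + const 1) (reg 21),
    .store (const 8 * reg 21 + const 1) (reg 20),
    .store (const 8 * reg 20) (reg 21)]

open Expr in
/-- Removes the node in register 21 from its list. -/
def unlinkProg : Stmt :=
  block [
    .assign 20 (load (const 8 * reg 21 + const 1)),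
    .assign 22 (load (const 8 * reg 21)),
    .store (const 8 * reg 20) (reg 22),
    .store (const 8 * reg 22 + const 1) (reg 20),
    .store (const 8 * reg 21 + const 1) (const 0)]

section
variable {p : Par} {w : ℕ} {I : List ℕ} {ω : Tape} {σ : Config}
open Expr

theorem wp_linkProg (hp : p.Fits w) {h x : ℕ} (hh : σ.reg 20 = h) (hx : σ.reg 21 = x)
    (h1 : 8 * h + 2 ≤ p.space) (h2 : 8 * x + 2 ≤ p.space) (h3 : 8 * σ.mem (8 * h) + 2 ≤ p.space) :
    wp w I ω linkProg (fun τ => Works p 22 40 σ τ ∧ τ.mem = linkMem σ.mem h x) σ := by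
  have hlt := hp.lt
  refine wp.intro fun P hP => ?_
  simp (disch := omega) [linkProg, Nat.mod_eq_of_lt, hh, hx]
  refine hP _ ⟨⟨fun y hy => ?_, rfl, ?_, ?_⟩, rfl⟩
  · simp (disch := omega) [Function.update_of_ne]
  · simp only; omega
  · simp only; omega

theorem wp_unlinkProg (hp : p.Fits w) {x : ℕ} (hx : σ.reg 21 = x)
    (h1 : 8 * x + 2 ≤ p.space) (h2 : 8 * σ.mem (8 * x) + 2 ≤ p.space)
    (h3 : 8 * σ.mem (8 * x + 1) + 2 ≤ p.space) :
    wp w I ω unlinkProg (fun τ => Works p 20 40 σ τ ∧ τ.mem = unlinkMem σ.mem x) σ := by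
  have hlt := hp.lt
  refine wp.intro fun P hP => ?_
  simp (disch := omega) [unlinkProg, Nat.mod_eq_of_lt, hx]
  refine hP _ ⟨⟨fun y hy => ?_, rfl, ?_, ?_⟩, rfl⟩
  · simp (disch := omega) [Function.update_of_ne]
  · simp only; omega
  · simp only; omega

end

/-! ### The memory invariant of the data structure -/

namespace Par
variable (p : Par)

/-- The nodes of all lists, for given lists of names of all buckets and a given list `fl` of
buckets. -/
def nodes (lst : ℕ → List ℕ) (fl : List ℕ) (h : ℕ) : List ℕ :=
  if h = 1 then fl.map fun B => 4 * B + 4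
  else if h % 4 = 3 then (lst (h / 4)).map (p.elem (h / 4 % p.E)) else []

/-- The memory represents the points `db s`, where table `S` contains the names `s ∈ P S`. Here
`lst B` lists the names in bucket `B`, and `fl` the buckets that are on the list of buckets. -/
structure Rep (mem : ℕ → ℕ) (db : ℕ → ℕ × (ℕ → ℕ)) (P : ℕ → Finset ℕ) (lst : ℕ → List ℕ)
    (fl : List ℕ) : Prop where
  lists : HoldsLists mem (p.nodes lst fl)
  mem_lst : ∀ B s, s ∈ lst B ↔ s ∈ P (B % p.E) ∧ p.key (B % p.E) (db s).2 = B / p.E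
  count : ∀ B, mem (8 * B + 5) = (lst B).length
  lt : ∀ B ∈ fl, B < p.M * p.E
  stored : ∀ S < p.E, ∀ s ∈ P S, s < p.N ∧ p.Valid (db s) ∧ p.Stored mem S s (db s)

/-- The bucket is small and contains a pair that is to be reported. -/
def Flagged (db : ℕ → ℕ × (ℕ → ℕ)) (lst : ℕ → List ℕ) (B : ℕ) : Prop :=
  (lst B).length ≤ p.cap ∧ p.bucketPairs (B % p.E) db (lst B) (lst B) ≠ []

variable {p} {mem mem' : ℕ → ℕ} {db : ℕ → ℕ × (ℕ → ℕ)} {P : ℕ → Finset ℕ} {lst : ℕ → List ℕ}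
  {fl : List ℕ}

theorem nodes_one : p.nodes lst fl 1 = fl.map fun B => 4 * B + 4 := rfl

theorem nodes_bucket (B : ℕ) : p.nodes lst fl (4 * B + 3) = (lst B).map (p.elem (B % p.E)) := by
  have h1 : 4 * B + 3 ≠ 1 := by omega
  have h2 : (4 * B + 3) % 4 = 3 := by omega
  have h3 : (4 * B + 3) / 4 = B := by omega
  rw [nodes, if_neg h1, if_pos h2, h3]

theorem nodes_update_bucket (B : ℕ) (l : List ℕ) : p.nodes (Function.update lst B l) fl =
    Function.update (p.nodes lst fl) (4 * B + 3) (l.map (p.elem (B % p.E))) := by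
  funext h
  by_cases hh : h = 4 * B + 3
  · subst hh
    rw [nodes_bucket, Function.update_self, Function.update_self]
  · rw [Function.update_of_ne hh]
    unfold nodes
    split_ifs with h1 h2
    · rfl
    · rw [Function.update_of_ne (by omega)]
    · rfl

theorem nodes_update_one (fl' : List ℕ) : p.nodes lst fl' =
    Function.update (p.nodes lst fl) 1 (fl'.map fun B => 4 * B + 4) := by
  funext h
  by_cases hh : h = 1
  · subst hh
    rw [nodes_one, Function.update_self]
  · rw [Function.update_of_ne hh, nodes, nodes, if_neg hh, if_neg hh]

theorem elem_injective (hp : 0 < p.E) (S : ℕ) : Function.Injective (p.elem S) := by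
  intro a b hab
  unfold elem at hab
  have : a * p.E = b * p.E := by omega
  exact Nat.eq_of_mul_eq_mul_right hp this

/-- The residue modulo 4 tells the kind of a node: 2 for a name in a table, 0 for a bucket as an
entry of the list of buckets. Heads are 1 for the list of buckets and numbers with residue 3 for the
buckets. -/
theorem mem_nodes {h x : ℕ} (hx : x ∈ p.nodes lst fl h) :
    (h = 1 ∧ ∃ B ∈ fl, x = 4 * B + 4) ∨
      ∃ B, h = 4 * B + 3 ∧ ∃ s ∈ lst B, x = p.elem (B % p.E) s := by
  unfold nodes at hx
  split_ifs at hx with h1 h2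
  · obtain ⟨B, hB, rfl⟩ := List.mem_map.1 hx
    exact .inl ⟨h1, B, hB, rfl⟩
  · obtain ⟨s, hs, rfl⟩ := List.mem_map.1 hx
    exact .inr ⟨h / 4, by omega, s, hs, rfl⟩
  · simp at hx

theorem Stored.congr {S s : ℕ} {u : ℕ × (ℕ → ℕ)} (h : p.Stored mem S s u)
    (hm : ∀ k, 2 ≤ k % 8 → k % 8 ≤ 4 → mem' k = mem k) : p.Stored mem' S s u where
  side := (hm _ (by omega) (by omega)).trans h.side
  coord i hi := (hm _ (by omega) (by omega)).trans (h.coord i hi)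
  key T hT := (hm _ (by omega) (by omega)).trans (h.key T hT)

namespace Rep

theorem le_space (hE : 0 < p.E) (h : p.Rep mem db P lst fl) {x a : ℕ}
    (hx : x ∈ p.nodes lst fl a) : 8 * x + 10 ≤ p.space := by
  unfold space
  rcases mem_nodes hx with ⟨-, B, hB, rfl⟩ | ⟨B, -, s, hs, rfl⟩
  · have := h.lt B hB
    omega
  · have hS := Nat.mod_lt B hE
    have := name_mul_add_lt (h.stored _ hS s ((h.mem_lst B s).1 hs).1).1 hS
    unfold elem
    omega

theorem next_le (hE : 0 < p.E) (h : p.Rep mem db P lst fl) {x a : ℕ} (ha : a % 2 = 1)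
    (hx : x ∈ a :: p.nodes lst fl a) : 8 * mem (8 * x) + 10 ≤ p.space := by
  rcases (h.lists.linked a ha).next_mem hx with h1 | h1
  · exact h.le_space hE h1
  · rw [h1]; unfold space; omega

theorem prev_le (hE : 0 < p.E) (h : p.Rep mem db P lst fl) {x a : ℕ}
    (ha' : 8 * a + 10 ≤ p.space)
    (hx : x ∈ p.nodes lst fl a) : 8 * mem (8 * x + 1) + 10 ≤ p.space := by
  have ha := h.lists.odd_of_mem hx
  rcases List.mem_cons.1 ((h.lists.linked a ha).prev_mem hx) with h1 | h1
  · rw [h1]; exact ha'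
  · exact h.le_space hE h1

/-- A node with residue 0 modulo 4 can only be on the list of buckets, so a vanishing predecessor
word decides membership there. -/
theorem prev_flag (h : p.Rep mem db P lst fl) (B : ℕ) : mem (8 * (4 * B + 4) + 1) ≠ 0 ↔ B ∈ fl := by
  constructor
  · intro h1
    by_contra hB
    refine h1 (h.lists.prev _ (by omega) (by omega) fun a ha => ?_)
    rcases mem_nodes ha with ⟨-, B', hB', h2⟩ | ⟨B', -, s, -, h2⟩
    · obtain rfl : B = B' := by omega
      exact hB hB'
    · unfold elem at h2
      omega
  · intro hB
    refine h.lists.prev_ne_zero (h := 1) ?_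
    rw [nodes_one]
    exact List.mem_map.2 ⟨B, hB, rfl⟩

theorem link_flag (h : p.Rep mem db P lst fl) {B : ℕ} (hB : B ∉ fl) (hBM : B < p.M * p.E) :
    p.Rep (linkMem mem 1 (4 * B + 4)) db P lst (B :: fl) where
  lists := by
    rw [nodes_update_one (fl := fl)]
    refine h.lists.link (by norm_num) (by omega) (by omega) fun a ha => ?_
    rcases mem_nodes ha with ⟨-, B', hB', h2⟩ | ⟨B', -, s, -, h2⟩
    · obtain rfl : B = B' := by omega
      exact hB hB'
    · unfold elem at h2
      omega
  mem_lst := h.mem_lst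
  count B := (linkMem_apply (by omega)).trans (h.count B)
  lt B' hB' := by
    rcases List.mem_cons.1 hB' with rfl | hB'
    exacts [hBM, h.lt B' hB']
  stored S hS s hs := by
    obtain ⟨h1, h2, h3⟩ := h.stored S hS s hs
    exact ⟨h1, h2, h3.congr fun k hk _ => linkMem_apply hk⟩

theorem nodup_fl (h : p.Rep mem db P lst fl) : fl.Nodup := by
  have := h.lists.nodup 1
  rw [nodes_one] at this
  exact this.of_map

theorem nodup_lst (h : p.Rep mem db P lst fl) (B : ℕ) : (lst B).Nodup := by
  have := h.lists.nodup (4 * B + 3)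
  rw [nodes_bucket] at this
  exact this.of_map

theorem unlink_flag (h : p.Rep mem db P lst fl) {B : ℕ} (hB : B ∈ fl) :
    p.Rep (unlinkMem mem (4 * B + 4)) db P lst (fl.erase B) where
  lists := by
    rw [nodes_update_one (fl := fl)]
    convert h.lists.unlink (x := 4 * B + 4) (h := 1) _ using 2
    · rw [nodes_one, List.map_erase fun a b hab => by simpa using hab]
    · exact List.mem_map.2 ⟨B, hB, rfl⟩
  mem_lst := h.mem_lst
  count B := (unlinkMem_apply (by omega)).trans (h.count B)
  lt B' hB' := h.lt B' (List.mem_of_mem_erase hB')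
  stored S hS s hs := by
    obtain ⟨h1, h2, h3⟩ := h.stored S hS s hs
    exact ⟨h1, h2, h3.congr fun k hk _ => unlinkMem_apply hk⟩

end Rep
end Par

/-! ### Keeping the list of buckets up to date -/

open Expr in
/-- Updates the position of the bucket in register 15 on the list of buckets. -/
def JoinMetric.refresh (φ : JoinMetric) : Stmt :=
  block [
    .assign 16 (const 0),
    .assign 17 (const 0),
    .ite (less (reg 6) (load (const 8 * reg 15 + const 5))) .skip φ.visit,
    .assign 21 (const 4 * reg 15 + const 4),
    .assign 20 (const 1),
    .ite (reg 16)
      (.ite (load (const 8 * reg 21 + const 1)) .skip linkProg)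
      (.ite (load (const 8 * reg 21 + const 1)) unlinkProg .skip)]

theorem Par.visitTime_mono (p : Par) {k l : ℕ} (h : k ≤ l) : p.visitTime k ≤ p.visitTime l := by
  unfold visitTime
  gcongr

/-- The time for an update of the list of buckets. -/
def Par.refreshTime (p : Par) : ℕ := p.visitTime p.cap + 100

namespace Par
variable {p : Par} {w : ℕ} {I : List ℕ} {ω : Tape} {σ : Config} {db : ℕ → ℕ × (ℕ → ℕ)}
  {P : ℕ → Finset ℕ} {lst : ℕ → List ℕ} {fl : List ℕ}
open Expr

/-- Only the bucket that has just changed may be listed wrongly, hence the restriction in the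
hypothesis on `fl`. A visit with reporting switched off finds out whether the bucket holds a pair to
be reported. A bucket above `cap` is not visited at all, which makes the time bound hold for all
inputs. -/
theorem wp_refresh (hp : p.Fits w) (hσ : p.Loaded σ) (hr : p.Rep σ.mem db P lst fl) {B : ℕ}
    (hS : σ.reg 10 = B % p.E) (hB : σ.reg 15 = B) (hBM : B < p.M * p.E)
    (hfl : ∀ B' ≠ B, B' ∈ fl ↔ p.Flagged db lst B') :
    wp w I ω p.φ.refresh (fun τ => Works p 16 p.refreshTime σ τ ∧
      (∀ k, 2 ≤ k % 8 → τ.mem k = σ.mem k) ∧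
      ∃ fl', p.Rep τ.mem db P lst fl' ∧ ∀ B', B' ∈ fl' ↔ p.Flagged db lst B') σ := by
  have hlt := hp.lt
  have hE := hp.E_pos
  have hsp : p.space = 64 * (p.N * p.E) + 64 * (p.M * p.E) + 16 * (p.N * p.d) + 8 * p.N + 1000 := rfl
  have hrt : p.refreshTime = p.visitTime p.cap + 100 := rfl
  have hSE := Nat.mod_lt B hE
  have hflag := hr.prev_flag B
  refine wp.intro fun Q hQ => ?_
  -- the last step, after the decision has been made
  have hlast : ∀ τ : Config, Works p 16 (p.visitTime p.cap + 30) σ τ → τ.mem = σ.mem →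
      (τ.reg 16 ≠ 0 ↔ p.Flagged db lst B) → wp w I ω (block [
        .assign 21 (const 4 * reg 15 + const 4),
        .assign 20 (const 1),
        .ite (reg 16)
          (.ite (load (const 8 * reg 21 + const 1)) .skip linkProg)
          (.ite (load (const 8 * reg 21 + const 1)) unlinkProg .skip)]) Q τ := by
    intro τ hw hmem h16
    have h15 : τ.reg 15 = B := (hw.reg 15 (by norm_num)).trans hB
    have htime := hw.time
    have hsize := hw.size
    have hout := hw.out
    have hreg := hw.reg
    -- The four cases are: keep the entry, add it, remove it, leave it absent.
    by_cases hF : p.Flagged db lst B <;> by_cases hBf : B ∈ fl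
    · have h1 := h16.2 hF
      have h2 := hflag.2 hBf
      simp (disch := omega) [Nat.mod_eq_of_lt, h15, h1, hmem, h2]
      refine hQ _ ⟨⟨fun y hy => ?_, hout, hsize, ?_⟩, fun _ _ => rfl, fl, hr, fun B' => ?_⟩
      · simp (disch := omega) [Function.update_of_ne, hreg]
      · simp only; omega
      · by_cases hBB : B' = B
        · subst hBB; simp [hBf, hF]
        · exact hfl B' hBB
    · have h1 := h16.2 hF
      have h2 : σ.mem (8 * (4 * B + 4) + 1) = 0 := by
        by_contra h
        exact hBf (hflag.1 h)
      simp (disch := omega) [Nat.mod_eq_of_lt, h15, h1, hmem, h2]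
      have h3 := hr.next_le hE (a := 1) (x := 1) (by norm_num) (by simp)
      refine wp.mono (wp_linkProg hp (h := 1) (x := 4 * B + 4) (by simp) (by simp) (by omega)
        (by omega) (by simp only; omega)) ?_
      rintro υ - ⟨hv, hvm⟩
      have h4 := hv.size
      have h5 := hv.time
      simp only at h4 h5 hvm
      rw [wp_block_nil]
      refine hQ _ ⟨⟨fun y hy => ?_, hv.out.trans hout, by omega, by omega⟩,
        fun k hk => ?_, B :: fl, ?_, fun B' => ?_⟩
      · rw [hv.reg y (by omega)]
        simp (disch := omega) [Function.update_of_ne, hreg]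
      · rw [hvm, linkMem_apply hk]
      · rw [hvm]; exact hr.link_flag hBf hBM
      · by_cases hBB : B' = B
        · subst hBB; simp [hF]
        · simp [hBB, hfl]
    · have h1 : τ.reg 16 = 0 := by
        by_contra h
        exact hF (h16.1 h)
      have h2 := hflag.2 hBf
      simp (disch := omega) [Nat.mod_eq_of_lt, h15, h1, hmem, h2]
      have hn : 4 * B + 4 ∈ p.nodes lst fl 1 := List.mem_map.2 ⟨B, hBf, rfl⟩
      have h3 := hr.next_le hE (a := 1) (by norm_num) (List.mem_cons_of_mem _ hn)
      have h4 := hr.prev_le hE (by omega) hn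
      refine wp.mono (wp_unlinkProg hp (x := 4 * B + 4) (by simp) (by omega)
        (by simp only; omega) (by simp only; omega)) ?_
      rintro υ - ⟨hv, hvm⟩
      have h4 := hv.size
      have h5 := hv.time
      simp only at h4 h5 hvm
      rw [wp_block_nil]
      refine hQ _ ⟨⟨fun y hy => ?_, hv.out.trans hout, by omega, by omega⟩,
        fun k hk => ?_, fl.erase B, ?_, fun B' => ?_⟩
      · rw [hv.reg y (by omega)]
        simp (disch := omega) [Function.update_of_ne, hreg]
      · rw [hvm, unlinkMem_apply hk]
      · rw [hvm]; exact hr.unlink_flag hBf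
      · rw [hr.nodup_fl.mem_erase_iff]
        by_cases hBB : B' = B
        · subst hBB; simp [hF]
        · simp [hBB, hfl]
    · have h1 : τ.reg 16 = 0 := by
        by_contra h
        exact hF (h16.1 h)
      have h2 : σ.mem (8 * (4 * B + 4) + 1) = 0 := by
        by_contra h
        exact hBf (hflag.1 h)
      simp (disch := omega) [Nat.mod_eq_of_lt, h15, h1, hmem, h2]
      refine hQ _ ⟨⟨fun y hy => ?_, hout, hsize, ?_⟩, fun _ _ => rfl, fl, hr, fun B' => ?_⟩
      · simp (disch := omega) [Function.update_of_ne, hreg]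
      · simp only; omega
      · by_cases hBB : B' = B
        · subst hBB; simp [hBf, hF]
        · exact hfl B' hBB
  rw [JoinMetric.refresh, wp_block_cons, wp_assign, wp_block_cons, wp_assign, wp_block_cons]
  simp (disch := omega) only [eval_const, Nat.mod_eq_of_lt, cost_const]
  have hv : (less (reg 6) (load (const 8 * reg 15 + const 5))).eval w I
      { σ with
        reg := Function.update (Function.update σ.reg 16 0) 17 0
        time := σ.time + (1 + 1) + (1 + 1) } = if p.cap < (lst B).length then 1 else 0 := by
    simp (disch := omega) [Nat.mod_eq_of_lt, hB, hσ.cap, hr.count]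
  rw [wp_ite, hv]
  by_cases hcap : p.cap < (lst B).length
  · rw [if_pos hcap, if_neg one_ne_zero, wp_skip]
    refine hlast _ ⟨fun y hy => ?_, rfl, ?_, ?_⟩ rfl ?_
    · simp (disch := omega) [Function.update_of_ne]
    · simp only; omega
    · simp; omega
    · simp [Flagged, hcap]
  · rw [if_neg hcap, if_pos rfl]
    have hl := hr.lists.linked (4 * B + 3) (by omega)
    rw [nodes_bucket] at hl
    refine wp.mono (wp_visit hp (S := B % p.E) (B := B) (l := lst B) (db := db)
      (hσ.congr fun y hy => ?_) ?_ hSE ?_ hBM hl fun s hs =>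
        hr.stored _ hSE s ((hr.mem_lst B s).1 hs).1) ?_
    · simp (disch := omega) [Function.update_of_ne]
    · simpa using hS
    · simpa using hB
    rintro τ - he
    obtain ⟨new, h1, h2, -⟩ := he.out
    have h3 := he.le_time
    have h4 := p.visitTime_mono (not_lt.1 hcap)
    simp at h2
    refine hlast _ ⟨fun y hy => ?_, ?_, ?_, ?_⟩ he.mem ?_
    · rw [he.reg y (by omega) (by omega)]
      simp (disch := omega) [Function.update_of_ne]
    · rw [h1, h2]; simp
    · rw [he.size]; simp only; omega
    · simp at h3; omega
    · rw [he.found]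
      simp [Flagged, not_lt.1 hcap]

end Par

/-! ### Computing keys and updating a single table -/

open Expr in
/-- Computes the key with the number in register 10 of the name in register 8. -/
def keyProg : Stmt :=
  block [
    .assign 11 (const 0),
    forLoop 12 3 (.ite (same (reg 12) (reg 10 % reg 3) + (same (reg 12) (reg 10 / reg 3 % reg 3) +
        same (reg 12) (reg 10 / reg 3 / reg 3))) .skip
      (.assign 11 ((reg 11 * reg 1 + load (const 8 * (reg 8 * reg 0 + reg 12) + const 3)) % reg 5)))]

open Expr in
/-- Inserts the name in register 8 into the table in register 10. -/
def JoinMetric.insertStep (φ : JoinMetric) : Stmt :=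
  block [
    keyProg,
    .store (const 8 * (reg 8 * reg 4 + reg 10) + const 2) (reg 11),
    .assign 15 (reg 11 * reg 4 + reg 10),
    .assign 20 (const 4 * reg 15 + const 3),
    .assign 21 (const 4 * (reg 8 * reg 4 + reg 10) + const 2),
    linkProg,
    .store (const 8 * reg 15 + const 5) (load (const 8 * reg 15 + const 5) + const 1),
    φ.refresh]

open Expr in
/-- Inserts a point with name in register 8 and side in register 9, whose coordinates begin at the
position of the input that is in register 14. -/
def JoinMetric.insertPoint (φ : JoinMetric) : Stmt :=
  block [
    .store (const 8 * reg 8 + const 4) (reg 9),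
    forLoop 12 0 (.store (const 8 * (reg 8 * reg 0 + reg 12) + const 3) (input (reg 14 + reg 12))),
    forLoop 10 4 φ.insertStep]

open Expr in
/-- Deletes the name in register 8 from the table in register 10. -/
def JoinMetric.deleteStep (φ : JoinMetric) : Stmt :=
  block [
    .assign 15 (load (const 8 * (reg 8 * reg 4 + reg 10) + const 2) * reg 4 + reg 10),
    .assign 21 (const 4 * (reg 8 * reg 4 + reg 10) + const 2),
    unlinkProg,
    .store (const 8 * reg 15 + const 5) (load (const 8 * reg 15 + const 5) - const 1),
    φ.refresh]

namespace Par
variable (p : Par)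

/-- The memory represents the points `db s`, where table `S` contains the names `s ∈ P S`, and the
list of buckets is up to date. -/
def State (mem : ℕ → ℕ) (db : ℕ → ℕ × (ℕ → ℕ)) (P : ℕ → Finset ℕ) : Prop :=
  ∃ lst fl, p.Rep mem db P lst fl ∧ ∀ B, B ∈ fl ↔ p.Flagged db lst B

/-- The time for an update of a table. -/
def stepTime : ℕ := p.D * 60 + p.refreshTime + 300

/-- The time for an update of all tables. -/
def updateTime : ℕ := p.d * 40 + p.E * (p.stepTime + 20) + 100

variable {p} {mem mem' : ℕ → ℕ} {db db' : ℕ → ℕ × (ℕ → ℕ)} {P : ℕ → Finset ℕ}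
  {lst : ℕ → List ℕ} {fl : List ℕ}

namespace Rep

/-- The points under names that occur in no table are irrelevant. This permits switching to the new
roster before an insertion and after a deletion. -/
theorem congr_db (h : p.Rep mem db P lst fl) (hE : 0 < p.E)
    (hdb : ∀ S < p.E, ∀ s ∈ P S, db' s = db s) : p.Rep mem db' P lst fl where
  lists := h.lists
  mem_lst B s := by
    rw [h.mem_lst]
    refine and_congr_right fun hs => ?_
    rw [hdb _ (Nat.mod_lt _ hE) _ hs]
  count := h.count
  lt := h.lt
  stored S hS s hs := by
    rw [hdb _ hS _ hs]
    exact h.stored S hS s hs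

theorem congr_mem (h : p.Rep mem db P lst fl)
    (hm : ∀ k, k % 8 = 0 ∨ k % 8 = 1 ∨ k % 8 = 5 → mem' k = mem k)
    (hs : ∀ S < p.E, ∀ s ∈ P S, p.Stored mem S s (db s) → p.Stored mem' S s (db s)) :
    p.Rep mem' db P lst fl where
  lists := h.lists.congr fun a ha => hm a (by omega)
  mem_lst := h.mem_lst
  count B := (hm _ (by omega)).trans (h.count B)
  lt := h.lt
  stored S hS s hsP := by
    obtain ⟨h1, h2, h3⟩ := h.stored S hS s hsP
    exact ⟨h1, h2, hs S hS s hsP h3⟩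

theorem congr_set {P' : ℕ → Finset ℕ} (h : p.Rep mem db P lst fl) (hE : 0 < p.E)
    (hP : ∀ S < p.E, P' S = P S) : p.Rep mem db P' lst fl where
  lists := h.lists
  mem_lst B s := by rw [h.mem_lst, hP _ (Nat.mod_lt _ hE)]
  count := h.count
  lt := h.lt
  stored S hS s hs := h.stored S hS s (hP S hS ▸ hs)

end Rep

theorem Flagged.congr_db (hdb : ∀ B, ∀ s ∈ lst B, db' s = db s) (B : ℕ) :
    p.Flagged db' lst B ↔ p.Flagged db lst B := by
  have : ∀ l l' : List ℕ, (∀ s ∈ l, db' s = db s) → (∀ s ∈ l', db' s = db s) →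
      p.bucketPairs (B % p.E) db' l l' = p.bucketPairs (B % p.E) db l l' := by
    intro l l' h h'
    refine List.flatMap_congr fun a ha => ?_
    rw [h a ha]
    congr 1
    refine List.filter_congr fun b hb => ?_
    rw [h' b hb]
  rw [Flagged, Flagged, this _ _ (hdb B) (hdb B)]

namespace State

theorem congr_db (h : p.State mem db P) (hE : 0 < p.E)
    (hdb : ∀ S < p.E, ∀ s ∈ P S, db' s = db s) : p.State mem db' P := by
  obtain ⟨lst, fl, h, hf⟩ := h
  refine ⟨lst, fl, h.congr_db hE hdb, fun B => (hf B).trans (Flagged.congr_db (fun B s hs => ?_) B).symm⟩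
  exact hdb _ (Nat.mod_lt _ hE) s ((h.mem_lst B s).1 hs).1

theorem congr_mem (h : p.State mem db P)
    (hm : ∀ k, k % 8 = 0 ∨ k % 8 = 1 ∨ k % 8 = 5 → mem' k = mem k)
    (hs : ∀ S < p.E, ∀ s ∈ P S, p.Stored mem S s (db s) → p.Stored mem' S s (db s)) :
    p.State mem' db P := by
  obtain ⟨lst, fl, h, hf⟩ := h
  exact ⟨lst, fl, h.congr_mem hm hs, hf⟩

theorem congr_set {P' : ℕ → Finset ℕ} (h : p.State mem db P) (hE : 0 < p.E)
    (hP : ∀ S < p.E, P' S = P S) : p.State mem db P' := by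
  obtain ⟨lst, fl, h, hf⟩ := h
  exact ⟨lst, fl, h.congr_set hE hP, hf⟩

end State

theorem bucket_mod {S k : ℕ} (hS : S < p.E) : (k * p.E + S) % p.E = S := by
  rw [add_comm, Nat.add_mul_mod_self_right, Nat.mod_eq_of_lt hS]

theorem bucket_div {S k : ℕ} (hS : S < p.E) : (k * p.E + S) / p.E = k := by
  rw [add_comm, Nat.add_mul_div_right _ _ (by omega), Nat.div_eq_of_lt hS, zero_add]

theorem bucket_mod_div (B : ℕ) : B / p.E * p.E + B % p.E = B := Nat.div_add_mod' B p.E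

namespace Rep

/-- Since nodes decode uniquely to a name and a table, a name absent from table `S` has its node
there on no list. In table `S` only the bucket belonging to the key gains the name; buckets of other
tables have another residue modulo `E`. -/
theorem insert_elem (h : p.Rep mem db P lst fl) {S s : ℕ} (hS : S < p.E) (hs : s ∉ P S)
    (hsN : s < p.N) (hv : p.Valid (db s)) (hst : p.Stored mem S s (db s)) {B : ℕ}
    (hB : B = p.key S (db s).2 * p.E + S) :
    p.Rep (Function.update (linkMem mem (4 * B + 3) (p.elem S s)) (8 * B + 5) ((lst B).length + 1))
      db (Function.update P S (insert s (P S))) (Function.update lst B (s :: lst B)) fl := by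
  have hE : 0 < p.E := by omega
  have hBm : B % p.E = S := by rw [hB, bucket_mod hS]
  have hBd : B / p.E = p.key S (db s).2 := by rw [hB, bucket_div hS]
  have hm : ∀ k, 2 ≤ k % 8 → k % 8 ≤ 4 → Function.update (linkMem mem (4 * B + 3) (p.elem S s))
      (8 * B + 5) ((lst B).length + 1) k = mem k := by
    intro k hk hk'
    rw [Function.update_of_ne (by omega), linkMem_apply hk]
  constructor
  · rw [nodes_update_bucket, hBm, List.map_cons, ← hBm, ← nodes_bucket (fl := fl), hBm]
    refine HoldsLists.congr (h.lists.link (by omega) ?_ ?_ fun a ha => ?_) fun a ha => ?_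
    · unfold elem; omega
    · unfold elem; omega
    · rcases mem_nodes ha with ⟨-, B', hB', h2⟩ | ⟨B', -, s', hs', h2⟩
      · unfold elem at h2; omega
      · have hlt := Nat.mod_lt B' hE
        have h3 : s * p.E + S = s' * p.E + B' % p.E := by unfold elem at h2; omega
        have h4 : S = B' % p.E := by
          rw [← bucket_mod (k := s) hS, h3, bucket_mod hlt]
        have h5 : s = s' := by
          rw [← bucket_div (k := s) hS, h3, bucket_div hlt]
        rw [h.mem_lst, ← h4, ← h5] at hs'
        exact hs hs'.1
    · exact Function.update_of_ne (by omega) _ _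
  · intro B' s'
    by_cases hBB : B' = B
    · subst hBB
      rw [Function.update_self, hBm, Function.update_self, List.mem_cons, Finset.mem_insert,
        h.mem_lst, hBm, hBd]
      constructor
      · rintro (rfl | h1)
        exacts [⟨.inl rfl, rfl⟩, ⟨.inr h1.1, h1.2⟩]
      · rintro ⟨rfl | h1, h2⟩
        exacts [.inl rfl, .inr ⟨h1, h2⟩]
    · rw [Function.update_of_ne hBB, h.mem_lst]
      by_cases hBS : B' % p.E = S
      · rw [hBS, Function.update_self, Finset.mem_insert]
        constructor
        · exact fun h1 => ⟨.inr h1.1, h1.2⟩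
        · rintro ⟨rfl | h1, h2⟩
          · refine absurd ?_ hBB
            rw [← bucket_mod_div (p := p) B', ← h2, hBS, hB]
          · exact ⟨h1, h2⟩
      · rw [Function.update_of_ne hBS]
  · intro B'
    by_cases hBB : B' = B
    · subst hBB
      rw [Function.update_self, Function.update_self, List.length_cons]
    · rw [Function.update_of_ne (by omega), Function.update_of_ne hBB, linkMem_apply (by omega),
        h.count]
  · exact h.lt
  · intro S' hS' s' hs'
    have h1 : s' ∈ P S' ∨ s' = s ∧ S' = S := by
      by_cases hSS : S' = S
      · subst hSS
        rw [Function.update_self, Finset.mem_insert] at hs'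
        tauto
      · rw [Function.update_of_ne hSS] at hs'
        exact .inl hs'
    rcases h1 with h1 | ⟨rfl, rfl⟩
    · obtain ⟨h1, h2, h3⟩ := h.stored S' hS' s' h1
      exact ⟨h1, h2, h3.congr hm⟩
    · exact ⟨hsN, hv, hst.congr hm⟩

theorem erase_elem (h : p.Rep mem db P lst fl) {S s : ℕ} (hS : S < p.E) (hs : s ∈ P S) {B : ℕ}
    (hB : B = p.key S (db s).2 * p.E + S) :
    p.Rep (Function.update (unlinkMem mem (p.elem S s)) (8 * B + 5) ((lst B).length - 1))
      db (Function.update P S ((P S).erase s)) (Function.update lst B ((lst B).erase s)) fl := by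
  have hE : 0 < p.E := by omega
  have hBm : B % p.E = S := by rw [hB, bucket_mod hS]
  have hBd : B / p.E = p.key S (db s).2 := by rw [hB, bucket_div hS]
  have hsB : s ∈ lst B := by rw [h.mem_lst, hBm, hBd]; exact ⟨hs, rfl⟩
  constructor
  · rw [nodes_update_bucket, hBm, List.map_erase (elem_injective hE S), ← hBm,
      ← nodes_bucket (fl := fl), hBm]
    refine HoldsLists.congr (h.lists.unlink ?_) fun a ha => Function.update_of_ne (by omega) _ _
    rw [nodes_bucket, hBm]
    exact List.mem_map_of_mem hsB
  · intro B' s'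
    by_cases hBB : B' = B
    · subst hBB
      rw [Function.update_self, hBm, Function.update_self, (h.nodup_lst B').mem_erase_iff,
        Finset.mem_erase, h.mem_lst, hBm, and_assoc]
    · rw [Function.update_of_ne hBB, h.mem_lst]
      by_cases hBS : B' % p.E = S
      · rw [hBS, Function.update_self, Finset.mem_erase]
        constructor
        · refine fun h1 => ⟨⟨?_, h1.1⟩, h1.2⟩
          rintro rfl
          refine absurd ?_ hBB
          rw [← bucket_mod_div (p := p) B', ← h1.2, hBS, hB]
        · exact fun h1 => ⟨h1.1.2, h1.2⟩
      · rw [Function.update_of_ne hBS]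
  · intro B'
    by_cases hBB : B' = B
    · subst hBB
      rw [Function.update_self, Function.update_self, List.length_erase_of_mem hsB]
    · rw [Function.update_of_ne (by omega), Function.update_of_ne hBB, unlinkMem_apply (by omega),
        h.count]
  · exact h.lt
  · intro S' hS' s' hs'
    have h1 : s' ∈ P S' := by
      by_cases hSS : S' = S
      · subst hSS
        rw [Function.update_self] at hs'
        exact Finset.mem_of_mem_erase hs'
      · rwa [Function.update_of_ne hSS] at hs'
    obtain ⟨h1, h2, h3⟩ := h.stored S' hS' s' h1
    refine ⟨h1, h2, h3.congr fun k hk hk' => ?_⟩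
    rw [Function.update_of_ne (by omega), unlinkMem_apply hk]

/-- Another stored key is never overwritten: the address determines the name and the table, and for
the same name and table the value written is the one already required. -/
theorem store_key (h : p.Rep mem db P lst fl) {S s : ℕ} (hS : S < p.E) :
    p.Rep (Function.update mem (8 * (s * p.E + S) + 2) (p.key S (db s).2)) db P lst fl := by
  refine h.congr_mem (fun k hk => Function.update_of_ne (by omega) _ _) fun S' hS' s' _ hst => ?_
  refine ⟨?_, fun i hi => ?_, fun T hT => ?_⟩
  · rw [Function.update_of_ne (by omega), hst.side]
  · rw [Function.update_of_ne (by omega), hst.coord i hi]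
  · by_cases hk : s' * p.E + T = s * p.E + S
    · have h1 : T = S := by
        rw [← bucket_mod (p := p) (k := s') (by omega : T < p.E), hk, bucket_mod hS]
      have h2 : s' = s := by
        rw [← bucket_div (p := p) (k := s') (by omega : T < p.E), hk, bucket_div hS]
      rw [h1, h2, Function.update_self]
    · rw [Function.update_of_ne (by omega), hst.key T hT]

end Rep
end Par

namespace Par
variable {p : Par} {w : ℕ} {I : List ℕ} {ω : Tape} {σ : Config} {db : ℕ → ℕ × (ℕ → ℕ)}
  {P : ℕ → Finset ℕ}
open Expr

theorem keyUpTo_lt (hM : 0 < p.M) (S : ℕ) (x : ℕ → ℕ) (i : ℕ) : p.keyUpTo S x i < p.M := by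
  induction i with
  | zero => exact hM
  | succ i ih =>
    rw [keyUpTo]
    split_ifs
    exacts [ih, Nat.mod_lt _ hM]

/-- Horner's rule modulo `M`. Each intermediate value before the reduction is below `M * q`, hence
fits into a word. -/
theorem wp_keyProg (hp : p.Fits w) (hσ : p.Loaded σ) {S s : ℕ} {x : ℕ → ℕ} (hs : σ.reg 8 = s)
    (hS : σ.reg 10 = S) (hsN : s < p.N) (hx : ∀ i < p.d, x i < p.q)
    (hst : ∀ i < p.d, σ.mem (8 * (s * p.d + i) + 3) = x i) :
    wp w I ω keyProg (fun τ => (∀ y, y ≠ 11 → y ≠ 12 → τ.reg y = σ.reg y) ∧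
      τ.reg 11 = p.key S x ∧ τ.mem = σ.mem ∧ τ.out = σ.out ∧ τ.size = σ.size ∧
      τ.time ≤ σ.time + (20 + p.D * 60)) σ := by
  have hlt := hp.lt
  have hsp : p.space = 64 * (p.N * p.E) + 64 * (p.M * p.E) + 16 * (p.N * p.d) + 8 * p.N + 1000 := rfl
  have hDd := hp.D_le
  rw [keyProg, wp_block_cons, wp_assign, wp_block_cons]
  refine wp_forLoop p.D (fun i τ => (∀ y, y ≠ 11 → y ≠ 12 → τ.reg y = σ.reg y) ∧
      τ.reg 11 = p.keyUpTo S x i ∧ τ.mem = σ.mem ∧ τ.out = σ.out ∧ τ.size = σ.size ∧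
      τ.time ≤ σ.time + (4 + i * 60)) ?_ (by omega) (by norm_num) ?_ ?_ ?_
  · simp [hσ.D]
  · refine ⟨fun y h1 h2 => ?_, ?_, rfl, rfl, rfl, ?_⟩
    · simp [h1, h2]
    · simp [keyUpTo]
    · simp
  · rintro i hi τ ⟨hreg, h11, hmem, hout, hsize, htime⟩ h12 h3
    have h1 : 1 % 2 ^ w = 1 := Nat.mod_eq_of_lt (by omega)
    -- The disjunction of three tests is computed as a sum of indicators; it is at most 3, so it
    -- does not wrap around to 0.
    have haux : ∀ (A B C : Prop) [Decidable A] [Decidable B] [Decidable C],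
        ((if A then 1 else 0) + ((if B then 1 else 0) + (if C then 1 else 0)) % 2 ^ w) % 2 ^ w = 0 ↔
          ¬ (A ∨ B ∨ C) := by
      intro A B C _ _ _
      have h2 : 2 % 2 ^ w = 2 := Nat.mod_eq_of_lt (by omega)
      have h3 : 3 % 2 ^ w = 3 := Nat.mod_eq_of_lt (by omega)
      by_cases hA : A <;> by_cases hB : B <;> by_cases hC : C <;>
        simp only [hA, hB, hC, if_true, if_false, Nat.reduceAdd, h1, h2, h3, Nat.zero_mod] <;> simp
    have h2 := name_mul_add_lt hsN (by omega : i < p.d)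
    have hk := p.keyUpTo_lt hp.M_pos S x i
    have hk' : p.keyUpTo S x i * p.q + p.q ≤ p.M * p.q := by
      rw [← Nat.succ_mul]; exact Nat.mul_le_mul_right _ hk
    have hxi := hx i (by omega)
    have hsi := hst i (by omega)
    have hc : ((same (reg 12) (reg 10 % reg 3) + (same (reg 12) (reg 10 / reg 3 % reg 3) +
        same (reg 12) (reg 10 / reg 3 / reg 3))).eval w I { τ with time := τ.time + 4 } = 0) ↔
        ¬ p.Skips S i := by
      simp only [eval_add, eval_same, eval_reg, eval_mod, eval_div, h12, h3,
        hreg 10 (by norm_num) (by norm_num), hS, h1, Skips]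
      exact haux _ _ _
    refine wp.intro fun Q hQ => ?_
    rw [wp_ite]
    by_cases hsk : p.Skips S i
    · rw [if_neg (by rw [hc]; exact not_not.2 hsk), wp_skip]
      refine hQ _ ⟨h12, h3, fun y h1 h2 => ?_, ?_, hmem, hout, hsize, ?_⟩
      · simp [h2, hreg y h1]
      · simp [h11, keyUpTo, hsk]
      · simp; omega
    · rw [if_pos (hc.2 hsk)]
      simp (disch := omega) [h11, h12, hreg, hs, hmem, hσ.q, hσ.M, hσ.d, Nat.mod_eq_of_lt, hsi]
      refine hQ _ ⟨by simpa using h12, by simpa using h3, fun y h1 h2 => ?_, ?_, rfl, hout,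
        hsize, ?_⟩
      · simp [h2, h1, hreg y h1]
      · simp [keyUpTo, hsk]
      · simp; omega
  · rintro τ ⟨hreg, h11, hmem, hout, hsize, htime⟩ - -
    rw [wp_block_nil]
    exact ⟨hreg, h11, hmem, hout, hsize, by simp only; omega⟩

/-- Tables are filled in increasing order. When table `S` is treated, the keys of the new point for
all smaller tables are already in memory, and the visit of the bucket needs them to decide whether a
pair has a common key earlier. -/
theorem wp_insertStep (hp : p.Fits w) (hσ : p.Loaded σ) (hst : p.State σ.mem db P) {S s : ℕ}
    (hs : σ.reg 8 = s) (hS : σ.reg 10 = S) (hSE : S < p.E) (hsN : s < p.N) (hsP : s ∉ P S)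
    (hv : p.Valid (db s)) (hside : σ.mem (8 * s + 4) = (db s).1)
    (hcoord : ∀ i < p.d, σ.mem (8 * (s * p.d + i) + 3) = (db s).2 i)
    (hkey : ∀ T < S, σ.mem (8 * (s * p.E + T) + 2) = p.key T (db s).2) :
    wp w I ω p.φ.insertStep (fun τ => Works p 11 p.stepTime σ τ ∧
      p.State τ.mem db (Function.update P S (insert s (P S))) ∧ p.Stored τ.mem S s (db s)) σ := by
  have hlt := hp.lt
  have hE := hp.E_pos
  have hsp : p.space = 64 * (p.N * p.E) + 64 * (p.M * p.E) + 16 * (p.N * p.d) + 8 * p.N + 1000 := rfl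
  have htm : p.stepTime = p.D * 60 + p.refreshTime + 300 := rfl
  have hsE := name_mul_add_lt hsN hSE
  have hk := p.key_lt hp.M_pos S (db s).2
  have hkE := name_mul_add_lt hk hSE
  obtain ⟨lst, fl, hr, hfl⟩ := hst
  set B := p.key S (db s).2 * p.E + S with hB
  have hBm : B % p.E = S := bucket_mod hSE
  have hr1 := hr.store_key (s := s) hSE
  have hst1 : p.Stored (Function.update σ.mem (8 * (s * p.E + S) + 2) (p.key S (db s).2)) S s
      (db s) := by
    refine ⟨?_, fun i hi => ?_, fun T hT => ?_⟩
    · rw [Function.update_of_ne (by omega), hside]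
    · rw [Function.update_of_ne (by omega), hcoord i hi]
    · rcases hT.lt_or_eq with hT | rfl
      · rw [Function.update_of_ne (by omega), hkey T hT]
      · rw [Function.update_self]
  have hr2 := hr1.insert_elem hSE hsP hsN hv hst1 hB
  have hnext := hr1.next_le hE (a := 4 * B + 3) (by omega) List.mem_cons_self
  set m1 := Function.update σ.mem (8 * (s * p.E + S) + 2) (p.key S (db s).2) with hm1
  refine wp.intro fun Q hQ => ?_
  rw [JoinMetric.insertStep, wp_block_cons]
  refine wp.mono (wp_keyProg hp hσ hs hS hsN hv.lt hcoord) ?_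
  rintro τ - ⟨hreg, h11, hmem, hout, hsize, htime⟩
  have he : p.elem S s = 4 * (s * p.E + S) + 2 := rfl
  simp only [wp_block_cons, wp_store, wp_assign]
  simp (disch := omega) [h11, hreg, hs, hS, hσ.E, hmem, Nat.mod_eq_of_lt, ← hB, ← hm1, ← he]
  refine wp.mono (wp_linkProg hp (h := 4 * B + 3) (x := p.elem S s) (by simp) (by simp)
    (by omega) (by omega) (by simp only; omega)) ?_
  rintro υ - ⟨hw, hvm⟩
  have hvreg := hw.reg
  simp only at hvm
  have hvsize := hw.size
  have hvtime := hw.time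
  have hv15 : υ.reg 15 = B := by simp (disch := omega) [hvreg]
  have hcnt : υ.mem (8 * B + 5) = (lst B).length := by
    rw [hvm, linkMem_apply (by omega), hr1.count]
  -- The names in a bucket are distinct and below `N`, so incrementing the counter cannot overflow.
  have hlen : (lst B).length ≤ p.N := by
    have := (hr.nodup_lst B).subperm (l₂ := List.range p.N) fun x hx => by
      rw [hr.mem_lst, hBm] at hx
      exact List.mem_range.2 (hr.stored S hSE x hx.1).1
    simpa using this.length_le
  simp only at hvsize hvtime
  simp (disch := omega) [hv15, hcnt, Nat.mod_eq_of_lt]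
  rw [hvm]
  refine wp.mono (wp_refresh hp (hσ.congr fun y hy => ?_) hr2 (B := B) ?_ hv15 hkE fun B' hB' => ?_) ?_
  · simp (disch := omega) [hvreg, Function.update_of_ne, hreg]
  · simp (disch := omega) [hvreg, hreg, hS, hBm]
  · rw [hfl, Flagged, Flagged, Function.update_of_ne hB']
  rintro ξ - ⟨hw', hm', fl', hr', hf'⟩
  have hsize' := hw'.size
  have htime' := hw'.time
  simp only at hsize' htime'
  rw [wp_block_nil]
  refine hQ _ ⟨⟨fun y hy => ?_, ?_, ?_, ?_⟩, ⟨_, fl', hr', hf'⟩, hst1.congr fun k hk hk' => ?_⟩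
  · rw [hw'.reg y (by omega)]
    simp (disch := omega) [hvreg, Function.update_of_ne, hreg]
  · rw [hw'.out]; exact hw.out.trans hout
  · omega
  · omega
  · rw [hm' k hk]
    simp only
    rw [Function.update_of_ne (by omega), linkMem_apply hk]

theorem wp_deleteStep (hp : p.Fits w) (hσ : p.Loaded σ) (hst : p.State σ.mem db P) {S s : ℕ}
    (hs : σ.reg 8 = s) (hS : σ.reg 10 = S) (hSE : S < p.E) (hsP : s ∈ P S) :
    wp w I ω p.φ.deleteStep (fun τ => Works p 11 p.stepTime σ τ ∧
      p.State τ.mem db (Function.update P S ((P S).erase s))) σ := by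
  have hlt := hp.lt
  have hE := hp.E_pos
  have hsp : p.space = 64 * (p.N * p.E) + 64 * (p.M * p.E) + 16 * (p.N * p.d) + 8 * p.N + 1000 := rfl
  have htm : p.stepTime = p.D * 60 + p.refreshTime + 300 := rfl
  obtain ⟨lst, fl, hr, hfl⟩ := hst
  obtain ⟨hsN, hv, hst⟩ := hr.stored S hSE s hsP
  have hsE := name_mul_add_lt hsN hSE
  have hk := p.key_lt hp.M_pos S (db s).2
  have hkE := name_mul_add_lt hk hSE
  have hkm := hst.key S le_rfl
  set B := p.key S (db s).2 * p.E + S with hB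
  have hBm : B % p.E = S := bucket_mod hSE
  have hBd : B / p.E = p.key S (db s).2 := bucket_div hSE
  have hr2 := hr.erase_elem hSE hsP hB
  have hn : p.elem S s ∈ p.nodes lst fl (4 * B + 3) := by
    rw [nodes_bucket, hBm]
    refine List.mem_map_of_mem ?_
    rw [hr.mem_lst, hBm, hBd]
    exact ⟨hsP, rfl⟩
  have hnext := hr.next_le hE (a := 4 * B + 3) (by omega) (List.mem_cons_of_mem _ hn)
  have hprev := hr.prev_le hE (by omega) hn
  have he : p.elem S s = 4 * (s * p.E + S) + 2 := rfl
  refine wp.intro fun Q hQ => ?_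
  simp only [JoinMetric.deleteStep, wp_block_cons, wp_assign]
  simp (disch := omega) [hs, hS, hσ.E, Nat.mod_eq_of_lt, hkm, ← hB, ← he]
  refine wp.mono (wp_unlinkProg hp (x := p.elem S s) (by simp) (by omega) (by simp only; omega)
    (by simp only; omega)) ?_
  rintro υ - ⟨hw, hvm⟩
  have hvreg := hw.reg
  simp only at hvm
  have hvsize := hw.size
  have hvtime := hw.time
  have hv15 : υ.reg 15 = B := by simp (disch := omega) [hvreg]
  have hcnt : υ.mem (8 * B + 5) = (lst B).length := by
    rw [hvm, unlinkMem_apply (by omega), hr.count]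
  simp only at hvsize hvtime
  simp (disch := omega) [hv15, hcnt, Nat.mod_eq_of_lt]
  rw [hvm]
  refine wp.mono (wp_refresh hp (hσ.congr fun y hy => ?_) hr2 (B := B) ?_ hv15 hkE fun B' hB' => ?_) ?_
  · simp (disch := omega) [hvreg, Function.update_of_ne]
  · simp (disch := omega) [hvreg, hS, hBm]
  · rw [hfl, Flagged, Flagged, Function.update_of_ne hB']
  rintro ξ - ⟨hw', hm', fl', hr', hf'⟩
  have hsize' := hw'.size
  have htime' := hw'.time
  simp only at hsize' htime'
  rw [wp_block_nil]
  refine hQ _ ⟨⟨fun y hy => ?_, ?_, ?_, ?_⟩, ⟨_, fl', hr', hf'⟩⟩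
  · rw [hw'.reg y (by omega)]
    simp (disch := omega) [hvreg, Function.update_of_ne]
  · rw [hw'.out]; exact hw.out
  · omega
  · omega

end Par

/-! ### Insertion, deletion and enumeration -/

open Expr in
/-- Inserts the point given in the input. -/
def JoinMetric.insertProg (φ : JoinMetric) : Stmt :=
  block [.assign 8 (input (const 0)), .assign 9 (input (const 1)), .assign 14 (const 2),
    φ.insertPoint]

open Expr in
/-- Deletes the point whose name is given in the input. -/
def JoinMetric.deleteProg (φ : JoinMetric) : Stmt :=
  block [.assign 8 (input (const 0)), forLoop 10 4 φ.deleteStep]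

open Expr in
/-- Reports the pairs of all buckets on the list of buckets. -/
def JoinMetric.enumProg (φ : JoinMetric) : Stmt :=
  block [
    .assign 17 (const 1),
    .assign 18 (load (const 8)),
    .while (reg 18) (block [
      .assign 15 ((reg 18 - const 4) / const 4),
      .assign 10 (reg 15 % reg 4),
      φ.visit,
      .assign 18 (load (const 8 * reg 18))])]

/-- Appends times between `a` and `b` to a list of times. -/
theorem isChain_append_times {D a b : ℕ} {ts new : List ℕ}
    (h : ts.IsChain fun s t => t ≤ s + D) (hl : ∀ m ∈ ts.getLast?, b ≤ m + D)
    (hn : ∀ t ∈ new, a ≤ t ∧ t ≤ b) (hab : b ≤ a + D) :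
    (ts ++ new).IsChain fun s t => t ≤ s + D := by
  refine List.isChain_append.2 ⟨h, ?_, fun m hm t ht => ?_⟩
  · refine List.Pairwise.isChain (List.pairwise_of_forall_mem_list fun s hs t ht => ?_)
    have := hn s hs
    have := hn t ht
    omega
  · have := hl m hm
    have := hn t (List.mem_of_mem_head? ht)
    omega

namespace Par
variable {p : Par} {w : ℕ} {I : List ℕ} {ω : Tape} {σ : Config} {db : ℕ → ℕ × (ℕ → ℕ)}
  {P₀ : Finset ℕ}
open Expr

theorem wp_insertPoint (hp : p.Fits w) (hσ : p.Loaded σ) (hst : p.State σ.mem db fun _ => P₀)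
    {s b : ℕ} (hs : σ.reg 8 = s) (hsN : s < p.N) (hsP : s ∉ P₀) (hv : p.Valid (db s))
    (h9 : σ.reg 9 = (db s).1) (h14 : σ.reg 14 = b)
    (hI : ∀ i < p.d, b + i < 2 ^ w ∧ I.getD (b + i) 0 = (db s).2 i) :
    wp w I ω p.φ.insertPoint (fun τ => Works p 10 p.updateTime σ τ ∧
      p.State τ.mem db fun _ => insert s P₀) σ := by
  have hlt := hp.lt
  have hE := hp.E_pos
  have hsp : p.space = 64 * (p.N * p.E) + 64 * (p.M * p.E) + 16 * (p.N * p.d) + 8 * p.N + 1000 := rfl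
  have htm : p.updateTime = p.d * 40 + p.E * (p.stepTime + 20) + 100 := rfl
  refine wp.intro fun Q hQ => ?_
  rw [JoinMetric.insertPoint, wp_block_cons, wp_store, wp_block_cons]
  simp (disch := omega) only [eval_add, eval_mul, eval_const, eval_reg, hs, h9, Nat.mod_eq_of_lt,
    cost_add, cost_mul, cost_const, cost_reg]
  refine wp_forLoop p.d (fun i τ => Works p 10 (20 + i * 40) σ τ ∧ τ.reg 14 = b ∧
    (∀ k, k % 8 ≠ 4 → k % 8 ≠ 3 → τ.mem k = σ.mem k) ∧ τ.mem (8 * s + 4) = (db s).1 ∧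
    (∀ s', s' ≠ s → τ.mem (8 * s' + 4) = σ.mem (8 * s' + 4)) ∧
    (∀ s', s' ≠ s → ∀ j < p.d, τ.mem (8 * (s' * p.d + j) + 3) = σ.mem (8 * (s' * p.d + j) + 3)) ∧
    ∀ j < i, τ.mem (8 * (s * p.d + j) + 3) = (db s).2 j) ?_ (by omega) (by norm_num) ?_ ?_ ?_
  · exact hσ.d
  · refine ⟨⟨fun y hy => ?_, rfl, ?_, ?_⟩, ?_, fun k hk hk' => ?_, ?_, fun s' hs' => ?_,
      fun s' hs' j hj => ?_, by simp⟩
    · simp (disch := omega) [Function.update_of_ne]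
    · simp only; omega
    · simp only; omega
    · simpa using h14
    · exact Function.update_of_ne (by omega) _ _
    · simp
    · exact Function.update_of_ne (by omega) _ _
    · exact Function.update_of_ne (by omega) _ _
  · rintro i hi τ ⟨hw, h14, hm1, hm2, hm3, hm4, hm5⟩ h12 h0
    have h1 := name_mul_add_lt hsN hi
    have h8 : τ.reg 8 = s := (hw.reg 8 (by norm_num)).trans hs
    have hsize := hw.size
    have htime := hw.time
    have hvi := hv.lt i hi
    obtain ⟨hI1, hI2⟩ := hI i hi
    refine wp.intro fun Q hQ => ?_
    rw [wp_store]
    simp (disch := omega) only [eval_add, eval_mul, eval_const, eval_reg, eval_input, h8, h12, h0,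
      h14, hI2, Nat.mod_eq_of_lt, cost_add, cost_mul, cost_const, cost_reg, cost_input]
    refine hQ _ ⟨h12, h0, ⟨fun y hy => ?_, hw.out, ?_, ?_⟩, ?_, fun k hk hk' => ?_, ?_,
      fun s' hs' => ?_, fun s' hs' j hj => ?_, fun j hj => ?_⟩
    · simp (disch := omega) [Function.update_of_ne, hw.reg]
    · simp only; omega
    · simp only; omega
    · simpa using h14
    · simp only
      rw [Function.update_of_ne (by omega), hm1 k hk hk']
    · simp only
      rw [Function.update_of_ne (by omega), hm2]
    · simp only
      rw [Function.update_of_ne (by omega), hm3 s' hs']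
    · simp only
      rw [Function.update_of_ne, hm4 s' hs' j hj]
      intro h
      have h2 : s' * p.d + j = s * p.d + i := by omega
      have hd : 0 < p.d := by omega
      apply hs'
      have h3 : (s' * p.d + j) / p.d = s' := by
        rw [add_comm, Nat.add_mul_div_right _ _ hd, Nat.div_eq_of_lt hj, zero_add]
      have h4 : (s * p.d + i) / p.d = s := by
        rw [add_comm, Nat.add_mul_div_right _ _ hd, Nat.div_eq_of_lt hi, zero_add]
      rw [← h3, h2, h4]
    · rcases Nat.lt_succ_iff_lt_or_eq.1 hj with hj | rfl
      · simp only
        rw [Function.update_of_ne (by omega), hm5 j hj]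
      · simp
  rintro τ ⟨hw, -, hm1, hm2, hm3, hm4, hm5⟩ - -
  -- Writing side and coordinates under a free name does not disturb the points that are
  -- represented.
  have hst' : p.State τ.mem db fun _ => P₀ := by
    refine hst.congr_mem (fun k hk => hm1 k (by omega) (by omega)) fun S hS s' hs' h => ?_
    have hne : s' ≠ s := fun h => hsP (h ▸ hs')
    exact ⟨(hm3 s' hne).trans h.side, fun j hj => (hm4 s' hne j hj).trans (h.coord j hj),
      fun T hT => (hm1 _ (by omega) (by omega)).trans (h.key T hT)⟩
  rw [wp_block_cons]
  have hreg := hw.reg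
  have hsize := hw.size
  have htime := hw.time
  -- During the loop the tables disagree on the set of names: those below `i` already contain the
  -- new point, the others do not. For this reason `State` takes one set for each table.
  refine wp_forLoop p.E (fun i υ => Works p 10 (p.d * 40 + 50 + i * (p.stepTime + 20)) σ υ ∧
    p.State υ.mem db (fun S => if S < i then insert s P₀ else P₀) ∧
    υ.mem (8 * s + 4) = (db s).1 ∧ (∀ j < p.d, υ.mem (8 * (s * p.d + j) + 3) = (db s).2 j) ∧
    ∀ T < i, υ.mem (8 * (s * p.E + T) + 2) = p.key T (db s).2) ?_ (by omega) (by norm_num) ?_ ?_ ?_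
  · simp [hreg, hσ.E]
  · refine ⟨⟨fun y hy => ?_, hw.out, hsize, ?_⟩, ?_, hm2, hm5, by simp⟩
    · simp (disch := omega) [Function.update_of_ne, hreg]
    · simp only; omega
    · simpa using hst'
  · rintro i hi υ ⟨hw, hst, hside, hcoord, hkey⟩ h10 h4
    have hsize := hw.size
    have htime := hw.time
    refine wp.mono (wp_insertStep (σ := { υ with time := υ.time + 4 }) hp (S := i) (s := s) (hσ.congr fun y hy => hw.reg y (by omega)) hst
      ((hw.reg 8 (by norm_num)).trans hs) h10 hi hsN (by simpa using hsP) hv hside hcoord hkey) ?_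
    rintro ξ - ⟨hw', hst', hs'⟩
    have hsize' := hw'.size
    have htime' := hw'.time
    simp only at hsize' htime'
    refine ⟨(hw'.reg 10 (by norm_num)).trans h10, (hw'.reg 4 (by norm_num)).trans h4,
      ⟨fun y hy => ?_, hw'.out.trans hw.out, by simp only; omega, ?_⟩, ?_, hs'.side, hs'.coord,
      fun T hT => hs'.key T (by omega)⟩
    · simp (disch := omega) only [Function.update_of_ne]
      exact (hw'.reg y (by omega)).trans (hw.reg y hy)
    · simp only [add_one_mul]; omega
    · refine hst'.congr_set hE fun S hS => ?_
      by_cases hSi : S = i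
      · subst hSi; simp
      · rw [Function.update_of_ne hSi]
        have : S < i + 1 ↔ S < i := by omega
        simp [this]
  · rintro υ ⟨hw, hst, -⟩ - -
    have hsize := hw.size
    have htime := hw.time
    rw [wp_block_nil]
    refine hQ _ ⟨⟨hw.reg, hw.out, hsize, ?_⟩, ?_⟩
    · simp only; omega
    · exact hst.congr_set hE fun S hS => by rw [if_pos hS]

theorem wp_insertProg (hp : p.Fits w) (hσ : p.Loaded σ) (hst : p.State σ.mem db fun _ => P₀)
    {s : ℕ} (hs : I.getD 0 0 = s) (hsN : s < p.N) (hsP : s ∉ P₀) (hv : p.Valid (db s))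
    (h9 : I.getD 1 0 = (db s).1) (hI : ∀ i < p.d, I.getD (2 + i) 0 = (db s).2 i) :
    wp w I ω p.φ.insertProg (fun τ => Works p 8 (p.updateTime + 50) σ τ ∧
      p.State τ.mem db fun _ => insert s P₀) σ := by
  have hlt := hp.lt
  have hsp : p.space = 64 * (p.N * p.E) + 64 * (p.M * p.E) + 16 * (p.N * p.d) + 8 * p.N + 1000 := rfl
  have hv1 := hv.side
  rw [JoinMetric.insertProg, wp_block_cons, wp_assign, wp_block_cons, wp_assign, wp_block_cons,
    wp_assign, wp_block_cons]
  simp (disch := omega) only [eval_input, eval_const, hs, h9, Nat.mod_eq_of_lt, cost_input,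
    cost_const]
  refine wp.mono (wp_insertPoint hp ?_ ?_ (s := s) (b := 2) ?_ hsN hsP hv ?_ ?_
    fun i hi => ⟨by omega, hI i hi⟩) ?_
  · refine hσ.congr fun y hy => ?_
    simp (disch := omega) [Function.update_of_ne]
  · exact hst
  · simp
  · simp
  · simp
  · rintro τ - ⟨hw, hst⟩
    have htime := hw.time
    simp only at htime
    rw [wp_block_nil]
    refine ⟨⟨fun y hy => ?_, hw.out, hw.size, by omega⟩, hst⟩
    rw [hw.reg y (by omega)]
    simp (disch := omega) [Function.update_of_ne]

theorem wp_deleteProg (hp : p.Fits w) (hσ : p.Loaded σ) (hst : p.State σ.mem db fun _ => P₀)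
    {s : ℕ} (hs : I.getD 0 0 = s) (hsN : s < p.N) (hsP : s ∈ P₀) :
    wp w I ω p.φ.deleteProg (fun τ => Works p 8 (p.updateTime + 50) σ τ ∧
      p.State τ.mem db fun _ => P₀.erase s) σ := by
  have hlt := hp.lt
  have hE := hp.E_pos
  have hsp : p.space = 64 * (p.N * p.E) + 64 * (p.M * p.E) + 16 * (p.N * p.d) + 8 * p.N + 1000 := rfl
  have htm : p.updateTime = p.d * 40 + p.E * (p.stepTime + 20) + 100 := rfl
  refine wp.intro fun Q hQ => ?_
  rw [JoinMetric.deleteProg, wp_block_cons, wp_assign, wp_block_cons]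
  simp (disch := omega) only [eval_input, eval_const, hs, Nat.mod_eq_of_lt, cost_input, cost_const]
  refine wp_forLoop p.E (fun i υ => Works p 8 (50 + i * (p.stepTime + 20)) σ υ ∧ υ.reg 8 = s ∧
    p.State υ.mem db (fun S => if S < i then P₀.erase s else P₀)) ?_ (by omega) (by norm_num) ?_ ?_ ?_
  · simp [hσ.E]
  · refine ⟨⟨fun y hy => ?_, rfl, by simp, ?_⟩, by simp, ?_⟩
    · simp (disch := omega) [Function.update_of_ne]
    · simp only; omega
    · simpa using hst
  · rintro i hi υ ⟨hw, h8, hst⟩ h10 h4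
    have hsize := hw.size
    have htime := hw.time
    refine wp.mono (wp_deleteStep (σ := { υ with time := υ.time + 4 }) hp (S := i) (s := s) (hσ.congr fun y hy => hw.reg y (by omega)) hst
      h8 h10 hi (by simpa using hsP)) ?_
    rintro ξ - ⟨hw', hst'⟩
    have hsize' := hw'.size
    have htime' := hw'.time
    simp only at hsize' htime'
    refine ⟨(hw'.reg 10 (by norm_num)).trans h10, (hw'.reg 4 (by norm_num)).trans h4,
      ⟨fun y hy => ?_, hw'.out.trans hw.out, by simp only; omega, ?_⟩, ?_, ?_⟩
    · simp (disch := omega) only [Function.update_of_ne]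
      exact (hw'.reg y (by omega)).trans (hw.reg y hy)
    · simp only [add_one_mul]; omega
    · simpa using (hw'.reg 8 (by norm_num)).trans h8
    · refine hst'.congr_set hE fun S hS => ?_
      by_cases hSi : S = i
      · subst hSi; simp
      · rw [Function.update_of_ne hSi]
        have : S < i + 1 ↔ S < i := by omega
        simp [this]
  · rintro υ ⟨hw, h8, hst⟩ - -
    have hsize := hw.size
    have htime := hw.time
    rw [wp_block_nil]
    refine hQ _ ⟨⟨hw.reg, hw.out, hsize, ?_⟩, ?_⟩
    · simp only; omega
    · exact hst.congr_set hE fun S hS => by rw [if_pos hS]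

end Par

/-! ### Construction, and the delay of an enumeration -/

open Expr in
/-- Reads the parameters and inserts the initial points. Here `K` and `L` are constants that
determine the number of keys and the bound for the size of the buckets that are examined. -/
def JoinMetric.buildProg (φ : JoinMetric) (K L : ℕ) : Stmt :=
  block [
    .assign 7 (input (const 0)),
    .assign 0 (input (const 1)),
    .assign 1 (input (const 2)),
    .assign 2 (input (const 3)),
    .assign 3 (const 0),
    .assign 19 (const 1),
    .while (less (reg 19) (reg 7))
      (block [.assign 19 (reg 19 * const 2), .assign 3 (reg 3 + const 1)]),
    .assign 4 (reg 3 * reg 3 * reg 3),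
    .assign 5 (reg 7 / const K + const 1),
    .assign 6 (const L * reg 3),
    forLoop 8 7 (block [
      .assign 9 (input (const 4 + reg 8 * (reg 0 + const 1))),
      .assign 14 (const 5 + reg 8 * (reg 0 + const 1)),
      φ.insertPoint])]

/-- The parameters for a structure that is built for `n` points. -/
def Par.ofSize (φ : JoinMetric) (K L n d q R : ℕ) : Par where
  φ := φ
  d := d
  q := q
  R := R
  D := Nat.clog 2 n
  E := Nat.clog 2 n * Nat.clog 2 n * Nat.clog 2 n
  M := n / K + 1
  cap := L * Nat.clog 2 n
  N := 2 * n

namespace Par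
variable {p : Par} {w : ℕ} {I : List ℕ} {ω : Tape} {σ : Config} {db : ℕ → ℕ × (ℕ → ℕ)}
  {P₀ : Finset ℕ}
open Expr

/-- The bound for the delay. -/
def delayTime (p : Par) : ℕ := 2 * p.visitTime p.cap + 100

/-- Every bucket on the list emits at least one pair and is small. Thus between consecutive reports
lie at most the rest of one visit and the beginning of the next, whence the factor 2 in `delayTime`.
The invariant says that at most one visit and 20 steps have passed since the last report, or since
the start. -/
theorem wp_enumProg (hp : p.Fits w) (hσ : p.Loaded σ) {lst : ℕ → List ℕ} {fl : List ℕ}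
    (hr : p.Rep σ.mem db (fun _ => P₀) lst fl) (hfl : ∀ B ∈ fl, p.Flagged db lst B)
    (ht : σ.time = 0) (ho : σ.out = []) :
    wp w I ω p.φ.enumProg (fun τ => (∀ y < 7, τ.reg y = σ.reg y) ∧ τ.mem = σ.mem ∧
      τ.size = σ.size ∧
      τ.out.map Prod.snd = fl.flatMap (fun B => p.bucketPairs (B % p.E) db (lst B) (lst B)) ∧
      (0 :: (τ.out.map Prod.fst ++ [τ.time])).IsChain fun s t => t ≤ s + p.delayTime) σ := by
  have hlt := hp.lt
  have hE := hp.E_pos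
  have hsp : p.space = 64 * (p.N * p.E) + 64 * (p.M * p.E) + 16 * (p.N * p.d) + 8 * p.N + 1000 := rfl
  have hdt : p.delayTime = 2 * p.visitTime p.cap + 100 := rfl
  have hl := hr.lists.linked 1 (by norm_num)
  rw [nodes_one] at hl
  have hnext : ∀ l₁ B l₂, fl = l₁ ++ B :: l₂ →
      σ.mem (8 * (4 * B + 4)) = (l₂.map fun B => 4 * B + 4).headD 0 := by
    rintro l₁ B l₂ rfl
    rw [List.map_append, List.map_cons] at hl
    exact hl.next
  have hhead := hl.next_head
  rw [JoinMetric.enumProg, wp_block_cons, wp_assign, wp_block_cons, wp_assign, wp_block_cons]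
  simp (disch := omega) only [eval_load, eval_const, Nat.mod_eq_of_lt, cost_load, cost_const]
  refine wp_while_list fl (fun l₁ l₂ τ => (∀ y < 7, τ.reg y = σ.reg y) ∧ τ.mem = σ.mem ∧
    τ.size = σ.size ∧ τ.reg 17 = 1 ∧ τ.reg 18 = (l₂.map fun B => 4 * B + 4).headD 0 ∧
    τ.out.map Prod.snd = l₁.flatMap (fun B => p.bucketPairs (B % p.E) db (lst B) (lst B)) ∧
    ((0 :: τ.out.map Prod.fst).IsChain fun s t => t ≤ s + p.delayTime) ∧
    ∀ m ∈ (0 :: τ.out.map Prod.fst).getLast?, τ.time ≤ m + p.visitTime p.cap + 20) ?_ ?_ ?_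
  · refine ⟨fun y hy => ?_, rfl, rfl, by simp, ?_, by simp [ho], by simp [ho], by simp [ho, ht]⟩
    · simp (disch := omega) [Function.update_of_ne]
    · simpa using hhead
  · rintro l₁ B l₂ hl₁ τ ⟨hreg, hmem, hsize, h17, h18, hout, hch, hlast⟩
    have hB : B ∈ fl := by rw [hl₁]; simp
    have hBM := hr.lt B hB
    have hSE := Nat.mod_lt B hE
    obtain ⟨hcap, hne⟩ := hfl B hB
    have h18' : τ.reg 18 = 4 * B + 4 := h18
    refine ⟨by simp [h18'], ?_⟩
    refine wp.intro fun Q hQ => ?_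
    rw [wp_block_cons, wp_assign, wp_block_cons, wp_assign, wp_block_cons]
    simp (disch := omega) [h18', Nat.mod_eq_of_lt, hreg, hσ.E]
    have hlB := hr.lists.linked (4 * B + 3) (by omega)
    rw [nodes_bucket, ← hmem] at hlB
    refine wp.mono (wp_visit hp (S := B % p.E) (B := B) (l := lst B) (db := db)
      (hσ.congr fun y hy => ?_) ?_ hSE ?_ hBM hlB fun s hs => ?_) ?_
    · simp (disch := omega) [Function.update_of_ne, hreg]
    · simp
    · simp
    · have := hr.stored _ hSE s ((hr.mem_lst B s).1 hs).1
      simpa only [hmem] using this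
    rintro υ hυ he
    obtain ⟨new, h1, h2, h3⟩ := he.out
    have h4 := he.le_time
    have h5 := p.visitTime_mono hcap
    simp only at h1 h3 h4 hυ
    simp [h17] at h2
    have hmem' : υ.mem = σ.mem := he.mem.trans hmem
    have h18'' : υ.reg 18 = 4 * B + 4 := by
      rw [he.reg 18 (by norm_num) (by norm_num)]; simpa using h18'
    simp (disch := omega) [h18'', Nat.mod_eq_of_lt, hmem', hnext _ _ _ hl₁]
    -- The bucket is flagged, so its visit is not silent; the last report can therefore be taken
    -- from this visit.
    have hnew : new ≠ [] := by
      rintro rfl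
      exact hne h2.symm
    refine hQ _ ⟨fun y hy => ?_, rfl, ?_, ?_, by simp, ?_, ?_, ?_⟩
    · simp (disch := omega) only [Function.update_of_ne]
      rw [he.reg y (by omega) (by omega)]
      simp (disch := omega) [Function.update_of_ne, hreg]
    · exact he.size.trans hsize
    · simp only
      rw [Function.update_of_ne (by norm_num)]
      rw [he.reg 17 (by norm_num) (by norm_num)]
      simpa using h17
    · simp only [h1, List.map_append, hout, h2, List.flatMap_append, List.flatMap_singleton]
    · simp only [h1, List.map_append, ← List.cons_append]
      refine isChain_append_times hch (a := τ.time + 6 + 4) (b := υ.time) (fun m hm => ?_)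
        (fun t ht => ?_) (by omega)
      · have := hlast m hm; omega
      · obtain ⟨e, he, rfl⟩ := List.mem_map.1 ht
        have := h3 e he
        omega
    · intro m hm
      simp only [h1, List.map_append, ← List.cons_append] at hm
      rw [List.getLast?_append_of_ne_nil _ (by simpa using hnew)] at hm
      obtain ⟨e, he, rfl⟩ := List.mem_map.1 (List.mem_of_getLast? hm)
      have := h3 e he
      simp only
      omega
  · rintro τ ⟨hreg, hmem, hsize, h17, h18, hout, hch, hlast⟩
    refine ⟨by simp [h18], ?_⟩
    rw [wp_block_nil]
    refine ⟨hreg, hmem, hsize, hout, ?_⟩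
    simp only [← List.cons_append]
    refine isChain_append_times hch (a := τ.time + 2) (b := τ.time + 2) (fun m hm => ?_)
      (fun t ht => ?_) (by omega)
    · have := hlast m hm; omega
    · simp at ht; omega

theorem wp_buildProg {φ : JoinMetric} {K L n d q R : ℕ} (hp : p.Fits w)
    (hpn : p = .ofSize φ K L n d q R) (hK : K < 2 ^ w) (hL : L < 2 ^ w) (hn : n < 2 ^ w)
    (hR : R < 2 ^ w) (hdn : n * d + n + 10 < 2 ^ w)
    (h0 : I.getD 0 0 = n) (h1 : I.getD 1 0 = d) (h2 : I.getD 2 0 = q) (h3 : I.getD 3 0 = R)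
    (hside : ∀ s < n, I.getD (4 + s * (d + 1)) 0 = (db s).1)
    (hcoord : ∀ s < n, ∀ i < d, I.getD (5 + s * (d + 1) + i) 0 = (db s).2 i)
    (hv : ∀ s < n, p.Valid (db s)) :
    wp w I ω (φ.buildProg K L) (fun τ => p.Loaded τ ∧ τ.size ≤ p.space ∧
      τ.time ≤ 100 + p.D * 20 + n * (p.updateTime + 50) ∧
      p.State τ.mem db fun _ => Finset.range n) Config.init := by
  have hlt := hp.lt
  have hE := hp.E_pos
  have hsp : p.space = 64 * (p.N * p.E) + 64 * (p.M * p.E) + 16 * (p.N * p.d) + 8 * p.N + 1000 := rfl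
  have hd : p.d = d := by rw [hpn]; rfl
  have hq : p.q = q := by rw [hpn]; rfl
  have hpR : p.R = R := by rw [hpn]; rfl
  have hD : p.D = Nat.clog 2 n := by rw [hpn]; rfl
  have hpE : p.E = p.D * p.D * p.D := by rw [hpn]; rfl
  have hM : p.M = n / K + 1 := by rw [hpn]; rfl
  have hcap : p.cap = L * p.D := by rw [hpn]; rfl
  have hN : p.N = 2 * n := by rw [hpn]; rfl
  have hφ : p.φ = φ := by rw [hpn]; rfl
  have hDd := hp.D_le
  have hDD : p.D * p.D ≤ p.E := by
    rcases Nat.eq_zero_or_pos p.D with h | h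
    · simp [h]
    · rw [hpE]; exact Nat.le_mul_of_pos_right _ h
  have hME : p.M ≤ p.M * p.E := Nat.le_mul_of_pos_right _ hE
  refine wp.intro fun Q hQ => ?_
  rw [JoinMetric.buildProg]
  simp only [wp_block_cons, wp_assign]
  simp (disch := omega) only [eval_input, eval_const, h0, h1, h2, h3, Nat.mod_eq_of_lt, cost_input,
    cost_const]
  -- Doubling 1 until it reaches `n` takes `Nat.clog 2 n` rounds, and the number of rounds is the
  -- parameter `D`.
  refine wp_while_nat p.D (fun i τ => τ.reg 0 = d ∧ τ.reg 1 = q ∧ τ.reg 2 = R ∧ τ.reg 7 = n ∧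
    τ.reg 3 = i ∧ τ.reg 19 = 2 ^ i ∧ τ.mem = (fun _ => 0) ∧ τ.size = 0 ∧
    τ.time ≤ 20 + i * 20) ?_ ?_ ?_
  · simp [Config.init]
  · rintro i hi τ ⟨hr0, hr1, hr2, hr7, hr3, hr19, hm, hs, ht⟩
    have hin : 2 ^ i < n := by rwa [hD, Nat.lt_clog_iff_pow_lt (by norm_num)] at hi
    have h11 : 1 % 2 ^ w = 1 := Nat.mod_eq_of_lt (by omega)
    refine ⟨by simp [hr19, hr7, hin, h11], ?_⟩
    simp (disch := omega) [Nat.mod_eq_of_lt, hr0, hr1, hr2, hr3, hr7, hr19, hm, hs, pow_succ]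
    omega
  rintro τ ⟨hr0, hr1, hr2, hr7, hr3, hr19, hm, hs, ht⟩
  have hin : ¬ 2 ^ p.D < n := by
    rw [hD, not_lt]; exact Nat.le_pow_clog (by norm_num) n
  refine ⟨by simp [hr19, hr7, hin], ?_⟩
  simp (disch := omega) [Nat.mod_eq_of_lt, hr3, hr7, ← hpE, ← hM, ← hcap]
  refine wp_forLoop n (fun i υ => p.Loaded υ ∧ υ.size ≤ p.space ∧ υ.reg 7 = n ∧
      υ.time ≤ 80 + p.D * 20 + i * (p.updateTime + 50) ∧
      p.State υ.mem db fun _ => Finset.range i) ?_ hn (by norm_num) ?_ ?_ ?_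
  · simp [hr7]
  · refine ⟨⟨?_, ?_, ?_, ?_, ?_, ?_, ?_⟩, ?_, ?_, ?_, ?_⟩
    all_goals try simp [hr0, hr1, hr2, hr3, hr7, hd, hq, hpR, hs]
    · omega
    · refine ⟨fun _ => [], [], ⟨⟨fun h hh => ?_, ?_, ?_, ?_, ?_, ?_⟩, ?_, ?_, ?_, ?_⟩, ?_⟩
      · simp [nodes, Linked, hm]
      all_goals simp [nodes, hm, Flagged, bucketPairs]
  · rintro i hi υ ⟨hld, hsz, hr7, htm, hst⟩ h8 -
    refine wp.intro fun Q hQ => ?_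
    have h4 : i * (d + 1) + d < n * (d + 1) := name_mul_add_lt hi (by omega)
    have h5 : n * (d + 1) = n * d + n := by ring
    have hvs := (hv i hi).side
    have hr0 : υ.reg 0 = d := hld.d.trans hd
    simp only [wp_block_cons, wp_assign]
    have hsi := hside i hi
    simp (disch := omega) [Nat.mod_eq_of_lt, h8, hr0, hsi, -List.getD_eq_getElem?_getD]
    rw [← hφ]
    refine wp.mono (wp_insertPoint (P₀ := Finset.range i) hp ?_ ?_ (s := i) (b := 5 + i * (d + 1)) ?_ (by omega) ?_
      (hv i hi) ?_ ?_ fun j hj => ⟨by omega, hcoord i hi j (by omega)⟩) ?_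
    · refine hld.congr fun y hy => ?_
      simp (disch := omega) [Function.update_of_ne]
    · exact hst
    · simp [h8]
    · simp
    · simp
    · simp
    rintro ξ - ⟨hw, hst'⟩
    have hsize := hw.size
    have htime := hw.time
    simp only at hsize htime
    rw [wp_block_nil]
    refine hQ _ ⟨?_, ?_, ⟨?_, ?_, ?_, ?_, ?_, ?_, ?_⟩, ?_, ?_, ?_, ?_⟩
    · rw [hw.reg 8 (by norm_num)]; simpa using h8
    · rw [hw.reg 7 (by norm_num)]; simpa using hr7
    · simpa [hw.reg] using hld.d
    · simpa [hw.reg] using hld.q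
    · simpa [hw.reg] using hld.R
    · simpa [hw.reg] using hld.D
    · simpa [hw.reg] using hld.E
    · simpa [hw.reg] using hld.M
    · simpa [hw.reg] using hld.cap
    · simp only; omega
    · simpa [hw.reg] using hr7
    · simp only [add_one_mul]; omega
    · simpa [Finset.range_add_one] using hst'
  · rintro υ ⟨hld, hsz, hr7, htm, hst⟩ - -
    rw [wp_block_nil]
    exact hQ _ ⟨hld.congr fun _ _ => rfl, hsz, by simp only; omega, hst⟩

end Par

/-! ### Correctness of the reports -/

namespace Par
variable {p : Par} {mem : ℕ → ℕ} {db : ℕ → ℕ × (ℕ → ℕ)} {P₀ : Finset ℕ} {lst : ℕ → List ℕ}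
  {fl : List ℕ}

variable (p) in
/-- No bucket is too large, and the points of every result have some key in common. -/
structure Fair (db : ℕ → ℕ × (ℕ → ℕ)) (P₀ : Finset ℕ) : Prop where
  load : ∀ S < p.E, ∀ k, (P₀.filter fun s => p.key S (db s).2 = k).card ≤ p.cap
  close : ∀ a ∈ P₀, ∀ b ∈ P₀, (db a).1 = 1 → (db b).1 = 0 → p.gapSum (db a).2 (db b).2 ≤ p.R →
    ∃ S < p.E, p.key S (db a).2 = p.key S (db b).2

theorem mem_bucketPairs {S : ℕ} {l l' : List ℕ} {e : ℕ × ℕ} :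
    e ∈ p.bucketPairs S db l l' ↔ e.1 ∈ l ∧ e.2 ∈ l' ∧ p.good S (db e.1) (db e.2) = true := by
  obtain ⟨a, b⟩ := e
  simp [bucketPairs]

theorem good_iff {S : ℕ} {u v : ℕ × (ℕ → ℕ)} : p.good S u v = true ↔
    u.1 = 1 ∧ v.1 = 0 ∧ p.gapSum u.2 v.2 ≤ p.R ∧ ∀ T < S, p.key T u.2 ≠ p.key T v.2 := by
  rw [good, decide_eq_true_iff]

theorem nodup_bucketPairs {S : ℕ} {l l' : List ℕ} (hl : l.Nodup) (hl' : l'.Nodup) :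
    (p.bucketPairs S db l l').Nodup := by
  refine List.nodup_flatMap.2 ⟨fun a _ => ?_, ?_⟩
  · exact (hl'.filter _).map fun b c h => (Prod.mk.inj h).2
  · refine hl.imp fun {a b} hab => ?_
    intro e he he'
    obtain ⟨c, -, rfl⟩ := List.mem_map.1 he
    obtain ⟨c', -, h⟩ := List.mem_map.1 he'
    exact hab (Prod.mk.inj h).1.symm

namespace Rep

/-- If a pair is emitted by two buckets, their tables coincide, because each is the first table in
which the keys agree. The common key and the table then determine the bucket. -/
theorem nodup_reports (hr : p.Rep mem db (fun _ => P₀) lst fl) :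
    (fl.flatMap fun B => p.bucketPairs (B % p.E) db (lst B) (lst B)).Nodup := by
  refine List.nodup_flatMap.2 ⟨fun B _ => nodup_bucketPairs (hr.nodup_lst B) (hr.nodup_lst B), ?_⟩
  refine hr.nodup_fl.imp fun {B B'} hB => ?_
  intro e he he'
  obtain ⟨h1, h2, h3⟩ := mem_bucketPairs.1 he
  obtain ⟨h1', h2', h3'⟩ := mem_bucketPairs.1 he'
  obtain ⟨-, -, -, h3⟩ := good_iff.1 h3
  obtain ⟨-, -, -, h3'⟩ := good_iff.1 h3'
  rw [hr.mem_lst] at h1 h2 h1' h2'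
  have hS : B % p.E = B' % p.E := by
    rcases lt_trichotomy (B % p.E) (B' % p.E) with h | h | h
    · exact absurd (h1.2.trans h2.2.symm) (h3' _ h)
    · exact h
    · exact absurd (h1'.2.trans h2'.2.symm) (h3 _ h)
  apply hB
  rw [← bucket_mod_div (p := p) B, ← bucket_mod_div (p := p) B', ← h1.2, ← h1'.2, hS]

/-- For a result, fairness yields a table with equal keys. In the least such table the common bucket
emits the pair, and it is small enough to be on the list by the bound on the loads. -/
theorem mem_reports (hr : p.Rep mem db (fun _ => P₀) lst fl)
    (hfl : ∀ B, B ∈ fl ↔ p.Flagged db lst B) (hf : p.Fair db P₀) (e : ℕ × ℕ) :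
    e ∈ (fl.flatMap fun B => p.bucketPairs (B % p.E) db (lst B) (lst B)) ↔
      e.1 ∈ P₀ ∧ e.2 ∈ P₀ ∧ (db e.1).1 = 1 ∧ (db e.2).1 = 0 ∧
        p.gapSum (db e.1).2 (db e.2).2 ≤ p.R := by
  rw [List.mem_flatMap]
  constructor
  · rintro ⟨B, -, he⟩
    obtain ⟨h1, h2, h3⟩ := mem_bucketPairs.1 he
    obtain ⟨h4, h5, h6, -⟩ := good_iff.1 h3
    exact ⟨((hr.mem_lst _ _).1 h1).1, ((hr.mem_lst _ _).1 h2).1, h4, h5, h6⟩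
  · rintro ⟨h1, h2, h3, h4, h5⟩
    have hex := hf.close _ h1 _ h2 h3 h4 h5
    classical
    obtain ⟨hSE, hS⟩ := Nat.find_spec hex
    have hmin := fun T => Nat.find_min (H := hex) (m := T)
    set S := Nat.find hex
    set B := p.key S (db e.1).2 * p.E + S
    have hBm : B % p.E = S := bucket_mod hSE
    have hBd : B / p.E = p.key S (db e.1).2 := bucket_div hSE
    have he : e ∈ p.bucketPairs (B % p.E) db (lst B) (lst B) := by
      rw [mem_bucketPairs, hr.mem_lst, hr.mem_lst, hBm, hBd, good_iff]
      exact ⟨⟨h1, rfl⟩, ⟨h2, hS.symm⟩, h3, h4, h5, fun T hT h => hmin T hT ⟨by omega, h⟩⟩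
    refine ⟨B, (hfl B).2 ⟨?_, List.ne_nil_of_mem he⟩, he⟩
    rw [← List.toFinset_card_of_nodup (hr.nodup_lst B)]
    convert hf.load S hSE (p.key S (db e.1).2) using 2
    ext s
    rw [List.mem_toFinset, hr.mem_lst, hBm, hBd, Finset.mem_filter]

end Rep
end Par

/-! ### Points, rosters and runs of the machine -/

/-- The coordinates of a point as a function on the natural numbers. -/
def Point.coord {d q : ℕ} (y : Point d q) (i : ℕ) : ℕ := if h : i < d then y ⟨i, h⟩ else 0

theorem Point.coord_fin {d q : ℕ} (y : Point d q) (i : Fin d) : y.coord i = y i := by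
  simp [coord]

theorem Point.coord_lt {d q : ℕ} (y : Point d q) {i : ℕ} (h : i < d) : y.coord i < q := by
  simp [coord, h]

theorem JoinMetric.natCast_gap_sub (a b : ℕ) :
    ((a - b + (b - a) : ℕ) : ℝ) = |(a : ℝ) - b| := by
  rcases le_total a b with h | h
  · rw [Nat.sub_eq_zero_of_le h, zero_add, Nat.cast_sub h, abs_sub_comm, abs_of_nonneg]
    exact sub_nonneg.2 (by exact_mod_cast h)
  · rw [Nat.sub_eq_zero_of_le h, add_zero, Nat.cast_sub h, abs_of_nonneg]
    exact sub_nonneg.2 (by exact_mod_cast h)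

/-- The power of the distance is the sum of the gaps, a natural number, so comparing it with `r ^
exponent` or with its floor is the same. -/
theorem JoinMetric.dist_le_iff (φ : JoinMetric) {d q : ℕ} (x y : Point d q) {r : ℝ} (hr : 0 < r) :
    φ.dist x y ≤ r ↔
      ∑ i ∈ Finset.range d, φ.gap (x.coord i) (y.coord i) ≤ ⌊r ^ φ.exponent⌋₊ := by
  rw [Nat.le_floor_iff (by positivity), ← Fin.sum_univ_eq_sum_range
    (fun i => φ.gap (x.coord i) (y.coord i))]
  simp only [Point.coord_fin]
  cases φ with
  | hamming =>
    simp only [dist, gap, exponent, pow_one]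
    rw [hammingDist, Finset.card_filter]
    refine Iff.of_eq ?_
    congr 2
    refine Finset.sum_congr rfl fun i _ => ?_
    by_cases h : x i = y i
    · simp [h]
    · have : ((x i : Fin q) : ℕ) ≠ y i := fun h' => h (Fin.ext h')
      simp [h, this]
  | l1 =>
    simp only [dist, gap, exponent, pow_one, Nat.cast_sum, natCast_gap_sub]
  | l2 =>
    simp only [dist, gap, exponent, Nat.cast_sum, Nat.cast_mul, natCast_gap_sub, abs_mul_abs_self]
    rw [Real.sqrt_le_left hr.le]
    simp only [sq]

section run
variable {n d q : ℕ}

/-- The sides and coordinates of the points whose names are in use. -/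
def dbOf (ρ : Fin (2 * n) → Option (Bool × ℕ)) (x : ℕ → Point d q) (s : ℕ) : ℕ × (ℕ → ℕ) :=
  if h : s < 2 * n then
    match ρ ⟨s, h⟩ with
    | some (b, u) => (b.toNat, (x u).coord)
    | none => (0, fun _ => 0)
  else (0, fun _ => 0)

/-- The names in use. -/
def namesOf (ρ : Fin (2 * n) → Option (Bool × ℕ)) : Finset ℕ :=
  (Finset.range (2 * n)).filter fun s => ∃ h : s < 2 * n, ρ ⟨s, h⟩ ≠ none

theorem mem_namesOf {ρ : Fin (2 * n) → Option (Bool × ℕ)} {s : ℕ} :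
    s ∈ namesOf ρ ↔ ∃ h : s < 2 * n, ρ ⟨s, h⟩ ≠ none := by
  simp only [namesOf, Finset.mem_filter, Finset.mem_range, and_iff_right_iff_imp]
  exact fun ⟨h, _⟩ => h

theorem fin_mem_namesOf {ρ : Fin (2 * n) → Option (Bool × ℕ)} {s : Fin (2 * n)} :
    (s : ℕ) ∈ namesOf ρ ↔ ρ s ≠ none := by
  rw [mem_namesOf]
  exact ⟨fun ⟨_, h⟩ => h, fun h => ⟨s.2, h⟩⟩

theorem dbOf_some {ρ : Fin (2 * n) → Option (Bool × ℕ)} {x : ℕ → Point d q} {s : Fin (2 * n)}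
    {b : Bool} {u : ℕ} (h : ρ s = some (b, u)) : dbOf ρ x s = (b.toNat, (x u).coord) := by
  simp [dbOf, h]

theorem dbOf_congr {ρ ρ' : Fin (2 * n) → Option (Bool × ℕ)} {x : ℕ → Point d q} {s : Fin (2 * n)}
    (h : ρ s = ρ' s) : dbOf ρ x s = dbOf ρ' x s := by
  simp [dbOf, h]

theorem namesOf_update_some {ρ : Fin (2 * n) → Option (Bool × ℕ)} {s : Fin (2 * n)}
    {e : Bool × ℕ} : namesOf (Function.update ρ s (some e)) = insert (s : ℕ) (namesOf ρ) := by
  ext a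
  rw [Finset.mem_insert, mem_namesOf, mem_namesOf]
  constructor
  · rintro ⟨h, h'⟩
    by_cases ha : (⟨a, h⟩ : Fin (2 * n)) = s
    · exact .inl (by rw [← ha])
    · rw [Function.update_of_ne ha] at h'
      exact .inr ⟨h, h'⟩
  · rintro (rfl | ⟨h, h'⟩)
    · exact ⟨s.2, by simp⟩
    · refine ⟨h, ?_⟩
      by_cases ha : (⟨a, h⟩ : Fin (2 * n)) = s
      · simp [ha]
      · rwa [Function.update_of_ne ha]

theorem namesOf_update_none {ρ : Fin (2 * n) → Option (Bool × ℕ)} {s : Fin (2 * n)} :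
    namesOf (Function.update ρ s none) = (namesOf ρ).erase (s : ℕ) := by
  ext a
  rw [Finset.mem_erase, mem_namesOf, mem_namesOf]
  constructor
  · rintro ⟨h, h'⟩
    by_cases ha : (⟨a, h⟩ : Fin (2 * n)) = s
    · simp [ha] at h'
    · rw [Function.update_of_ne ha] at h'
      exact ⟨fun h1 => ha (Fin.ext h1), h, h'⟩
  · rintro ⟨hne, h, h'⟩
    refine ⟨h, ?_⟩
    rwa [Function.update_of_ne]
    rintro rfl
    exact hne rfl

theorem valid_dbOf {p : Par} (hd : p.d = d) (hq : p.q = q) {ρ : Fin (2 * n) → Option (Bool × ℕ)}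
    {x : ℕ → Point d q} {s : ℕ} (hs : s ∈ namesOf ρ) : p.Valid (dbOf ρ x s) := by
  obtain ⟨h, h'⟩ := mem_namesOf.1 hs
  obtain ⟨⟨b, u⟩, hu⟩ := Option.ne_none_iff_exists'.1 h'
  rw [show dbOf ρ x s = _ from dbOf_some (s := ⟨s, h⟩) hu]
  exact ⟨b.toNat_le, fun i hi => by rw [hq]; exact (x u).coord_lt (hd ▸ hi)⟩

theorem Point.getD_words (y : Point d q) {i : ℕ} (hi : i < d) : y.words.getD i 0 = y.coord i := by
  simp [words, coord, hi]

theorem getD_flatMap_range {k m : ℕ} {f : ℕ → List ℕ} (hf : ∀ s, (f s).length = k) {s i : ℕ}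
    (hs : s < m) (hi : i < k) :
    ((List.range m).flatMap f).getD (s * k + i) 0 = (f s).getD i 0 := by
  have hlen : ∀ m, ((List.range m).flatMap f).length = m * k := by
    intro m
    simp [List.length_flatMap, hf]
  induction m with
  | zero => omega
  | succ m ih =>
    rw [List.range_succ, List.flatMap_append, List.flatMap_singleton]
    rcases Nat.lt_succ_iff_lt_or_eq.1 hs with hs | rfl
    · rw [List.getD_append _ _ _ _ (by rw [hlen]; exact name_mul_add_lt hs hi), ih hs]
    · rw [List.getD_append_right _ _ _ _ (by rw [hlen]; omega), hlen]
      congr 1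
      omega

/-- What an operation achieves, where `σ'` is the configuration after the operation, and `ρ` is
the roster before the operation. -/
structure OpDone (p : Par) (φ : JoinMetric) (r : ℝ) (side : ℕ → Bool) (ops : ℕ → Op n)
    (x : ℕ → Point d q) (t : ℕ) (σ' : Config) : Prop where
  update : ops t ≠ .enumerate → σ'.time ≤ p.updateTime + 50
  delay : ops t = .enumerate →
    (0 :: (σ'.out.map Prod.fst ++ [σ'.time])).IsChain fun s t => t ≤ s + p.delayTime
  reports : ops t = .enumerate →
    p.Fair (dbOf (roster n side ops t) x) (namesOf (roster n side ops t)) →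
    σ'.Reports (IsResult φ r side ops x t)

/-- The configuration represents the points with the given roster. -/
structure Holds (p : Par) (ρ : Fin (2 * n) → Option (Bool × ℕ)) (x : ℕ → Point d q)
    (σ : Config) : Prop where
  loaded : p.Loaded σ
  size : σ.size ≤ p.space
  state : p.State σ.mem (dbOf ρ x) fun _ => namesOf ρ

/-- The programs of the data structure. -/
def JoinMetric.structure (φ : JoinMetric) (K L : ℕ) : JoinStructure where
  build := φ.buildProg K L
  insert := φ.insertProg
  delete := φ.deleteProg
  enumerate := φ.enumProg

variable {φ : JoinMetric} {K L w : ℕ} {r : ℝ} {side : ℕ → Bool} {ops : ℕ → Op n}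
  {x : ℕ → Point d q} {ω : Tape} {p : Par}

theorem exists_exec_build (hp : p.Fits w) (hpn : p = .ofSize φ K L n d q ⌊r ^ φ.exponent⌋₊)
    (hK : K < 2 ^ w) (hL : L < 2 ^ w) (hR : ⌊r ^ φ.exponent⌋₊ < 2 ^ w)
    (hdn : n * d + 2 * n + 10 < 2 ^ w) :
    ∃ σ, Exec w (buildInput φ n d q r side x) ω (φ.structure K L).build Config.init σ ∧
      Holds p (roster n side ops 0) x σ ∧
      σ.time ≤ 100 + p.D * 20 + n * (p.updateTime + 50) := by
  have hd : p.d = d := by rw [hpn]; rfl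
  have hq : p.q = q := by rw [hpn]; rfl
  have hρ : ∀ s (h : s < n), roster n side ops 0 ⟨s, by omega⟩ = some (side s, s) := by
    intro s h
    simp [roster, h]
  have hdb : ∀ s < n, dbOf (roster n side ops 0) x s = ((side s).toNat, (x s).coord) :=
    fun s h => dbOf_some (s := ⟨s, by omega⟩) (hρ s h)
  have hnames : namesOf (roster n side ops 0) = Finset.range n := by
    ext s
    rw [mem_namesOf, Finset.mem_range]
    constructor
    · rintro ⟨h, h'⟩
      by_contra hs
      simp [roster, hs] at h'
    · intro h
      exact ⟨by omega, by rw [hρ s h]; simp⟩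
  set f : ℕ → List ℕ := fun i => (side i).toNat :: (x i).words
  have hf : ∀ s, (f s).length = d + 1 := by intro s; simp [f, Point.words]
  have hI : ∀ s < n, ∀ i < d + 1, (buildInput φ n d q r side x).getD (4 + (s * (d + 1) + i)) 0 =
      (f s).getD i 0 := by
    intro s hs i hi
    rw [buildInput, List.getD_append_right _ _ _ _ (by simp)]
    rw [show ∀ m, 4 + m - [n, d, q, ⌊r ^ φ.exponent⌋₊].length = m from
      fun m => by simp]
    exact getD_flatMap_range hf hs hi
  have hside : ∀ s < n, (buildInput φ n d q r side x).getD (4 + s * (d + 1)) 0 =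
      (dbOf (roster n side ops 0) x s).1 := by
    intro s hs
    have := hI s hs 0 (by omega)
    rw [add_zero] at this
    rw [this, hdb s hs]
    rfl
  have hcoord : ∀ s < n, ∀ i < d, (buildInput φ n d q r side x).getD (5 + s * (d + 1) + i) 0 =
      (dbOf (roster n side ops 0) x s).2 i := by
    intro s hs i hi
    have := hI s hs (i + 1) (by omega)
    rw [show 5 + s * (d + 1) + i = 4 + (s * (d + 1) + (i + 1)) by ring, this, hdb s hs]
    exact (x s).getD_words hi
  obtain ⟨σ, h, hl, hs, ht, hst⟩ := Par.wp_buildProg (ω := ω) hp hpn hK hL (by omega) hR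
    (by omega) rfl rfl rfl rfl hside hcoord
    (fun s hs => valid_dbOf hd hq (by rw [hnames]; simpa using hs))
  exact ⟨σ, h, ⟨hl, hs, by rwa [hnames]⟩, ht⟩

/-- The guarantees on time, delay and memory are unconditional; fairness enters only in the claim on
the reports. -/
theorem exists_exec_op (hp : p.Fits w) (hpn : p = .ofSize φ K L n d q ⌊r ^ φ.exponent⌋₊)
    (hr : 0 < r) (hops : ValidOps n side ops) {t : ℕ} {σ : Config}
    (hσ : Holds p (roster n side ops t) x σ) :
    ∃ σ', Exec w (opInput (ops t) (x (n + t))) ω ((φ.structure K L).prog (ops t)) σ.fresh σ' ∧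
      Holds p (roster n side ops (t + 1)) x σ' ∧ OpDone p φ r side ops x t σ' := by
  have hd : p.d = d := by rw [hpn]; rfl
  have hq : p.q = q := by rw [hpn]; rfl
  have hN : p.N = 2 * n := by rw [hpn]; rfl
  have hφ : p.φ = φ := by rw [hpn]; rfl
  have hR : p.R = ⌊r ^ φ.exponent⌋₊ := by rw [hpn]; rfl
  have hE := hp.E_pos
  have hops := hops t
  have hfresh : p.Loaded σ.fresh := hσ.loaded.congr fun _ _ => rfl
  have hsz := hσ.size
  set ρ := roster n side ops t with hρ
  cases ho : ops t with
  | insert s b =>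
    have hnone : ρ s = none := by simpa [ho] using hops
    have hρ' : roster n side ops (t + 1) = Function.update ρ s (some (b, n + t)) := by
      rw [roster, ho]
    have hsP : (s : ℕ) ∉ namesOf ρ := by rw [fin_mem_namesOf, not_not, hnone]
    have hdb : dbOf (roster n side ops (t + 1)) x s = (b.toNat, (x (n + t)).coord) :=
      dbOf_some (by rw [hρ']; simp)
    -- The name is free, so the stored structure also represents the points as given by the next
    -- roster.
    have hst : p.State σ.fresh.mem (dbOf (roster n side ops (t + 1)) x) fun _ => namesOf ρ := by
      refine hσ.state.congr_db hE fun S _ a ha => ?_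
      obtain ⟨h, -⟩ := mem_namesOf.1 ha
      refine dbOf_congr (s := ⟨a, h⟩) ?_
      rw [hρ', Function.update_of_ne]
      rintro rfl
      exact hsP ha
    obtain ⟨σ', hex, hw, hst'⟩ := Par.wp_insertProg (ω := ω)
      (I := opInput (.insert s b) (x (n + t))) hp hfresh hst (s := s) rfl (by omega) hsP
      (valid_dbOf hd hq (by rw [hρ', namesOf_update_some]; simp)) (by rw [hdb]; rfl)
      (fun i hi => by rw [hdb, add_comm 2 i]; exact (x (n + t)).getD_words (hd ▸ hi))
    have hs' := hw.size
    have ht' := hw.time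
    refine ⟨σ', by rw [← hφ]; exact hex, ⟨hfresh.works hw (by norm_num), ?_, ?_⟩, ?_, ?_, ?_⟩
    · exact hs'.trans (max_le hsz le_rfl)
    · rwa [hρ', namesOf_update_some, ← hρ']
    · intro _; simpa [Config.fresh] using ht'
    · simp [ho]
    · simp [ho]
  | delete s =>
    have hsome : ρ s ≠ none := by simpa [ho] using hops
    have hρ' : roster n side ops (t + 1) = Function.update ρ s none := by
      rw [roster, ho]
    have hsP : (s : ℕ) ∈ namesOf ρ := by rwa [fin_mem_namesOf]
    obtain ⟨σ', hex, hw, hst'⟩ := Par.wp_deleteProg (ω := ω)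
      (I := opInput (.delete s) (x (n + t))) hp hfresh hσ.state (s := s) rfl (by omega) hsP
    have hs' := hw.size
    have ht' := hw.time
    refine ⟨σ', by rw [← hφ]; exact hex, ⟨hfresh.works hw (by norm_num), ?_, ?_⟩, ?_, ?_, ?_⟩
    · exact hs'.trans (max_le hsz le_rfl)
    · rw [hρ', namesOf_update_none]
      refine hst'.congr_db hE fun S _ a ha => ?_
      obtain ⟨h, -⟩ := mem_namesOf.1 (Finset.mem_of_mem_erase ha)
      refine dbOf_congr (s := ⟨a, h⟩) ?_
      rw [Function.update_of_ne]
      rintro rfl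
      exact Finset.ne_of_mem_erase ha rfl
    · intro _; simpa [Config.fresh] using ht'
    · simp [ho]
    · simp [ho]
  | enumerate =>
    have hρ' : roster n side ops (t + 1) = ρ := by rw [roster, ho]
    obtain ⟨lst, fl, hrep, hfl⟩ := hσ.state
    obtain ⟨σ', hex, hreg, hmem, hs', hout, hch⟩ := Par.wp_enumProg (ω := ω)
      (I := opInput (.enumerate : Op n) (x (n + t))) hp hfresh (σ := σ.fresh) hrep
      (fun B hB => (hfl B).1 hB) rfl rfl
    refine ⟨σ', by rw [← hφ]; exact hex, ⟨hfresh.congr hreg, ?_, ?_⟩, ?_, ?_, ?_⟩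
    · rw [hs']; exact hsz
    · rw [hρ', hmem]; exact hσ.state
    · simp [ho]
    · exact fun _ => hch
    · intro _ hfair
      refine ⟨by rw [hout]; exact hrep.nodup_reports, fun i j => ?_⟩
      rw [hout, hrep.mem_reports hfl hfair]
      constructor
      · rintro ⟨hi, hj, hi1, hj0, hle⟩
        simp only at hi hj hi1 hj0 hle
        obtain ⟨h, h'⟩ := mem_namesOf.1 hi
        obtain ⟨⟨b, u⟩, hu⟩ := Option.ne_none_iff_exists'.1 h'
        obtain ⟨k, k'⟩ := mem_namesOf.1 hj
        obtain ⟨⟨c, v⟩, hv⟩ := Option.ne_none_iff_exists'.1 k'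
        rw [show dbOf ρ x i = _ from dbOf_some (s := ⟨i, h⟩) hu] at hi1 hle
        rw [show dbOf ρ x j = _ from dbOf_some (s := ⟨j, k⟩) hv] at hj0 hle
        obtain rfl : b = true := by cases b <;> simp_all
        obtain rfl : c = false := by cases c <;> simp_all
        refine ⟨⟨i, h⟩, ⟨j, k⟩, rfl, rfl, u, v, hu, hv, ?_⟩
        rw [JoinMetric.dist_le_iff φ _ _ hr, ← hR]
        rwa [Par.gapSum, hd, hφ] at hle
      · rintro ⟨a, b, rfl, rfl, u, v, hu, hv, hle⟩
        rw [JoinMetric.dist_le_iff φ _ _ hr, ← hR] at hle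
        have hu' := dbOf_some (x := x) hu
        have hv' := dbOf_some (x := x) hv
        refine ⟨fin_mem_namesOf.2 ?_, fin_mem_namesOf.2 ?_, ?_, ?_, ?_⟩
        · rw [hρ, hu]; simp
        · rw [hρ, hv]; simp
        · simp only [hρ, hu']; rfl
        · simp only [hρ, hv']; rfl
        · simp only [hρ, hu', hv', Par.gapSum, hd, hφ]
          exact hle

theorem exists_isRun (hp : p.Fits w) (hpn : p = .ofSize φ K L n d q ⌊r ^ φ.exponent⌋₊)
    (hK : K < 2 ^ w) (hL : L < 2 ^ w) (hR : ⌊r ^ φ.exponent⌋₊ < 2 ^ w)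
    (hdn : n * d + 2 * n + 10 < 2 ^ w) (hr : 0 < r) (hops : ValidOps n side ops) :
    ∃ σ : ℕ → Config, IsRun φ (φ.structure K L) w r side ops x ω σ ∧
      (∀ t, (σ t).size ≤ p.space) ∧
      (σ 0).time ≤ 100 + p.D * 20 + n * (p.updateTime + 50) ∧
      ∀ t, OpDone p φ r side ops x t (σ (t + 1)) := by
  obtain ⟨σ₀, h0, hh0, ht0⟩ := exists_exec_build (side := side) (ops := ops) (x := x) (ω := ω)
    hp hpn hK hL hR hdn
  -- The subtype carries the invariant along, so that chosen successors can be iterated by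
  -- recursion.
  have hstep : ∀ t (σ : {σ : Config // Holds p (roster n side ops t) x σ}),
      ∃ σ' : {σ : Config // Holds p (roster n side ops (t + 1)) x σ},
        Exec w (opInput (ops t) (x (n + t))) ω ((φ.structure K L).prog (ops t)) σ.1.fresh σ'.1 ∧
        OpDone p φ r side ops x t σ'.1 := by
    intro t σ
    obtain ⟨σ', h1, h2, h3⟩ := exists_exec_op (K := K) (L := L) (ω := ω) hp hpn hr hops σ.2
    exact ⟨⟨σ', h2⟩, h1, h3⟩
  choose next hnext using hstep
  let σ : (t : ℕ) → {σ : Config // Holds p (roster n side ops t) x σ} :=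
    fun t => Nat.rec ⟨σ₀, hh0⟩ (fun t σ => next t σ) t
  exact ⟨fun t => (σ t).1, ⟨h0, fun t => (hnext t (σ t)).1⟩, fun t => (σ t).2.size, ht0,
    fun t => (hnext t (σ t)).2⟩

end run

/-! ### Counting points -/

section counting
variable {d q : ℕ}

/-- Points that agree on the coordinates in `C`. -/
theorem card_le_of_agree {A : Finset (Point d q)} {C : Finset (Fin d)}
    (h : ∀ x ∈ A, ∀ y ∈ A, ∀ i ∈ C, x i = y i) : A.card ≤ q ^ (d - C.card) := by
  classical
  have hinj : Set.InjOn (fun (x : Point d q) (i : {i // i ∉ C}) => x i) A := by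
    intro x hx y hy hxy
    funext i
    by_cases hi : i ∈ C
    · exact h x hx y hy i hi
    · exact congrFun hxy ⟨i, hi⟩
  have := Finset.card_le_card_of_injOn (t := Finset.univ) _ (fun _ _ => Finset.mem_univ _) hinj
  refine this.trans_eq ?_
  rw [Finset.card_univ, Fintype.card_fun, Fintype.card_fin, Fintype.card_subtype_compl,
    Fintype.card_fin, Fintype.card_coe]

/-- A point within distance `k` agrees with the centre on some set of exactly `d - k` coordinates;
the bound sums over all such sets, each leaving `k` coordinates free. -/
theorem card_filter_hammingDist_le (z : Point d q) {k : ℕ} (hk : k ≤ d) :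
    (Finset.univ.filter fun y : Point d q => hammingDist y z ≤ k).card ≤ d.choose k * q ^ k := by
  classical
  have hsub : (Finset.univ.filter fun y : Point d q => hammingDist y z ≤ k) ⊆
      ((Finset.univ : Finset (Fin d)).powersetCard (d - k)).biUnion fun T =>
        Finset.univ.filter fun y : Point d q => ∀ i ∈ T, y i = z i := by
    intro y hy
    rw [Finset.mem_filter] at hy
    have h1 : (Finset.univ.filter fun i => y i ≠ z i).card +
        (Finset.univ.filter fun i => ¬ y i ≠ z i).card = d := by
      rw [Finset.card_filter_add_card_filter_not]; simp
    have h2 : hammingDist y z = (Finset.univ.filter fun i => y i ≠ z i).card := rfl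
    obtain ⟨T, hT, hTc⟩ := Finset.exists_subset_card_eq
      (s := Finset.univ.filter fun i => ¬ y i ≠ z i) (n := d - k) (by omega)
    rw [Finset.mem_biUnion]
    refine ⟨T, Finset.mem_powersetCard.2 ⟨Finset.subset_univ _, hTc⟩, ?_⟩
    rw [Finset.mem_filter]
    exact ⟨Finset.mem_univ _, fun i hi => by simpa using hT hi⟩
  refine (Finset.card_le_card hsub).trans ((Finset.card_biUnion_le_card_mul _ _ (q ^ k) ?_).trans ?_)
  · intro T hT
    have hTc := (Finset.mem_powersetCard.1 hT).2
    refine (card_le_of_agree (C := T) ?_).trans_eq ?_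
    · intro x hx y hy i hi
      rw [(Finset.mem_filter.1 hx).2 i hi, (Finset.mem_filter.1 hy).2 i hi]
    · rw [hTc, Nat.sub_sub_self hk]
  · rw [Finset.card_powersetCard, Finset.card_univ, Fintype.card_fin, Nat.choose_symm hk]

end counting

/-! ### Keys as numbers in base `q`, and collisions of keys -/

namespace Par
variable (p : Par)

/-- The number that is reduced modulo `M` to obtain `keyUpTo`. -/
def valUpTo (S : ℕ) (x : ℕ → ℕ) : ℕ → ℕ
  | 0 => 0
  | i + 1 => if p.Skips S i then valUpTo S x i else valUpTo S x i * p.q + x i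

/-- The coordinates below `i` that are used by the key `S`. -/
def used (S i : ℕ) : Finset ℕ := (Finset.range i).filter fun j => ¬ p.Skips S j

variable {p}

theorem keyUpTo_eq_mod (S : ℕ) (x : ℕ → ℕ) (i : ℕ) :
    p.keyUpTo S x i = p.valUpTo S x i % p.M := by
  induction i with
  | zero => simp [keyUpTo, valUpTo]
  | succ i ih =>
    rw [keyUpTo, valUpTo]
    split_ifs
    · exact ih
    · rw [ih, Nat.add_mod, Nat.mod_mul_mod, ← Nat.add_mod]

theorem used_succ (S i : ℕ) :
    p.used S (i + 1) = if p.Skips S i then p.used S i else insert i (p.used S i) := by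
  rw [used, Finset.range_add_one, Finset.filter_insert, used]
  split_ifs <;> simp_all

theorem notMem_used (S i : ℕ) : i ∉ p.used S i := by simp [used]

theorem valUpTo_lt {S : ℕ} {x : ℕ → ℕ} {i : ℕ} (hx : ∀ j < i, x j < p.q) :
    p.valUpTo S x i < p.q ^ (p.used S i).card := by
  induction i with
  | zero => simp [valUpTo, used]
  | succ i ih =>
    have ih := ih fun j hj => hx j (by omega)
    have hi := hx i (by omega)
    rw [valUpTo, used_succ]
    split_ifs
    · exact ih
    · rw [Finset.card_insert_of_notMem (notMem_used S i), pow_succ]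
      exact name_mul_add_lt ih hi

/-- Uniqueness of digits: division by `q` removes the last used digit, and the induction proceeds
with the rest. -/
theorem eq_of_valUpTo_eq {S : ℕ} {x y : ℕ → ℕ} {i : ℕ} (hx : ∀ j < i, x j < p.q)
    (hy : ∀ j < i, y j < p.q) (h : p.valUpTo S x i = p.valUpTo S y i) :
    ∀ j ∈ p.used S i, x j = y j := by
  induction i with
  | zero => simp [used]
  | succ i ih =>
    have ih := ih (fun j hj => hx j (by omega)) fun j hj => hy j (by omega)
    have hxi := hx i (by omega)
    have hyi := hy i (by omega)
    rw [valUpTo, valUpTo] at h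
    rw [used_succ]
    split_ifs at h ⊢ with hs
    · exact ih h
    · have hq : 0 < p.q := by omega
      have h1 : p.valUpTo S x i = p.valUpTo S y i := by
        have := congrArg (· / p.q) h
        simpa [add_comm _ (x i), add_comm _ (y i), Nat.add_mul_div_right _ _ hq,
          Nat.div_eq_of_lt hxi, Nat.div_eq_of_lt hyi] using this
      intro j hj
      rcases Finset.mem_insert.1 hj with rfl | hj
      · rw [h1] at h; omega
      · exact ih h1 j hj

theorem le_card_used (S : ℕ) : p.D - 3 ≤ (p.used S p.D).card := by
  have h1 : (Finset.range p.D \ {S % p.D, S / p.D % p.D, S / p.D / p.D}) ⊆ p.used S p.D := by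
    intro j hj
    simp only [Finset.mem_sdiff, Finset.mem_insert, Finset.mem_singleton] at hj
    exact Finset.mem_filter.2 ⟨hj.1, hj.2⟩
  have h2 := Finset.card_le_card h1
  have h3 := Finset.le_card_sdiff ({S % p.D, S / p.D % p.D, S / p.D / p.D} : Finset ℕ)
    (Finset.range p.D)
  have h4 : ({S % p.D, S / p.D % p.D, S / p.D / p.D} : Finset ℕ).card ≤ 3 := Finset.card_le_three
  rw [Finset.card_range] at h3
  omega

/-- With `c` used coordinates the unreduced key is at most `q ^ c`, so at most `q ^ c / M + 1` of
its values lie in a given residue class. Each value determines the `c` used coordinates and leaves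
`d - c` free. -/
theorem card_filter_key_le (hD : p.D ≤ p.d) (S k : ℕ) :
    (Finset.univ.filter fun y : Point p.d p.q => p.key S y.coord = k).card ≤
      (p.q ^ (p.used S p.D).card / p.M + 1) * p.q ^ (p.d - (p.used S p.D).card) := by
  classical
  set A := Finset.univ.filter fun y : Point p.d p.q => p.key S y.coord = k
  have hlt : ∀ y : Point p.d p.q, ∀ j < p.D, y.coord j < p.q :=
    fun y j hj => y.coord_lt (by omega)
  have h1 : A.card ≤ p.q ^ (p.d - (p.used S p.D).card) *
      (A.image fun y => p.valUpTo S y.coord p.D).card := by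
    refine Finset.card_le_mul_card_image _ _ fun v _ => ?_
    have hC : ∀ j ∈ p.used S p.D, j < p.d := fun j hj => by
      have := Finset.mem_range.1 (Finset.mem_filter.1 hj).1
      omega
    refine (card_le_of_agree (C := (p.used S p.D).attachFin hC) fun x hx y hy i hi => ?_).trans_eq
      (by rw [Finset.card_attachFin])
    rw [Finset.mem_attachFin] at hi
    have := eq_of_valUpTo_eq (hlt x) (hlt y)
      ((Finset.mem_filter.1 hx).2.trans (Finset.mem_filter.1 hy).2.symm) _ hi
    rw [Point.coord_fin, Point.coord_fin] at this
    exact Fin.ext this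
  have h2 : (A.image fun y => p.valUpTo S y.coord p.D).card ≤
      p.q ^ (p.used S p.D).card / p.M + 1 := by
    rw [← Finset.card_range (p.q ^ (p.used S p.D).card / p.M + 1)]
    refine Finset.card_le_card_of_injOn (· / p.M) ?_ ?_
    · intro v hv
      obtain ⟨y, -, rfl⟩ := Finset.mem_image.1 hv
      exact Finset.mem_coe.2 (Finset.mem_range.2 (Nat.lt_succ_of_le
        (Nat.div_le_div_right (valUpTo_lt (hlt y)).le)))
    · intro v hv v' hv' hvv
      obtain ⟨y, hy, rfl⟩ := Finset.mem_image.1 hv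
      obtain ⟨y', hy', rfl⟩ := Finset.mem_image.1 hv'
      have e := (Finset.mem_filter.1 hy).2
      have e' := (Finset.mem_filter.1 hy').2
      rw [key, keyUpTo_eq_mod] at e e'
      rw [← Nat.div_add_mod (p.valUpTo S y.coord p.D) p.M,
        ← Nat.div_add_mod (p.valUpTo S y'.coord p.D) p.M, e, e']
      simp only at hvv
      rw [hvv]
  rw [mul_comm]
  exact h1.trans (Nat.mul_le_mul_left _ h2)

/-- Points that differ in at most three coordinates have a common key. -/
theorem exists_key_eq {x y : ℕ → ℕ} (hD : 0 < p.D) (hE : p.E = p.D * p.D * p.D)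
    (h : ((Finset.range p.D).filter fun i => x i ≠ y i).card ≤ 3) :
    ∃ S < p.E, p.key S x = p.key S y := by
  -- If there are fewer than three differing coordinates, the triple is padded by repetition, or by
  -- 0 if there are none.
  obtain ⟨a, b, c, ha, hb, hc, habc⟩ : ∃ a b c, a < p.D ∧ b < p.D ∧ c < p.D ∧
      ∀ i < p.D, x i ≠ y i → i = a ∨ i = b ∨ i = c := by
    set A := (Finset.range p.D).filter fun i => x i ≠ y i with hA
    have hmem : ∀ i, i ∈ A ↔ i < p.D ∧ x i ≠ y i := by simp [hA]
    have hl : A.toList.length ≤ 3 := by simpa using h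
    have hml : ∀ i, i ∈ A.toList ↔ i < p.D ∧ x i ≠ y i := by simpa using hmem
    match hlist : A.toList with
    | [] =>
      refine ⟨0, 0, 0, hD, hD, hD, fun i hi hne => ?_⟩
      have := (hml i).2 ⟨hi, hne⟩
      simp [hlist] at this
    | [a] =>
      have h1 := ((hml a).1 (by simp [hlist])).1
      refine ⟨a, a, a, h1, h1, h1, fun i hi hne => ?_⟩
      have := (hml i).2 ⟨hi, hne⟩
      simp only [hlist, List.mem_singleton] at this
      exact .inl this
    | [a, b] =>
      have h1 := ((hml a).1 (by simp [hlist])).1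
      have h2 := ((hml b).1 (by simp [hlist])).1
      refine ⟨a, b, b, h1, h2, h2, fun i hi hne => ?_⟩
      have := (hml i).2 ⟨hi, hne⟩
      simp only [hlist, List.mem_cons, List.not_mem_nil, or_false] at this
      tauto
    | [a, b, c] =>
      have h1 := ((hml a).1 (by simp [hlist])).1
      have h2 := ((hml b).1 (by simp [hlist])).1
      have h3 := ((hml c).1 (by simp [hlist])).1
      refine ⟨a, b, c, h1, h2, h3, fun i hi hne => ?_⟩
      have := (hml i).2 ⟨hi, hne⟩
      simpa only [hlist, List.mem_cons, List.not_mem_nil, or_false] using this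
    | _ :: _ :: _ :: _ :: l =>
      simp [hlist] at hl
      omega
  have h1 : b + c * p.D < p.D * p.D := by
    have := name_mul_add_lt hc hb; omega
  have h2 : a + (b + c * p.D) * p.D < p.E := by
    have := name_mul_add_lt h1 ha; omega
  -- The table with digits `a`, `b`, `c` in base `D` skips exactly these three coordinates.
  refine ⟨a + (b + c * p.D) * p.D, h2, ?_⟩
  have e1 : (a + (b + c * p.D) * p.D) % p.D = a := by
    rw [Nat.add_mul_mod_self_right, Nat.mod_eq_of_lt ha]
  have e2 : (a + (b + c * p.D) * p.D) / p.D = b + c * p.D := by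
    rw [Nat.add_mul_div_right _ _ hD, Nat.div_eq_of_lt ha, zero_add]
  have e3 : (b + c * p.D) % p.D = b := by
    rw [Nat.add_mul_mod_self_right, Nat.mod_eq_of_lt hb]
  have e4 : (b + c * p.D) / p.D = c := by
    rw [Nat.add_mul_div_right _ _ hD, Nat.div_eq_of_lt hb, zero_add]
  unfold key
  suffices ∀ i ≤ p.D, p.keyUpTo (a + (b + c * p.D) * p.D) x i =
      p.keyUpTo (a + (b + c * p.D) * p.D) y i from this _ le_rfl
  intro i hi
  induction i with
  | zero => rfl
  | succ i ih =>
    rw [keyUpTo, keyUpTo, ih (by omega)]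
    split_ifs with hs
    · rfl
    · by_cases hxy : x i = y i
      · rw [hxy]
      · refine absurd ?_ hs
        rw [Skips, e1, e2, e3, e4]
        exact habc i (by omega) hxy

end Par

/-! ### Random points -/

section law

theorem uniform_real_finset {α : Type} [Fintype α] [Nonempty α] [MeasurableSpace α]
    {A : Finset α} (hA : MeasurableSet (A : Set α)) :
    (uniform α).real A = A.card / Fintype.card α := by
  classical
  rw [measureReal_def, uniform, PMF.toMeasure_uniformOfFintype_apply (s := (A : Set α)) hA]
  simp

variable {d q : ℕ} [NeZero q]

instance : IsProbabilityMeasure (pointLaw d q) := by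
  unfold pointLaw
  infer_instance

instance : IsProbabilityMeasure tapeLaw := by
  unfold tapeLaw
  infer_instance

theorem pointLaw_real_forall_mem (T : Finset ℕ) (A : ℕ → Finset (Point d q)) :
    (pointLaw d q).real {x | ∀ i ∈ T, x i ∈ A i} = ∏ i ∈ T, ((A i).card / q ^ d : ℝ) := by
  have hm : ∀ B : Finset (Point d q), MeasurableSet (B : Set (Point d q)) :=
    fun B => B.finite_toSet.measurableSet
  have h : {x : ℕ → Point d q | ∀ i ∈ T, x i ∈ A i} =
      Set.pi (T : Set ℕ) fun i => (A i : Set (Point d q)) := by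
    ext x; simp [Set.mem_pi]
  rw [h, measureReal_def, pointLaw, Measure.infinitePi_pi _ fun i _ => hm _, ENNReal.toReal_prod]
  refine Finset.prod_congr rfl fun i _ => ?_
  rw [← measureReal_def, uniform_real_finset (hm _)]
  simp

/-- The event is split according to the value of `x v`. By independence each of the `q ^ d` values
contributes at most the probability of a Hamming ball divided by `q ^ d`. -/
theorem pointLaw_real_hammingDist_le {u v k : ℕ} (huv : u ≠ v) (hk : k ≤ d) :
    (pointLaw d q).real {x | hammingDist (x u) (x v) ≤ k} ≤ d.choose k * (q ^ k / q ^ d : ℝ) := by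
  classical
  have hq : (0 : ℝ) < q ^ d := by
    have := NeZero.pos q
    positivity
  have hsub : {x : ℕ → Point d q | hammingDist (x u) (x v) ≤ k} ⊆
      ⋃ z ∈ (Finset.univ : Finset (Point d q)), {x | ∀ i ∈ ({u, v} : Finset ℕ),
        x i ∈ if i = v then {z} else Finset.univ.filter fun y => hammingDist y z ≤ k} := by
    intro x hx
    simp only [Set.mem_iUnion]
    refine ⟨x v, Finset.mem_univ _, ?_⟩
    have : hammingDist (x u) (x v) ≤ k := hx
    simp [huv, this]
  refine (measureReal_mono hsub (measure_ne_top _ _)).trans ((measureReal_biUnion_finset_le _ _).trans ?_)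
  have hz : ∀ z : Point d q, (pointLaw d q).real {x | ∀ i ∈ ({u, v} : Finset ℕ),
      x i ∈ if i = v then {z} else Finset.univ.filter fun y => hammingDist y z ≤ k} ≤
      d.choose k * (q ^ k / q ^ d : ℝ) / q ^ d := by
    intro z
    rw [pointLaw_real_forall_mem, Finset.prod_pair huv]
    simp only [huv, if_false, if_true, Finset.card_singleton, Nat.cast_one]
    rw [mul_one_div, ← mul_div_assoc]
    gcongr
    exact_mod_cast card_filter_hammingDist_le z hk
  refine (Finset.sum_le_sum fun z _ => hz z).trans_eq ?_
  simp only [Finset.sum_const, Finset.card_univ, Fintype.card_fun, Fintype.card_fin, nsmul_eq_mul,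
    Nat.cast_pow]
  field_simp

/-- The left side is one term of the binomial expansion of the right side, or zero. -/
theorem choose_mul_pow_le_one_add_pow (N m : ℕ) {x : ℝ} (hx : 0 ≤ x) :
    N.choose m * x ^ m ≤ (1 + x) ^ N := by
  rw [add_comm, add_pow]
  rcases le_or_gt m N with h | h
  · refine le_trans (le_of_eq ?_) (Finset.single_le_sum (f := fun m => x ^ m * 1 ^ (N - m) *
      (N.choose m : ℝ)) (fun i _ => by positivity) (Finset.mem_range_succ_iff.2 h))
    simp [mul_comm]
  · rw [Nat.choose_eq_zero_of_lt h, Nat.cast_zero, zero_mul]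
    exact Finset.sum_nonneg fun i _ => by positivity

/-- A union bound over the sets of `m` names whose points all lie in `A`. The number of these sets
times `b ^ m` is rewritten with `(2 * b) ^ m / 2 ^ m`, which leaves a geometrically decreasing
factor. Injectivity of `f` provides the independence. -/
theorem pointLaw_real_card_filter_ge {P₀ : Finset ℕ} {f : ℕ → ℕ} (hf : Set.InjOn f P₀)
    {A : Finset (Point d q)} {b : ℝ} (hA : (A.card / q ^ d : ℝ) ≤ b) (m : ℕ) :
    (pointLaw d q).real {x | m ≤ (P₀.filter fun s => x (f s) ∈ A).card} ≤
      (1 + 2 * b) ^ P₀.card / 2 ^ m := by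
  classical
  have hb : 0 ≤ b := le_trans (by positivity) hA
  have hsub : {x : ℕ → Point d q | m ≤ (P₀.filter fun s => x (f s) ∈ A).card} ⊆
      ⋃ W ∈ P₀.powersetCard m, {x | ∀ i ∈ W.image f, x i ∈ A} := by
    intro x hx
    obtain ⟨W, hW, hWm⟩ := Finset.exists_subset_card_eq (show m ≤ _ from hx)
    simp only [Set.mem_iUnion]
    refine ⟨W, Finset.mem_powersetCard.2 ⟨hW.trans (Finset.filter_subset _ _), hWm⟩, ?_⟩
    intro i hi
    obtain ⟨s, hs, rfl⟩ := Finset.mem_image.1 hi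
    exact (Finset.mem_filter.1 (hW hs)).2
  refine (measureReal_mono hsub (measure_ne_top _ _)).trans ((measureReal_biUnion_finset_le _ _).trans ?_)
  have hW : ∀ W ∈ P₀.powersetCard m,
      (pointLaw d q).real {x | ∀ i ∈ W.image f, x i ∈ A} ≤ b ^ m := by
    intro W hW
    obtain ⟨h1, h2⟩ := Finset.mem_powersetCard.1 hW
    rw [pointLaw_real_forall_mem _ fun _ => A, Finset.prod_const,
      Finset.card_image_of_injOn (hf.mono (by exact_mod_cast h1)), h2]
    gcongr
  refine (Finset.sum_le_sum hW).trans ?_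
  rw [Finset.sum_const, Finset.card_powersetCard, nsmul_eq_mul, le_div_iff₀ (by positivity),
    mul_assoc, ← mul_pow, mul_comm b]
  exact choose_mul_pow_le_one_add_pow _ _ (by positivity)

end law

/-- The binomial coefficient is at most `16 ^ R * (17 / 16) ^ d`. After taking eighth powers, `17 ^
8 ≤ 2 ^ 33` leaves a factor `2 ^ (7 * d) ≥ n ^ (7 * R)` to pay for `n ^ 24` and the constants. This
works once `7 * R > 24`, that is `R ≥ 4`, which is why the keys skip three coordinates. -/
theorem choose_mul_two_pow_le {n d R : ℕ} (hn : 2 ^ 44 ≤ n) (hR : 4 ≤ R) (h : n ^ R ≤ 2 ^ d) :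
    4 * n ^ 3 * (d.choose R * 2 ^ R) ≤ 2 ^ d := by
  have h1 : d.choose R * 16 ^ d ≤ 16 ^ R * 17 ^ d := by
    have := choose_mul_pow_le_one_add_pow d R (x := 1 / 16) (by norm_num)
    have e : (1 + 1 / 16 : ℝ) = 17 / 16 := by norm_num
    rw [e, div_pow, div_pow, one_pow, mul_one_div, div_le_div_iff₀ (by positivity)
      (by positivity)] at this
    rw [mul_comm (16 ^ R)]
    exact_mod_cast this
  have h2 : 4 * n ^ 3 * 32 ^ R * 17 ^ d ≤ 32 ^ d := by
    obtain ⟨j, rfl⟩ := Nat.exists_eq_add_of_le hR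
    rw [← Nat.pow_le_pow_iff_left (n := 8) (by norm_num)]
    have h32 : ∀ k, 32 ^ k = (2 ^ k) ^ 5 := fun k => by rw [← pow_mul, mul_comm, pow_mul]; norm_num
    have h17 : (17 ^ d) ^ 8 ≤ (2 ^ d) ^ 33 := by
      rw [← pow_mul, ← pow_mul, mul_comm, mul_comm d, pow_mul, pow_mul]
      exact Nat.pow_le_pow_left (by norm_num) d
    -- The left side consists of `4 ^ 8` and `32 ^ (4 * 8)`, together `(2 ^ 44) ^ 4`. This is the
    -- origin of the threshold for `n`.
    have ha : 2 ^ 16 * 2 ^ 160 ≤ n ^ 4 :=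
      le_trans (by norm_num) (Nat.pow_le_pow_left hn 4)
    have hb : (2 ^ j) ^ 40 ≤ (n ^ j) ^ 7 := by
      rw [← pow_mul, ← pow_mul, mul_comm, mul_comm j, pow_mul, pow_mul]
      exact Nat.pow_le_pow_left (le_trans (by norm_num) (Nat.pow_le_pow_left hn 7)) j
    rw [h32, h32]
    calc (4 * n ^ 3 * (2 ^ (4 + j)) ^ 5 * 17 ^ d) ^ 8
        = n ^ 24 * (2 ^ 16 * 2 ^ 160) * (2 ^ j) ^ 40 * (17 ^ d) ^ 8 := by ring
      _ ≤ n ^ 24 * n ^ 4 * (n ^ j) ^ 7 * (2 ^ d) ^ 33 := by gcongr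
      _ = (n ^ (4 + j)) ^ 7 * (2 ^ d) ^ 33 := by ring
      _ ≤ (2 ^ d) ^ 7 * (2 ^ d) ^ 33 := by gcongr
      _ = ((2 ^ d) ^ 5) ^ 8 := by ring
  refine Nat.le_of_mul_le_mul_right ?_ (show 0 < 16 ^ d by positivity)
  calc 4 * n ^ 3 * (d.choose R * 2 ^ R) * 16 ^ d
      = 4 * n ^ 3 * 2 ^ R * (d.choose R * 16 ^ d) := by ring
    _ ≤ 4 * n ^ 3 * 2 ^ R * (16 ^ R * 17 ^ d) := by gcongr
    _ = 4 * n ^ 3 * 32 ^ R * 17 ^ d := by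
        rw [show (32 : ℕ) = 2 * 16 by norm_num, mul_pow]
        ring
    _ ≤ 32 ^ d := h2
    _ = 2 ^ d * 16 ^ d := by rw [← mul_pow]; norm_num

/-! ### Distinctness of the points in use -/

section roster
variable {n : ℕ} {side : ℕ → Bool} {ops : ℕ → Op n}

theorem roster_lt {t : ℕ} {s : Fin (2 * n)} {b : Bool} {u : ℕ}
    (h : roster n side ops t s = some (b, u)) : u < n + t := by
  induction t with
  | zero =>
    simp only [roster] at h
    split_ifs at h with hs
    cases h
    simpa using hs
  | succ t ih =>
    cases ho : ops t with
    | insert a c =>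
      simp only [roster, ho, Function.update_apply] at h
      split_ifs at h with hs
      · cases h; omega
      · have := ih h; omega
    | delete a =>
      simp only [roster, ho, Function.update_apply] at h
      split_ifs at h with hs
      have := ih h
      omega
    | enumerate =>
      simp only [roster, ho] at h
      have := ih h
      omega

/-- Each insertion brings a new index `n + t`, larger than all indices used before. The points in
use are therefore independent under the law of the sequence. -/
theorem roster_inj {t : ℕ} {s s' : Fin (2 * n)} {b b' : Bool} {u : ℕ}
    (h : roster n side ops t s = some (b, u)) (h' : roster n side ops t s' = some (b', u)) :
    s = s' := by
  induction t with
  | zero =>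
    simp only [roster] at h h'
    split_ifs at h h'
    simp only [Option.some.injEq, Prod.mk.injEq] at h h'
    exact Fin.ext (h.2.trans h'.2.symm)
  | succ t ih =>
    cases ho : ops t with
    | insert a c =>
      simp only [roster, ho, Function.update_apply] at h h'
      split_ifs at h h' with hs hs' hs'
      · rw [hs, hs']
      · cases h
        exact absurd (roster_lt h') (lt_irrefl _)
      · cases h'
        exact absurd (roster_lt h) (lt_irrefl _)
      · exact ih h h'
    | delete a =>
      simp only [roster, ho, Function.update_apply] at h h'
      split_ifs at h h'
      exact ih h h'
    | enumerate =>
      simp only [roster, ho] at h h'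
      exact ih h h'

/-- The points in use have pairwise distinct indices. -/
theorem exists_index (t : ℕ) : ∃ f : ℕ → ℕ, Set.InjOn f (namesOf (roster n side ops t)) ∧
    ∀ {d q : ℕ} (x : ℕ → Point d q), ∀ s ∈ namesOf (roster n side ops t),
      (dbOf (roster n side ops t) x s).2 = (x (f s)).coord := by
  set ρ := roster n side ops t with hρ
  have h : ∀ s, ∃ u, s ∈ namesOf ρ → ∃ (h : s < 2 * n) (b : Bool), ρ ⟨s, h⟩ = some (b, u) := by
    intro s
    by_cases hs : s ∈ namesOf ρ
    · obtain ⟨h, h'⟩ := mem_namesOf.1 hs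
      obtain ⟨⟨b, u⟩, hu⟩ := Option.ne_none_iff_exists'.1 h'
      exact ⟨u, fun _ => ⟨h, b, hu⟩⟩
    · exact ⟨0, fun h => absurd h hs⟩
  choose f hf using h
  refine ⟨f, fun s hs s' hs' hss => ?_, fun x s hs => ?_⟩
  · obtain ⟨h, b, hb⟩ := hf s hs
    obtain ⟨h', b', hb'⟩ := hf s' hs'
    rw [← hss] at hb'
    exact Fin.mk.inj (roster_inj hb hb')
  · obtain ⟨h, b, hb⟩ := hf s hs
    rw [show dbOf ρ x s = _ from dbOf_some (s := ⟨s, h⟩) hb]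

theorem card_namesOf_le (ρ : Fin (2 * n) → Option (Bool × ℕ)) : (namesOf ρ).card ≤ 2 * n := by
  refine (Finset.card_filter_le _ _).trans ?_
  rw [Finset.card_range]

theorem dbOf_side_ne {d q : ℕ} {ρ : Fin (2 * n) → Option (Bool × ℕ)} {x : ℕ → Point d q} {a b : ℕ}
    (ha : (dbOf ρ x a).1 = 1) (hb : (dbOf ρ x b).1 = 0) : a ≠ b := by
  rintro rfl
  omega

end roster

/-! ### The probability of fairness -/

namespace Par
variable {φ : JoinMetric} {K L n d q R : ℕ}

/-- The probability is at most `1 / M + 1 / q ^ c` for `c` used coordinates. Here `1 / M ≤ K / n`,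
and `q ^ c ≥ 2 ^ (D - 3) ≥ n / 8` since at most three coordinates are skipped. -/
theorem card_filter_key_div_le (hq : 2 ≤ q) (hn : 2 ≤ n) (hK : 0 < K) (hD : Nat.clog 2 n ≤ d)
    (S k : ℕ) :
    ((Finset.univ.filter fun y : Point d q =>
      (ofSize φ K L n d q R).key S y.coord = k).card / q ^ d : ℝ) ≤ (K + 8) / n := by
  have h := card_filter_key_le (p := ofSize φ K L n d q R) hD S k
  have hc := le_card_used (p := ofSize φ K L n d q R) S
  have hcd : ((ofSize φ K L n d q R).used S (Nat.clog 2 n)).card ≤ d := by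
    refine le_trans ?_ hD
    exact (Finset.card_filter_le _ _).trans_eq (Finset.card_range _)
  set c := ((ofSize φ K L n d q R).used S (ofSize φ K L n d q R).D).card with hcdef
  have hcd : c ≤ d := hcd
  simp only [ofSize] at h hc
  have hM : (n : ℝ) ≤ K * (n / K + 1 : ℕ) := by
    exact_mod_cast (Nat.lt_mul_div_succ n hK).le
  have h8 : n ≤ 8 * q ^ c := calc
    n ≤ 2 ^ Nat.clog 2 n := Nat.le_pow_clog (by norm_num) n
    _ ≤ 2 ^ (3 + c) := Nat.pow_le_pow_right (by norm_num) (by omega)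
    _ = 8 * 2 ^ c := by rw [pow_add]; norm_num
    _ ≤ 8 * q ^ c := Nat.mul_le_mul_left _ (Nat.pow_le_pow_left hq c)
  have h8 : (n : ℝ) ≤ 8 * q ^ c := by exact_mod_cast h8
  have hn0 : (0 : ℝ) < n := by exact_mod_cast (by omega : 0 < n)
  have hq0 : (0 : ℝ) < q := by exact_mod_cast (by omega : 0 < q)
  have hM0 : (0 : ℝ) < (n / K + 1 : ℕ) := by exact_mod_cast Nat.succ_pos _
  have h' : ((Finset.univ.filter fun y : Point d q =>
      (ofSize φ K L n d q R).key S y.coord = k).card : ℝ) ≤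
      (q ^ c / (n / K + 1 : ℕ) + 1) * q ^ (d - c) := by
    refine (Nat.cast_le.2 h).trans ?_
    rw [Nat.cast_mul, Nat.cast_add, Nat.cast_one, Nat.cast_pow]
    gcongr
    exact_mod_cast Nat.cast_div_le
  calc _ ≤ (q ^ c / (n / K + 1 : ℕ) + 1) * q ^ (d - c) / (q : ℝ) ^ d := by gcongr
    _ = 1 / (n / K + 1 : ℕ) + 1 / q ^ c := by
        rw [← Nat.sub_add_cancel hcd, pow_add]
        field_simp
        simp
    _ ≤ K / n + 8 / n := by
        refine add_le_add ?_ ?_ <;> rw [div_le_div_iff₀ (by positivity) hn0]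
        · linarith
        · linarith
    _ = (K + 8) / n := by ring

theorem card_filter_coord_ne_le (x y : Point d q) {D : ℕ} (hD : D ≤ d) :
    ((Finset.range D).filter fun i => x.coord i ≠ y.coord i).card ≤ hammingDist x y := by
  rw [hammingDist]
  refine Finset.card_le_card_of_surjOn (fun i : Fin d => (i : ℕ)) ?_
  intro i hi
  rw [Finset.mem_coe, Finset.mem_filter, Finset.mem_range] at hi
  refine ⟨⟨i, by omega⟩, ?_, rfl⟩
  rw [Finset.mem_coe, Finset.mem_filter]
  refine ⟨Finset.mem_univ _, fun h => hi.2 ?_⟩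
  have hx := x.coord_fin ⟨i, by omega⟩
  have hy := y.coord_fin ⟨i, by omega⟩
  exact hx.trans ((congrArg Fin.val h).trans hy.symm)

/-- Distinct coordinates are distinct integers, so each contributes at least 1 in every metric. This
reduces the three metrics to the Hamming distance. -/
theorem hammingDist_le_gapSum {p : Par} (x y : Point p.d q) :
    hammingDist x y ≤ p.gapSum x.coord y.coord := by
  rw [hammingDist, Finset.card_filter, gapSum, ← Fin.sum_univ_eq_sum_range
    fun i => p.φ.gap (x.coord i) (y.coord i)]
  refine Finset.sum_le_sum fun i _ => ?_
  rw [x.coord_fin, y.coord_fin]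
  split_ifs with h
  · have h : (x i : ℕ) ≠ y i := fun h' => h (Fin.ext h')
    have h1 : 1 ≤ (x i : ℕ) - y i + (y i - x i) := by omega
    cases p.φ with
    | hamming => simp [JoinMetric.gap, h]
    | l1 => exact h1
    | l2 => exact Nat.mul_le_mul h1 h1
  · exact Nat.zero_le _

/-- With at most `2 * n` points the power is at most `exp (4 * K + 32) ≤ 2 ^ (8 * K + 64)`. The
number of buckets is at most `2 ^ (4 * D)` and `n ≤ 2 ^ D`, so the exponent `5 * D + 8 * K + 64` has
to be covered by `L * D + 1`; the lower bound on `L` is chosen for this. -/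
theorem load_bound_le (hn : 2 ≤ n) (hK : 2 ≤ K) (hL : 8 * K + 69 ≤ L) {N : ℕ} (hN : N ≤ 2 * n) :
    (Nat.clog 2 n * Nat.clog 2 n * Nat.clog 2 n * (n / K + 1) : ℕ) *
      ((1 + 2 * ((K + 8) / n)) ^ N / 2 ^ (L * Nat.clog 2 n + 1) : ℝ) ≤ 1 / n := by
  set D := Nat.clog 2 n with hDdef
  have hD : 0 < D := Nat.clog_pos (by norm_num) hn
  have hn0 : (0 : ℝ) < n := by exact_mod_cast (by omega : 0 < n)
  have h1 : (1 + 2 * ((K + 8) / n) : ℝ) ^ N ≤ 2 ^ (8 * K + 64) := by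
    calc (1 + 2 * ((K + 8) / n) : ℝ) ^ N ≤ (1 + 2 * ((K + 8) / n)) ^ (2 * n) := by
          refine pow_le_pow_right₀ ?_ hN
          have : (0 : ℝ) ≤ 2 * ((K + 8) / n) := by positivity
          linarith
      _ ≤ Real.exp (2 * ((K + 8) / n)) ^ (2 * n) := by
          gcongr
          rw [add_comm]
          exact Real.add_one_le_exp _
      _ = Real.exp 1 ^ (4 * K + 32) := by
          rw [← Real.exp_nat_mul, ← Real.exp_nat_mul]
          congr 1
          push_cast
          field_simp
          ring
      _ ≤ 4 ^ (4 * K + 32) := by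
          gcongr
          linarith [Real.exp_one_lt_d9]
      _ = 2 ^ (8 * K + 64) := by
          rw [show (4 : ℝ) = 2 ^ 2 by norm_num, ← pow_mul]
          congr 1
          ring
  have hlt : D < 2 ^ D := Nat.lt_two_pow_self
  have hnD : n ≤ 2 ^ D := Nat.le_pow_clog (by norm_num) n
  have hM : n / K + 1 ≤ 2 ^ D := by
    have : n / K ≤ n / 2 := Nat.div_le_div_left hK (by norm_num)
    omega
  have h2 : D * D * D * (n / K + 1) ≤ 2 ^ (4 * D) := by
    calc _ ≤ 2 ^ D * 2 ^ D * 2 ^ D * 2 ^ D := by gcongr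
      _ = _ := by ring
  have h3 : 2 ^ (4 * D) * 2 ^ (8 * K + 64) * n ≤ 2 ^ (L * D + 1) := by
    calc _ ≤ 2 ^ (4 * D) * 2 ^ (8 * K + 64) * 2 ^ D := by gcongr
      _ = 2 ^ (4 * D + (8 * K + 64) + D) := by ring
      _ ≤ _ := Nat.pow_le_pow_right (by norm_num) (by nlinarith)
  have h2 : ((D * D * D * (n / K + 1) : ℕ) : ℝ) ≤ 2 ^ (4 * D) := by exact_mod_cast h2
  have h3 : (2 : ℝ) ^ (4 * D) * 2 ^ (8 * K + 64) * n ≤ 2 ^ (L * D + 1) := by exact_mod_cast h3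
  calc _ ≤ (2 : ℝ) ^ (4 * D) * (2 ^ (8 * K + 64) / 2 ^ (L * D + 1)) := by gcongr
    _ ≤ 1 / n := by
      rw [← mul_div_assoc, div_le_div_iff₀ (by positivity) hn0]
      linarith

/-- `B₁` is the event that some bucket is overfull, `B₂` that two points in use are close although
`R ≥ 4` and `n ≥ K`. Each has probability at most `1 / n`, and outside both the structure is fair.
-/
theorem prob_fair [NeZero q] (hq : 2 ≤ q) (hn : 2 ≤ n) (hK : 2 ^ 44 ≤ K) (hL : 8 * K + 69 ≤ L)
    (hD : Nat.clog 2 n ≤ d) (hR : n ^ R ≤ 2 ^ d) (side : ℕ → Bool) (ops : ℕ → Op n) (t : ℕ) :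
    1 - 2 / (n : ℝ) ≤ ((pointLaw d q).prod tapeLaw).real {e | (ofSize φ K L n d q R).Fair
      (dbOf (roster n side ops t) e.1) (namesOf (roster n side ops t))} := by
  classical
  set p := ofSize φ K L n d q R with hp
  set ρ := roster n side ops t with hρ
  have hn0 : (0 : ℝ) < n := by exact_mod_cast (by omega : 0 < n)
  have hD0 : 0 < Nat.clog 2 n := Nat.clog_pos (by norm_num) hn
  have hRd : R ≤ d := (Nat.pow_le_pow_iff_right (a := 2) (by norm_num)).1
    ((Nat.pow_le_pow_left hn R).trans hR)
  obtain ⟨f, hf, hfx⟩ := exists_index (side := side) (ops := ops) t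
  have hN := card_namesOf_le ρ
  set A : ℕ → ℕ → Finset (Point d q) := fun S k => Finset.univ.filter fun y => p.key S y.coord = k
  set B₁ : Set (ℕ → Point d q) := ⋃ e ∈ Finset.range p.E ×ˢ Finset.range p.M,
    {x | p.cap + 1 ≤ ((namesOf ρ).filter fun s => x (f s) ∈ A e.1 e.2).card} with hB₁
  set B₂ : Set (ℕ → Point d q) := ⋃ e ∈ (namesOf ρ ×ˢ namesOf ρ).filter
    fun e => e.1 ≠ e.2 ∧ K ≤ n ∧ 4 ≤ R, {x | hammingDist (x (f e.1)) (x (f e.2)) ≤ R} with hB₂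
  have h₁ : (pointLaw d q).real B₁ ≤ 1 / n := by
    refine (measureReal_biUnion_finset_le _ _).trans ((Finset.sum_le_sum fun e _ =>
      pointLaw_real_card_filter_ge hf
        (card_filter_key_div_le hq hn (by omega) hD e.1 e.2) _).trans ?_)
    rw [Finset.sum_const, Finset.card_product, Finset.card_range, Finset.card_range, nsmul_eq_mul]
    exact load_bound_le hn (by omega) hL hN
  have h₂ : (pointLaw d q).real B₂ ≤ 1 / n := by
    by_cases hc : K ≤ n ∧ 4 ≤ R
    · refine (measureReal_biUnion_finset_le _ _).trans ((Finset.sum_le_sum fun e he =>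
        pointLaw_real_hammingDist_le ?_ hRd).trans ?_)
      · obtain ⟨h1, h2, -⟩ := Finset.mem_filter.1 he
        obtain ⟨h3, h4⟩ := Finset.mem_product.1 h1
        exact fun h => h2 (hf h3 h4 h)
      · rw [Finset.sum_const, nsmul_eq_mul]
        have hcard : ((namesOf ρ ×ˢ namesOf ρ).filter
            fun e => e.1 ≠ e.2 ∧ K ≤ n ∧ 4 ≤ R).card ≤ 4 * n ^ 2 := by
          refine (Finset.card_filter_le _ _).trans ?_
          rw [Finset.card_product]
          exact (Nat.mul_le_mul hN hN).trans_eq (by ring)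
        have hcard : (((namesOf ρ ×ˢ namesOf ρ).filter
            fun e => e.1 ≠ e.2 ∧ K ≤ n ∧ 4 ≤ R).card : ℝ) ≤ 4 * n ^ 2 := by exact_mod_cast hcard
        have hmain : (4 * n ^ 3 * (d.choose R * 2 ^ R) : ℝ) ≤ 2 ^ d := by
          exact_mod_cast choose_mul_two_pow_le (hK.trans hc.1) hc.2 hR
        have hqq : (q ^ R / q ^ d : ℝ) ≤ 2 ^ R / 2 ^ d := by
          have h2 : (2 : ℝ) ≤ q := by exact_mod_cast hq
          rw [← Nat.sub_add_cancel hRd, pow_add, pow_add, div_mul_cancel_right₀ (by positivity),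
            div_mul_cancel_right₀ (by positivity)]
          gcongr
        calc _ ≤ 4 * (n : ℝ) ^ 2 * (d.choose R * (2 ^ R / 2 ^ d)) := by gcongr
          _ = 4 * n ^ 3 * (d.choose R * 2 ^ R) / 2 ^ d * (1 / n) := by field_simp
          _ ≤ 1 * (1 / n) := by
            gcongr
            rwa [div_le_one (by positivity)]
          _ = _ := one_mul _
    · have : B₂ = ∅ := by
        rw [hB₂, Finset.filter_false_of_mem fun e _ h => hc h.2]
        simp
      rw [this, measureReal_empty]
      positivity
  have hfair : ∀ x : ℕ → Point d q, x ∉ B₁ → x ∉ B₂ → p.Fair (dbOf ρ x) (namesOf ρ) := by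
    intro x hx₁ hx₂
    simp only [hB₁, hB₂, Set.mem_iUnion, not_exists] at hx₁ hx₂
    constructor
    · intro S hS k
      by_cases hk : k < p.M
      · have := hx₁ (S, k) (Finset.mem_product.2 ⟨Finset.mem_range.2 hS, Finset.mem_range.2 hk⟩)
        rw [Set.mem_ofPred_eq, not_le, Nat.lt_succ_iff] at this
        refine le_of_eq_of_le ?_ this
        congr 1
        refine Finset.filter_congr fun s hs => ?_
        rw [hfx x s hs, Finset.mem_filter]
        simp
      · rw [Finset.filter_false_of_mem fun s _ h => hk (h.symm.trans_lt
          (p.key_lt (Nat.succ_pos _) _ _)),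
          Finset.card_empty]
        exact Nat.zero_le _
    · intro a ha b hb ha1 hb0 hab
      have hne := dbOf_side_ne ha1 hb0
      rw [hfx x a ha, hfx x b hb] at hab ⊢
      have hd := (hammingDist_le_gapSum (p := p) (x (f a)) (x (f b))).trans hab
      have hE0 : 0 < p.E := Nat.mul_pos (Nat.mul_pos hD0 hD0) hD0
      -- For small `n` there is only one key, so any two points share it. Otherwise either closeness
      -- is excluded by `B₂`, or at most three coordinates differ.
      by_cases hnK : n < K
      · refine ⟨0, hE0, ?_⟩
        have hM : p.M = 1 := by simp [hp, ofSize, Nat.div_eq_of_lt hnK]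
        have h1 := fun y => (p.key_lt (Nat.succ_pos _) 0 y).trans_eq hM
        rw [Nat.lt_one_iff.1 (h1 _), Nat.lt_one_iff.1 (h1 _)]
      · by_cases hR4 : 4 ≤ R
        · exact absurd hd (hx₂ (a, b) (Finset.mem_filter.2 ⟨Finset.mem_product.2 ⟨ha, hb⟩, hne,
            by omega, hR4⟩))
        · refine exists_key_eq hD0 rfl ((card_filter_coord_ne_le _ _ hD).trans (hd.trans ?_))
          exact Nat.le_of_lt_succ (not_le.1 hR4)
  -- Fairness depends on the points alone, so the exceptional event is a cylinder over the tape.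
  have hcover : (Set.univ : Set ((ℕ → Point d q) × Tape)) ⊆
      {e | p.Fair (dbOf ρ e.1) (namesOf ρ)} ∪ (B₁ ∪ B₂) ×ˢ Set.univ := by
    rintro ⟨x, ω⟩ -
    by_cases h1 : x ∈ B₁
    · exact .inr ⟨.inl h1, trivial⟩
    · by_cases h2 : x ∈ B₂
      · exact .inr ⟨.inr h2, trivial⟩
      · exact .inl (hfair x h1 h2)
  have h := (measureReal_mono (μ := (pointLaw d q).prod tapeLaw) hcover).trans
    (measureReal_union_le _ _)
  rw [probReal_univ, measureReal_prod_prod, probReal_univ, mul_one] at h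
  have h' := measureReal_union_le (μ := pointLaw d q) B₁ B₂
  have : (2 / n : ℝ) = 1 / n + 1 / n := by ring
  linarith

end Par

/-! ### Word size, time and space in terms of `n`, `d` and `q` -/

namespace Par
variable {φ : JoinMetric} {K L n d q R : ℕ}

theorem fits_ofSize (hn : 2 ≤ n) (hq : 2 ≤ q) (hD : Nat.clog 2 n ≤ d) (hR : R ≤ d)
    (hK : K ≤ 2 ^ 48) (hL : L ≤ 2 ^ 48) :
    (ofSize φ K L n d q R).Fits (21 * (Nat.log 2 (n * d * q) + 1)) ∧
      K + L + R + (n * d + 2 * n + 10) < 2 ^ (21 * (Nat.log 2 (n * d * q) + 1)) := by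
  have hD0 : 0 < Nat.clog 2 n := Nat.clog_pos (by norm_num) hn
  have hd0 : 1 ≤ d := by omega
  have hMn : n / K + 1 ≤ n + 1 := Nat.succ_le_succ (Nat.div_le_self n K)
  set Z := 2 ^ (Nat.log 2 (n * d * q) + 1) with hZdef
  have hZ : n * d * q < Z := Nat.lt_pow_succ_log_self (by norm_num) _
  have h4 : 2 * 1 * 2 ≤ n * d * q := by gcongr
  have h8 : 8 ≤ Z := by
    have : 2 ≤ Nat.log 2 (n * d * q) :=
      (Nat.le_log_iff_pow_le (by norm_num) (by omega)).2 (by omega)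
    exact le_trans (by norm_num) (Nat.pow_le_pow_right (n := 2) (i := 3) (by norm_num) (by omega))
  have hnZ : n < Z := by
    refine lt_of_le_of_lt ?_ hZ
    calc n = n * 1 * 1 := by ring
      _ ≤ n * d * q := by gcongr; omega
  have hdZ : d ≤ Z := by
    refine le_trans ?_ hZ.le
    calc d = 1 * d * 1 := by ring
      _ ≤ n * d * q := by gcongr <;> omega
  have hqZ : q ≤ Z := by
    refine le_trans ?_ hZ.le
    calc q = 1 * 1 * q := by ring
      _ ≤ n * d * q := by gcongr; omega
  have hmono : ∀ a b c e, a ≤ Z → b ≤ Z → c ≤ Z → e ≤ Z → a * b * c * e ≤ Z ^ 4 := by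
    intro a b c e ha hb hc he
    calc a * b * c * e ≤ Z * Z * Z * Z := by gcongr
      _ = Z ^ 4 := by ring
  have h1Z : 1 ≤ Z := by omega
  have hDZ : Nat.clog 2 n ≤ Z := hD.trans hdZ
  have hMZ : n / K + 1 ≤ Z := by omega
  -- All quantities add up to at most `2 ^ 50 * Z ^ 4`. As `n * d * q ≥ 4` forces `Z ≥ 8`, seventeen
  -- further factors `Z` absorb the constant; hence the word size factor 21.
  have hbig : 2 ^ 50 * Z ^ 4 < Z ^ 21 := calc
    2 ^ 50 * Z ^ 4 < 8 ^ 17 * Z ^ 4 := by gcongr; norm_num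
    _ ≤ Z ^ 17 * Z ^ 4 := by gcongr
    _ = Z ^ 21 := by ring
  have e1 := hmono 1 1 1 1 h1Z h1Z h1Z h1Z
  have e2 := hmono n _ _ _ hnZ.le hDZ hDZ hDZ
  have e3 := hmono _ _ _ _ hMZ hDZ hDZ hDZ
  have e4 := hmono n d 1 1 hnZ.le hdZ h1Z h1Z
  have e5 := hmono n 1 1 1 hnZ.le h1Z h1Z h1Z
  have e6 := hmono _ q 1 1 hMZ hqZ h1Z h1Z
  have e7 := hmono q 1 1 1 hqZ h1Z h1Z h1Z
  have e8 := hmono d q q 1 hdZ hqZ hqZ h1Z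
  have e9 := hmono q q 1 1 hqZ hqZ h1Z h1Z
  have e10 := hmono d 1 1 1 hdZ h1Z h1Z h1Z
  have e11 := hmono _ _ _ 1 hDZ hDZ hDZ h1Z
  have e12 : L * Nat.clog 2 n ≤ 2 ^ 48 * Z ^ 4 :=
    Nat.mul_le_mul hL (by simpa using hmono _ 1 1 1 hDZ h1Z h1Z h1Z)
  rw [mul_comm 21, pow_mul, ← hZdef]
  refine ⟨⟨Nat.succ_pos _,
    Nat.mul_pos (Nat.mul_pos hD0 hD0) hD0, hD, ?_⟩, ?_⟩
  · rw [pow_mul, ← hZdef]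
    simp only [space, ofSize]
    refine lt_of_le_of_lt ?_ hbig
    simp only [mul_one, mul_assoc] at *
    omega
  · simp only [mul_one] at *
    omega

/-- All resource bounds are compared with this one monomial. Its degree 8 in `D` comes from an
update: `D ^ 3` tables, `(L * D) ^ 2` pairs in a bucket, and up to `D ^ 3` keys compared for a pair.
-/
theorem monomial_le {a b c : ℕ} {D : ℕ} (hL : 0 < L) (hd : 0 < d) (hD : 0 < D) (ha : a ≤ 2)
    (hb : b ≤ 1) (hc : c ≤ 8) : L ^ a * d ^ b * D ^ c ≤ L ^ 2 * d * D ^ 8 := by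
  have := Nat.pow_le_pow_right hd hb
  rw [pow_one] at this
  gcongr

theorem updateTime_ofSize_le (hL : 0 < L) (hd : 0 < d) (hn : 2 ≤ n) :
    (ofSize φ K L n d q R).updateTime + 50 ≤ 2000 * (L ^ 2 * d * Nat.clog 2 n ^ 8) := by
  have hD : 0 < Nat.clog 2 n := Nat.clog_pos (by norm_num) hn
  simp only [updateTime, stepTime, refreshTime, visitTime, pairTime, ofSize]
  generalize Nat.clog 2 n = D at *
  have h := fun {a b c} => monomial_le (L := L) (d := d) (D := D) (a := a) (b := b) (c := c) hL hd hD
  have h1 := h (a := 0) (b := 0) (c := 0) (by norm_num) (by norm_num) (by norm_num)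
  have h2 := h (a := 0) (b := 1) (c := 0) (by norm_num) (by norm_num) (by norm_num)
  have h3 := h (a := 0) (b := 0) (c := 3) (by norm_num) (by norm_num) (by norm_num)
  have h4 := h (a := 0) (b := 0) (c := 4) (by norm_num) (by norm_num) (by norm_num)
  have h5 := h (a := 1) (b := 0) (c := 4) (by norm_num) (by norm_num) (by norm_num)
  have h6 := h (a := 2) (b := 1) (c := 5) (by norm_num) (by norm_num) (by norm_num)
  have h7 := h (a := 2) (b := 0) (c := 8) (by norm_num) (by norm_num) (by norm_num)
  have h8 := h (a := 2) (b := 0) (c := 5) (by norm_num) (by norm_num) (by norm_num)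
  linarith

theorem delayTime_ofSize_le (hL : 0 < L) (hd : 0 < d) (hn : 2 ≤ n) :
    (ofSize φ K L n d q R).delayTime ≤ 2200 * (L ^ 2 * d * Nat.clog 2 n ^ 8) := by
  have hD : 0 < Nat.clog 2 n := Nat.clog_pos (by norm_num) hn
  simp only [delayTime, visitTime, pairTime, ofSize]
  generalize Nat.clog 2 n = D at *
  have h := fun {a b c} => monomial_le (L := L) (d := d) (D := D) (a := a) (b := b) (c := c) hL hd hD
  have h1 := h (a := 0) (b := 0) (c := 0) (by norm_num) (by norm_num) (by norm_num)
  have h2 := h (a := 1) (b := 0) (c := 1) (by norm_num) (by norm_num) (by norm_num)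
  have h3 := h (a := 2) (b := 1) (c := 2) (by norm_num) (by norm_num) (by norm_num)
  have h4 := h (a := 2) (b := 0) (c := 5) (by norm_num) (by norm_num) (by norm_num)
  have h5 := h (a := 2) (b := 0) (c := 2) (by norm_num) (by norm_num) (by norm_num)
  linarith

theorem buildTime_ofSize_le (hL : 0 < L) (hd : 0 < d) (hn : 2 ≤ n) :
    100 + (ofSize φ K L n d q R).D * 20 + n * ((ofSize φ K L n d q R).updateTime + 50) ≤
      2200 * (L ^ 2 * (n * d) * Nat.clog 2 n ^ 8) := by
  have hD : 0 < Nat.clog 2 n := Nat.clog_pos (by norm_num) hn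
  have h0 := updateTime_ofSize_le (φ := φ) (K := K) (q := q) (R := R) hL hd hn
  have h1 := monomial_le (L := L) (d := d) (a := 0) (b := 0) (c := 0) hL hd hD (by norm_num)
    (by norm_num) (by norm_num)
  have h2 := monomial_le (L := L) (d := d) (a := 0) (b := 0) (c := 1) hL hd hD (by norm_num)
    (by norm_num) (by norm_num)
  have h3 : 100 + (ofSize φ K L n d q R).D * 20 ≤ 200 * (L ^ 2 * d * Nat.clog 2 n ^ 8) := by
    simp only [ofSize]
    linarith
  calc _ ≤ n * (200 * (L ^ 2 * d * Nat.clog 2 n ^ 8)) +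
        n * (2000 * (L ^ 2 * d * Nat.clog 2 n ^ 8)) := by
        gcongr
        exact h3.trans (Nat.le_mul_of_pos_left _ (by omega))
    _ = _ := by ring

theorem space_ofSize_le (hL : 0 < L) (hd : 0 < d) (hn : 2 ≤ n) :
    (ofSize φ K L n d q R).space ≤ 2200 * (L ^ 2 * (n * d) * Nat.clog 2 n ^ 8) := by
  have hD : 0 < Nat.clog 2 n := Nat.clog_pos (by norm_num) hn
  have hM : n / K + 1 ≤ n * 2 := by
    have := Nat.div_le_self n K
    omega
  have h := fun {a b c} => monomial_le (L := L) (d := d) (a := a) (b := b) (c := c) hL hd hD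
  have h1 := h (a := 0) (b := 0) (c := 0) (by norm_num) (by norm_num) (by norm_num)
  have h2 := h (a := 0) (b := 0) (c := 3) (by norm_num) (by norm_num) (by norm_num)
  have h3 := h (a := 0) (b := 1) (c := 0) (by norm_num) (by norm_num) (by norm_num)
  simp only [space, ofSize]
  generalize Nat.clog 2 n = D at *
  calc _ ≤ 64 * (2 * n * (D * D * D)) + 64 * (n * 2 * (D * D * D)) + 16 * (2 * n * d) +
        8 * (2 * n) + 1000 * n := by
        gcongr
        omega
    _ = n * (256 * (D * D * D) + 32 * d + 1016) := by ring
    _ ≤ _ := by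
        rw [mul_left_comm _ n, mul_assoc n, mul_left_comm _ n]
        gcongr
        linarith

end Par

/-! ### Conversion to logarithms, and the main theorem -/

theorem JoinMetric.floor_pow_mul_le {d : ℕ} {r l : ℝ} (φ : JoinMetric) (hr : 0 < r) (hl : 0 ≤ l)
    (h : max 1 r ^ φ.exponent * l ≤ d) : l ≤ d ∧ ⌊r ^ φ.exponent⌋₊ * l ≤ d := by
  constructor
  · refine le_trans (le_mul_of_one_le_left hl ?_) h
    exact one_le_pow₀ (le_max_left _ _)
  · refine le_trans (mul_le_mul_of_nonneg_right ?_ hl) h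
    refine (Nat.floor_le (by positivity)).trans ?_
    exact pow_le_pow_left₀ hr.le (le_max_right _ _) _

theorem clog_le_two_mul_logb {n : ℕ} (h : 1 ≤ Real.logb 2 n) :
    (Nat.clog 2 n : ℝ) ≤ 2 * Real.logb 2 n := by
  have h1 := Real.natCeil_logb_natCast 2 n
  have h2 := Nat.ceil_lt_add_one (zero_le_one.trans h)
  rw [Nat.cast_ofNat] at h1
  rw [h1] at h2
  linarith

theorem natCast_le_mul_logb_pow {n m a y L k : ℕ} (hn : 1 ≤ Real.logb 2 n)
    (h : m ≤ a * (L * y * Nat.clog 2 n ^ k)) :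
    (m : ℝ) ≤ (a * L * 2 ^ k : ℕ) * y * Real.logb 2 n ^ k := by
  have := clog_le_two_mul_logb hn
  calc (m : ℝ) ≤ a * (L * y * Nat.clog 2 n ^ k) := by exact_mod_cast h
    _ ≤ a * (L * y * (2 * Real.logb 2 n) ^ k) := by gcongr
    _ = _ := by push_cast; rw [mul_pow]; ring

theorem mainTheorem12 (φ : JoinMetric) :
    ∃ (P : JoinStructure) (κ C c : ℕ),
      ∀ (n d q : ℕ) [NeZero q] (r : ℝ) (side : ℕ → Bool) (ops : ℕ → Op n),
        2 ≤ n → 2 ≤ q → 0 < r →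
        max 1 r ^ φ.exponent * Real.logb 2 n ≤ d →
        ValidOps n side ops →
        ∃ σ : (ℕ → Point d q) × Tape → ℕ → Config,
          (∀ p, IsRun φ P (κ * (Nat.log 2 (n * d * q) + 1)) r side ops p.1 p.2 (σ p)) ∧
          (∀ p t, ((σ p t).size : ℝ) ≤ C * (n * d) * Real.logb 2 n ^ c) ∧
          (∀ p, ((σ p 0).time : ℝ) ≤ C * (n * d) * Real.logb 2 n ^ c) ∧
          (∀ p t, ops t ≠ Op.enumerate →
            ((σ p (t + 1)).time : ℝ) ≤ C * d * Real.logb 2 n ^ c) ∧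
          (∀ t, ops t = Op.enumerate →
            1 - 2 / (n : ℝ) ≤ ((pointLaw d q).prod tapeLaw).real
              {p | (σ p (t + 1)).Reports (IsResult φ r side ops p.1 t) ∧
                (σ p (t + 1)).DelayAtMost (C * d * Real.logb 2 n ^ c)}) := by
  -- `K` is the threshold for `n` in the estimate of close pairs, and `L` is large enough for the
  -- bound on the loads. The existential hides the numerals, so that they are never unfolded.
  obtain ⟨K, L, hK, hL, hK', hL', hL0⟩ : ∃ K L : ℕ, 2 ^ 44 ≤ K ∧ 8 * K + 69 ≤ L ∧ K ≤ 2 ^ 48 ∧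
      L ≤ 2 ^ 48 ∧ 0 < L :=
    ⟨2 ^ 44, 2 ^ 48, by norm_num, by norm_num, by norm_num, by norm_num, by norm_num⟩
  -- 2200 is the largest coefficient in the resource bounds, and `2 ^ 8` pays for replacing
  -- `Nat.clog 2 n` by twice the logarithm in an eighth power.
  refine ⟨φ.structure K L, 21, 2200 * L ^ 2 * 2 ^ 8, 8, ?_⟩
  intro n d q _ r side ops hn hq hr hd hops
  have hlog : 1 ≤ Real.logb 2 n := by
    rw [Real.le_logb_iff_rpow_le (by norm_num) (by positivity), Real.rpow_one]
    exact_mod_cast hn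
  obtain ⟨hld, hRd⟩ := φ.floor_pow_mul_le hr (by linarith) hd
  have hceil : ⌈Real.logb 2 n⌉₊ = Nat.clog 2 n := by
    simpa using Real.natCeil_logb_natCast 2 n
  have hD : Nat.clog 2 n ≤ d := hceil ▸ Nat.ceil_le.2 hld
  have hd0 : 0 < d := by
    have : (1 : ℝ) ≤ d := hlog.trans hld
    exact_mod_cast this
  -- The hypothesis on `r` after exponentiation, in the form used for counting close pairs.
  have hnR : n ^ ⌊r ^ φ.exponent⌋₊ ≤ 2 ^ d := by
    have h : Real.logb 2 ((n : ℝ) ^ ⌊r ^ φ.exponent⌋₊) ≤ Real.logb 2 (2 ^ d) := by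
      rw [Real.logb_pow, Real.logb_pow, Real.logb_self_eq_one (by norm_num), mul_one]
      exact hRd
    have := (Real.logb_le_logb (by norm_num) (by positivity) (by positivity)).1 h
    exact_mod_cast this
  have hRd' : ⌊r ^ φ.exponent⌋₊ ≤ d := (Nat.pow_le_pow_iff_right (a := 2) (by norm_num)).1
    ((Nat.pow_le_pow_left hn _).trans hnR)
  obtain ⟨hfit, hlt⟩ := Par.fits_ofSize (φ := φ) hn hq hD hRd' hK' hL'
  choose σ hrun hsize hbuild hop using fun e : (ℕ → Point d q) × Tape =>
    exists_isRun (x := e.1) (ω := e.2) hfit rfl (by omega) (by omega) (by omega) (by omega) hr hops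
  refine ⟨σ, hrun, fun e t => ?_, fun e => ?_, fun e t ht => ?_, fun t ht => ?_⟩
  · exact (natCast_le_mul_logb_pow hlog ((hsize e t).trans (Par.space_ofSize_le hL0 hd0 hn))).trans_eq (by rw [Nat.cast_mul n])
  · exact (natCast_le_mul_logb_pow hlog ((hbuild e).trans (Par.buildTime_ofSize_le hL0 hd0 hn))).trans_eq (by rw [Nat.cast_mul n])
  · exact natCast_le_mul_logb_pow hlog ((((hop e t).update ht).trans (Par.updateTime_ofSize_le hL0 hd0 hn)).trans (by gcongr; norm_num))
  · refine (Par.prob_fair (φ := φ) hq hn hK hL hD hnR side ops t).trans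
      (measureReal_mono (fun e he => ⟨(hop e t).reports ht he, ?_⟩) (measure_ne_top _ _))
    refine ((hop e t).delay ht).imp fun {u v} huv => ?_
    have h1 := natCast_le_mul_logb_pow hlog (Par.delayTime_ofSize_le (φ := φ) (K := K) (q := q)
      (R := ⌊r ^ φ.exponent⌋₊) hL0 hd0 hn)
    have h2 : (v : ℝ) ≤ u + (Par.ofSize φ K L n d q ⌊r ^ φ.exponent⌋₊).delayTime := by
      exact_mod_cast huv
    linarith
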